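/- **Setting.** Let $q\in\mathbb C$ be nonzero and not a root of unity, fix a square root $s=q^{1/2}$, let $N\ge 4$, $n=\lfloor N/2\rfloor$, $i'=N-i+1$, and let $m\ge 0$. Put $\rho_i=\frac N2-i$ for $i<i'$, $\rho_i=0$ for $i=i'$, $\rho_{i'}=-\rho_i$, and $$[a]=\frac{1-q^a}{1-q},\qquad [a]_q=\frac{q^a-q^{-a}}{q-q^{-1}},\qquad (a;b)_k=\prod_{j=0}^{k-1}(1-ab^j).$$ Let $\mathcal A$ be the complex algebra generated by $x_1,\dots,x_N$ with the relations $x_ix_j=q\,x_jx_i$ ($i<j$, $j\ne i'$) and $$x_{i'}x_i-x_ix_{i'}=\frac{q-q^{-1}}{q^{\rho_i-1}+q^{1-\rho_i}}\sum_{i<j<i'}q^{\rho_{j'}}x_jx_{j'}\qquad(i<i').$$ The monomials $x^\nu=x_1^{\nu_1}\cdots x_N^{\nu_N}$ form a basis of $\mathcal A$; $\mathcal A_m$ is the span of those of degree $m$. Put $Q=\sum_{i}q^{\rho_{i'}}x_ix_{i'}$. Let $\varepsilon_i$ denote the $i$-th unit vector. **$q$-Laplace operator.** Let $\Delta_q=\sum_{i=1}^Nq^{\rho_i}\partial_i\partial_{i'}$,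 where for $k\le n$ $$\partial_kx^\nu=[\nu_k]_q\,q^{\nu_{k+1}+\dots+\nu_{1'}}x^{\nu-\varepsilon_k},$$ $$\partial_{k'}x^\nu=[\nu_{k'}]_q\,q^{\nu_k+\nu_{(k-1)'}+\dots+\nu_{1'}}x^{\nu-\varepsilon_{k'}}+\sum_{j=k+1}^n[\nu_j]_q[\nu_{j'}]_q(q-q^{-1})q^{\rho_k-\rho_j+d_{kj}}x^{\nu+\varepsilon_k-\varepsilon_j-\varepsilon_{j'}}+R_k,$$ $d_{kj}=\nu_k+\dots+\nu_{j-1}+\nu_{(j-1)'}+\dots+\nu_{1'}$; if $N=2n$, then $R_k=0$; if $N=2n+1$, then $$R_k=[\nu_{n+1}-1][\nu_{n+1}]\frac{q-q^{-1}}{1+q}\,q^{\rho_k+2+(\nu_k+\dots+\nu_{1'})-2\nu_{n+1}}\,x^{\nu+\varepsilon_k-2\varepsilon_{n+1}},\qquad \partial_{n+1}x^\nu=[\nu_{n+1}]\,q^{\nu_{n'}+\dots+\nu_{1'}}x^{\nu-\varepsilon_{n+1}}.$$ Let $\mathcal H_m=\{p\in\mathcal A_m:\Delta_qp=0\}$.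 **Action of $U_q(\mathrm{so}_N)$.** With $\mu_i=\nu_i-\nu_{i'}$, the elements $\hat K_i$, $K_i$, $E_i$, $F_i$ ($1\le i\le n$) act on $\mathcal A$ as follows. $\hat K_ix^\nu=q^{\mu_i}x^\nu$. Let $b=i+1$, and $a=i$, except that $a=n-1$ if $i=n$ and $N=2n$. Then $K_ix^\nu=q^{\mu_a-\mu_b}x^\nu$. If $b\ne b'$, then $$E_ix^\nu=[\nu_b]_q\,q^{\nu_a-\nu_b+1}x^{\nu+\varepsilon_a-\varepsilon_b}-[\nu_{a'}]_q\,q^{\nu_a-\nu_b-\nu_{a'}+\nu_{b'}+1}x^{\nu+\varepsilon_{b'}-\varepsilon_{a'}},$$ $$F_ix^\nu=[\nu_a]_q\,q^{-\nu_a+\nu_b-\nu_{b'}+\nu_{a'}+1}x^{\nu-\varepsilon_a+\varepsilon_b}-[\nu_{b'}]_q\,q^{-\nu_{b'}+\nu_{a'}+1}x^{\nu-\varepsilon_{b'}+\varepsilon_{a'}};$$ if $b=b'$ (that is, $N=2n+1$ and $i=n$), then $$E_ix^\nu=[\nu_b]\,q^{\nu_a-\nu_b+3/2}x^{\nu+\varepsilon_a-\varepsilon_b}-[\nu_{a'}]_q\,q^{\nu_a-\nu_{a'}+1}x^{\nu+\varepsilon_b-\varepsilon_{a'}},$$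 $$F_ix^\nu=[\nu_a]_q\,q^{-\nu_a+\nu_{a'}+1/2}x^{\nu-\varepsilon_a+\varepsilon_b}-[\nu_b]\,q^{-\nu_b+\nu_{a'}+1}x^{\nu-\varepsilon_b+\varepsilon_{a'}}.$$ The counit $\epsilon$ takes the value $1$ on $\hat K_i^{\pm1},K_i^{\pm1}$ and $0$ on $E_i,F_i$. $U_q(\mathrm{so}_2)$ is generated by $\hat K_1^{\pm1}$, and $U_q(\mathrm{so}_{N-2})$ by $K_i^{\pm1},E_i,F_i$ with $2\le i\le n$ (for $N=4$, by $\hat K_2^{\pm1}$). A polynomial $p\in\mathcal H_m$ is *zonal* with respect to $U_q(\mathrm{so}_2)\times U_q(\mathrm{so}_{N-2})$ if $Xp=\epsilon(X)p$ for every $X$ in the subalgebra generated by both. **Theorem.** The space of polynomials in $\mathcal H_m$ that are zonal with respect to $U_q(\mathrm{so}_2)\times U_q(\mathrm{so}_{N-2})$ has dimension at most one. It is nonzero if and only if $m$ is even. If $m=2h$, it is spanned by $$\varphi^m_{h,h}=\sum_{k=0}^{h}\frac{\big((q^{-2h};q^2)_k\big)^2}{(q^2;q^2)_k\,(q^{-N-2m+4};q^2)_k}\;\frac{q^{(6-N)k/2}}{(1+q^{N-2})^k}\;Q^k\,x_1^{h-k}x_{1'}^{h-k},$$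 and $\varphi^m_{h,h}=\mathsf H_m(x_1^hx_{1'}^h)$, where $\mathsf H_m=\sum_{k=0}^{\lfloor m/2\rfloor}\alpha_k\,Q^k\Delta_q^k$ with $$\alpha_k=\frac{q^{2k^2-2mk-k}(1-q^2)^{2k}}{(1+q^{N-2})^{2k}\,(q^{-N-2m+4};q^2)_k\,(q^2;q^2)_k}.$$ -/

import Mathlib

open scoped BigOperators


namespace QuantumEuclid

/-! Throughout, `N` is the number of variables, `s` is a fixed square root of the deformation
parameter `q`, so that `q = s ^ 2` (for even `N` only powers of `q` occur). The indices `1, …, N` are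
the elements of `Fin N` (shifted by one), and `i' = N - i + 1` is `Fin.rev i`. -/

/-- The parameter `q = s ^ 2` is nonzero and not a root of unity. -/
def Admissible (s : ℂ) : Prop := s ≠ 0 ∧ ∀ k : ℕ, 0 < k → (s ^ 2) ^ k ≠ 1

/-- `twoRho i = 2 ρ_i`, an integer, so that `q ^ ρ_i = s ^ twoRho i`; here
`ρ_i = N / 2 - i` for `i < i'`, `ρ_i = 0` for `i = i'` and `ρ_{i'} = - ρ_i` (with `i` one-based). -/
def twoRho {N : ℕ} (i : Fin N) : ℤ :=
  if i < i.rev then (N : ℤ) - 2 - 2 * (i : ℕ)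
  else if i = i.rev then 0
  else -((N : ℤ) - 2 - 2 * (i.rev : ℕ))

/-- The defining relations of the algebra of polynomials on the quantum Euclidean space:
`x_i x_j = q x_j x_i` for `i < j ≠ i'`, and the relations for `x_{i'} x_i` with `i < i'`.
In the last case `i = n` of the relations `conj` the sum is empty if `N = 2 n`, and it is
`x_{n+1} ^ 2` with total coefficient `(q - q⁻¹) / (q ^ (-1/2) + q ^ (1/2)) = q ^ (1/2) - q ^ (-1/2)`
if `N = 2 n + 1`. -/
inductive Rel (N : ℕ) (s : ℂ) : FreeAlgebra ℂ (Fin N) → FreeAlgebra ℂ (Fin N) → Prop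
  | comm (i j : Fin N) (hij : i < j) (hj : j ≠ i.rev) :
      Rel N s (FreeAlgebra.ι ℂ i * FreeAlgebra.ι ℂ j)
        (s ^ 2 • (FreeAlgebra.ι ℂ j * FreeAlgebra.ι ℂ i))
  | conj (i : Fin N) (hi : i < i.rev) :
      Rel N s (FreeAlgebra.ι ℂ i.rev * FreeAlgebra.ι ℂ i)
        (FreeAlgebra.ι ℂ i * FreeAlgebra.ι ℂ i.rev +
          ((s ^ 2 - (s ^ 2)⁻¹) / (s ^ (twoRho i - 2) + s ^ (-twoRho i + 2))) •
            ∑ j ∈ Finset.Ioo i i.rev,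
              s ^ twoRho j.rev • (FreeAlgebra.ι ℂ j * FreeAlgebra.ι ℂ j.rev))

/-- The algebra `A = ℂ_q[x_1, …, x_N]` of polynomials on the quantum Euclidean space. -/
abbrev Alg (N : ℕ) (s : ℂ) : Type := RingQuot (Rel N s)

noncomputable section

/-- The quantum Cartesian coordinate `x_i`. -/
def x {N : ℕ} (s : ℂ) (i : Fin N) : Alg N s :=
  RingQuot.mkAlgHom ℂ (Rel N s) (FreeAlgebra.ι ℂ i)

/-- The ordered monomial `x_1 ^ ν_1 ⋯ x_N ^ ν_N`. -/
def mon {N : ℕ} (s : ℂ) (ν : Fin N → ℕ) : Alg N s :=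
  (List.ofFn fun i => x s i ^ ν i).prod

/-- The squared `q`-radius `Q = ∑ i, q ^ ρ_{i'} x_i x_{i'}`. -/
def Q (N : ℕ) (s : ℂ) : Alg N s :=
  ∑ i : Fin N, s ^ twoRho i.rev • (x s i * x s i.rev)

/-! ### The ordered monomials form a basis

The operators below are defined on the ordered monomials. The next facts prove that these
monomials form a basis of the algebra; the result is `monBasis`. -/

/-- The universal property of the algebra. -/
def lift {N : ℕ} {s : ℂ} {B : Type*} [Ring B] [Algebra ℂ B] (f : Fin N → B)
    (h1 : ∀ i j : Fin N, i < j → j ≠ i.rev → f i * f j = s ^ 2 • (f j * f i))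
    (h2 : ∀ i : Fin N, i < i.rev → f i.rev * f i = f i * f i.rev +
      ((s ^ 2 - (s ^ 2)⁻¹) / (s ^ (twoRho i - 2) + s ^ (-twoRho i + 2))) •
        ∑ j ∈ Finset.Ioo i i.rev, s ^ twoRho j.rev • (f j * f j.rev)) :
    Alg N s →ₐ[ℂ] B :=
  RingQuot.liftAlgHom ℂ ⟨FreeAlgebra.lift ℂ f, by
    intro a b h
    induction h with
    | comm i j hij hj => simpa using h1 i j hij hj
    | conj i hi => simpa using h2 i hi⟩

@[simp] theorem lift_x {N : ℕ} {s : ℂ} {B : Type*} [Ring B] [Algebra ℂ B] (f : Fin N → B)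
    (h1) (h2) (i : Fin N) : lift (s := s) f h1 h2 (x s i) = f i := by
  simp [lift, x]

theorem x_comm {N : ℕ} (s : ℂ) (i j : Fin N) (hij : i < j) (hj : j ≠ i.rev) :
    x s i * x s j = s ^ 2 • (x s j * x s i) := by
  simpa [x] using RingQuot.mkAlgHom_rel ℂ (Rel.comm (s := s) i j hij hj)

theorem x_conj {N : ℕ} (s : ℂ) (i : Fin N) (hi : i < i.rev) :
    x s i.rev * x s i = x s i * x s i.rev +
      ((s ^ 2 - (s ^ 2)⁻¹) / (s ^ (twoRho i - 2) + s ^ (-twoRho i + 2))) •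
        ∑ j ∈ Finset.Ioo i i.rev, s ^ twoRho j.rev • (x s j * x s j.rev) := by
  simpa [x] using RingQuot.mkAlgHom_rel ℂ (Rel.conj (s := s) i hi)

theorem adjoin_x (N : ℕ) (s : ℂ) : Algebra.adjoin ℂ (Set.range (x (N := N) s)) = ⊤ := by
  have h : Set.range (x (N := N) s) =
      RingQuot.mkAlgHom ℂ (Rel N s) '' Set.range (FreeAlgebra.ι ℂ) := by
    rw [← Set.range_comp]; rfl
  rw [h, ← AlgHom.map_adjoin, FreeAlgebra.adjoin_range_ι, Algebra.map_top,
    AlgHom.range_eq_top]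
  exact RingQuot.mkAlgHom_surjective ℂ _

/-- The embedding of the index set onto the inner indices. -/
def emb {N : ℕ} (i : Fin N) : Fin (N + 2) := i.castSucc.succ

theorem emb_val {N : ℕ} (i : Fin N) : (emb i : ℕ) = i + 1 := by simp [emb]

theorem rev_emb {N : ℕ} (i : Fin N) : (emb i).rev = emb i.rev := by
  ext; simp only [Fin.val_rev, emb_val]; omega

theorem emb_lt {N : ℕ} (i j : Fin N) : emb i < emb j ↔ i < j := by
  simp [emb]

theorem emb_inj {N : ℕ} {i j : Fin N} : emb i = emb j ↔ i = j := by
  simp [emb]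

theorem emb_injective (N : ℕ) : Function.Injective (emb (N := N)) := fun _ _ h => emb_inj.1 h

/-- The same embedding, bundled. -/
def embE (N : ℕ) : Fin N ↪ Fin (N + 2) := ⟨emb, emb_injective N⟩

theorem embE_apply {N : ℕ} (i : Fin N) : embE N i = emb i := rfl

theorem twoRho_emb {N : ℕ} (i : Fin N) : twoRho (emb i) = twoRho i := by
  simp only [twoRho, rev_emb, emb_lt, emb_inj, emb_val]
  split_ifs <;> push_cast <;> ring

theorem Ioo_emb {N : ℕ} (i j : Fin N) :
    Finset.Ioo (emb i) (emb j) = (Finset.Ioo i j).map (embE N) := by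
  ext k
  simp only [Finset.mem_Ioo, Finset.mem_map, embE_apply]
  constructor
  · rintro ⟨h1, h2⟩
    rw [Fin.lt_def, emb_val] at h1 h2
    refine ⟨⟨k - 1, by omega⟩, ⟨?_, ?_⟩, ?_⟩
    · rw [Fin.lt_def]; show _ < (k : ℕ) - 1; omega
    · rw [Fin.lt_def]; show (k : ℕ) - 1 < _; omega
    · ext; rw [emb_val]; show (k : ℕ) - 1 + 1 = k; omega
  · rintro ⟨l, ⟨h1, h2⟩, rfl⟩
    exact ⟨(emb_lt _ _).2 h1, (emb_lt _ _).2 h2⟩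

theorem Ioo_zero {N : ℕ} : Finset.Ioo (0 : Fin (N + 2)) (Fin.last (N + 1)) =
    Finset.univ.map (embE N) := by
  ext k
  simp only [Finset.mem_Ioo, Finset.mem_map, embE_apply, Finset.mem_univ,
    true_and]
  constructor
  · rintro ⟨h1, h2⟩
    rw [Fin.lt_def] at h1 h2
    rw [Fin.val_last] at h2
    rw [Fin.val_zero] at h1
    refine ⟨⟨k - 1, by omega⟩, ?_⟩
    ext; rw [emb_val]; show (k : ℕ) - 1 + 1 = k; omega
  · rintro ⟨l, rfl⟩
    rw [Fin.lt_def, Fin.lt_def, emb_val, Fin.val_last, Fin.val_zero]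
    omega

theorem fin_cases2 {N : ℕ} (k : Fin (N + 2)) :
    k = 0 ∨ k = Fin.last (N + 1) ∨ ∃ i : Fin N, k = emb i := by
  by_cases h0 : k = 0
  · exact Or.inl h0
  by_cases h1 : k = Fin.last (N + 1)
  · exact Or.inr (Or.inl h1)
  refine Or.inr (Or.inr ⟨⟨k - 1, ?_⟩, ?_⟩)
  · rw [Fin.ext_iff, Fin.val_zero] at h0
    rw [Fin.ext_iff, Fin.val_last] at h1
    omega
  · rw [Fin.ext_iff, Fin.val_zero] at h0
    ext
    rw [emb_val]
    show _ = (k : ℕ) - 1 + 1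
    omega

theorem twoRho_zero (N : ℕ) : twoRho (0 : Fin (N + 2)) = N := by
  simp [twoRho, Fin.lt_def]

theorem twoRho_last (N : ℕ) : twoRho (Fin.last (N + 1)) = -N := by
  have h : ¬ (Fin.last (N + 1) < Fin.rev (Fin.last (N + 1))) := by simp
  have h' : ¬ (Fin.last (N + 1) = Fin.rev (Fin.last (N + 1))) := by simp [Fin.ext_iff]
  rw [twoRho, if_neg h, if_neg h']
  simp only [Fin.rev_last, Fin.val_zero]
  push_cast
  ring

/-- The inclusion of the polynomials in the inner variables. -/
def incl (N : ℕ) (s : ℂ) : Alg N s →ₐ[ℂ] Alg (N + 2) s :=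
  lift (fun i => x s (emb i))
    (fun i j hij hj => x_comm s _ _ ((emb_lt _ _).2 hij) (by rw [rev_emb]; simpa [emb_inj]))
    (fun i hi => by
      have h := x_conj s (emb i) (by rw [rev_emb]; exact (emb_lt _ _).2 hi)
      rw [rev_emb, Ioo_emb, Finset.sum_map, twoRho_emb] at h
      simpa only [embE_apply, rev_emb, twoRho_emb] using h)

@[simp] theorem incl_x {N : ℕ} (s : ℂ) (i : Fin N) : incl N s (x s i) = x s (emb i) := by
  simp [incl]

/-- The scaling endomorphism `x_i ↦ c x_i`. -/
def scale (N : ℕ) (s c : ℂ) : Alg N s →ₐ[ℂ] Alg N s :=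
  lift (fun i => c • x s i)
    (fun i j hij hj => by
      simp only [smul_mul_assoc, mul_smul_comm]
      rw [x_comm s i j hij hj, smul_comm (s ^ 2) c, smul_comm (s ^ 2) c])
    (fun i hi => by
      simp only [smul_mul_assoc, mul_smul_comm, x_conj s i hi, smul_add, Finset.smul_sum]
      congr 1
      refine Finset.sum_congr rfl fun j _ => ?_
      simp only [smul_smul]
      congr 1
      ring)

@[simp] theorem scale_x {N : ℕ} (s c : ℂ) (i : Fin N) : scale N s c (x s i) = c • x s i := by
  simp [scale]

/-- The coefficient in the relation for the last and the first variable. -/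
def kap (N : ℕ) (s : ℂ) : ℂ := (s ^ 2 - (s ^ 2)⁻¹) / (s ^ ((N : ℤ) - 2) + s ^ (-(N : ℤ) + 2))

theorem incl_Q (N : ℕ) (s : ℂ) :
    incl N s (Q N s) = ∑ j : Fin N, s ^ twoRho j.rev • (x s (emb j) * x s (emb j.rev)) := by
  simp [Q]

theorem last_zero (N : ℕ) (s : ℂ) :
    x s (Fin.last (N + 1)) * x s 0 =
      x s 0 * x s (Fin.last (N + 1)) + kap N s • incl N s (Q N s) := by
  have h := x_conj s (0 : Fin (N + 2)) (by simp [Fin.lt_def])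
  rw [Fin.rev_zero, Ioo_zero, Finset.sum_map, twoRho_zero] at h
  simp only [embE_apply, rev_emb, twoRho_emb] at h
  rw [h, incl_Q, kap]

theorem zero_emb {N : ℕ} (s : ℂ) (i : Fin N) :
    x s 0 * x s (emb i) = s ^ 2 • (x s (emb i) * x s 0) :=
  x_comm s _ _ (by rw [Fin.lt_def, emb_val, Fin.val_zero]; omega)
    (by rw [Fin.rev_zero, Ne, Fin.ext_iff, emb_val, Fin.val_last]; omega)

theorem emb_last {N : ℕ} (s : ℂ) (i : Fin N) :
    x s (emb i) * x s (Fin.last (N + 1)) = s ^ 2 • (x s (Fin.last (N + 1)) * x s (emb i)) :=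
  x_comm s _ _ (by rw [Fin.lt_def, emb_val, Fin.val_last]; omega)
    (by rw [rev_emb, Ne, Fin.ext_iff, emb_val, Fin.val_last]; omega)

theorem emb_zero' {N : ℕ} {s : ℂ} (hs : s ≠ 0) (i : Fin N) :
    x s (emb i) * x s 0 = (s ^ 2)⁻¹ • (x s 0 * x s (emb i)) := by
  rw [zero_emb, smul_smul, inv_mul_cancel₀ (pow_ne_zero 2 hs), one_smul]

theorem last_emb' {N : ℕ} {s : ℂ} (hs : s ≠ 0) (i : Fin N) :
    x s (Fin.last (N + 1)) * x s (emb i) =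
      (s ^ 2)⁻¹ • (x s (emb i) * x s (Fin.last (N + 1))) := by
  rw [emb_last, smul_smul, inv_mul_cancel₀ (pow_ne_zero 2 hs), one_smul]

theorem incl_zero {N : ℕ} {s : ℂ} (hs : s ≠ 0) (y : Alg N s) :
    incl N s y * x s 0 = x s 0 * incl N s (scale N s (s ^ 2)⁻¹ y) := by
  have hy : y ∈ Algebra.adjoin ℂ (Set.range (x (N := N) s)) := by rw [adjoin_x]; trivial
  induction hy using Algebra.adjoin_induction with
  | mem a ha =>
    obtain ⟨i, rfl⟩ := ha
    rw [incl_x, emb_zero' hs, scale_x, map_smul, incl_x, mul_smul_comm]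
  | algebraMap r => simp only [AlgHom.commutes]; exact Algebra.commutes _ _
  | add a b _ _ ha hb => simp only [map_add, add_mul, mul_add, ha, hb]
  | mul a b _ _ ha hb => rw [map_mul, mul_assoc, hb, ← mul_assoc, ha, mul_assoc, map_mul, map_mul]

theorem last_incl {N : ℕ} {s : ℂ} (hs : s ≠ 0) (y : Alg N s) :
    x s (Fin.last (N + 1)) * incl N s y =
      incl N s (scale N s (s ^ 2)⁻¹ y) * x s (Fin.last (N + 1)) := by
  have hy : y ∈ Algebra.adjoin ℂ (Set.range (x (N := N) s)) := by rw [adjoin_x]; trivial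
  induction hy using Algebra.adjoin_induction with
  | mem a ha =>
    obtain ⟨i, rfl⟩ := ha
    rw [incl_x, last_emb' hs, scale_x, map_smul, incl_x, smul_mul_assoc]
  | algebraMap r => simp only [AlgHom.commutes]; exact (Algebra.commutes _ _).symm
  | add a b _ _ ha hb => simp only [map_add, add_mul, mul_add, ha, hb]
  | mul a b _ _ ha hb =>
    rw [map_mul, ← mul_assoc, ha, mul_assoc, hb, ← mul_assoc, map_mul, map_mul]

theorem scale_Q (N : ℕ) (s c : ℂ) : scale N s c (Q N s) = c ^ 2 • Q N s := by
  simp only [Q, map_sum, map_smul, map_mul, scale_x, Finset.smul_sum, smul_mul_assoc,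
    mul_smul_comm, smul_smul]
  refine Finset.sum_congr rfl fun j _ => ?_
  congr 1
  ring

theorem den_ne {s : ℂ} (hs : Admissible s) (e : ℤ) : s ^ e + s ^ (-e) ≠ 0 := by
  intro h
  have h0 := hs.1
  have h1 : (s ^ 2) ^ (2 * e) = 1 := by
    have h2 : s ^ e * s ^ e = -1 := by
      have : s ^ e * (s ^ e + s ^ (-e)) = 0 := by rw [h, mul_zero]
      rw [mul_add, ← zpow_add₀ h0 e (-e)] at this
      simp only [add_neg_cancel, zpow_zero] at this
      linear_combination this
    have h3 : (s ^ 2) ^ (2 * e) = (s ^ e * s ^ e) ^ 2 := by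
      rw [← zpow_add₀ h0, ← zpow_natCast, ← zpow_natCast, ← zpow_mul, ← zpow_mul]
      congr 1; push_cast; ring
    rw [h3, h2]; norm_num
  rcases lt_trichotomy e 0 with he | he | he
  · refine hs.2 (-(2 * e)).toNat (by omega) ?_
    rw [← zpow_natCast, Int.toNat_of_nonneg (by omega), zpow_neg, h1, inv_one]
  · subst he; norm_num at h
  · refine hs.2 (2 * e).toNat (by omega) ?_
    rw [← zpow_natCast, Int.toNat_of_nonneg (by omega), h1]

theorem Q_succ (N : ℕ) {s : ℂ} (hs : Admissible s) :
    Q (N + 2) s = (s ^ (N : ℤ) + s ^ (-(N : ℤ))) • (x s 0 * x s (Fin.last (N + 1)) +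
      (s ^ 2 / (s ^ ((N : ℤ) - 2) + s ^ (-(N : ℤ) + 2))) • incl N s (Q N s)) := by
  have hd := den_ne hs ((N : ℤ) - 2)
  rw [show -((N : ℤ) - 2) = -(N : ℤ) + 2 by ring] at hd
  have h0 := hs.1
  have h : Q (N + 2) s = s ^ (-(N : ℤ)) • (x s 0 * x s (Fin.last (N + 1))) +
      s ^ (N : ℤ) • (x s (Fin.last (N + 1)) * x s 0) + incl N s (Q N s) := by
    rw [Q, Fin.sum_univ_succ, Fin.sum_univ_castSucc, incl_Q]
    have e1 : (Fin.last N).succ = Fin.last (N + 1) := rfl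
    rw [e1, Fin.rev_zero, Fin.rev_last, twoRho_last, twoRho_zero]
    have e2 : ∀ i : Fin N, i.castSucc.succ = emb i := fun _ => rfl
    simp only [e2, rev_emb, twoRho_emb]
    abel
  rw [h, last_zero, kap, smul_add, smul_add, smul_smul, smul_smul]
  have e3 : (1 : ℂ) + s ^ (N : ℤ) * ((s ^ 2 - (s ^ 2)⁻¹) /
      (s ^ ((N : ℤ) - 2) + s ^ (-(N : ℤ) + 2))) =
      (s ^ (N : ℤ) + s ^ (-(N : ℤ))) * (s ^ 2 / (s ^ ((N : ℤ) - 2) + s ^ (-(N : ℤ) + 2))) := by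
    have e4 : s ^ ((N : ℤ) - 2) = s ^ (N : ℤ) * (s ^ 2)⁻¹ := by
      rw [zpow_sub₀ h0]; rfl
    have e5 : s ^ (-(N : ℤ) + 2) = s ^ (-(N : ℤ)) * s ^ 2 := by
      rw [zpow_add₀ h0]; rfl
    rw [mul_div_assoc', mul_div_assoc', eq_div_iff hd, add_mul, div_mul_cancel₀ _ hd, e4, e5]
    ring
  rw [← e3, add_smul, add_smul, one_smul]
  abel

theorem Q_comm {s : ℂ} (hs : Admissible s) : ∀ (N : ℕ) (i : Fin N),
    Q N s * x s i = x s i * Q N s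
  | 0, i => i.elim0
  | 1, i => by
    have : i = 0 := Subsingleton.elim _ _
    subst this
    simp [Q, mul_assoc]
  | N + 2, i => by
    have h0 := hs.1
    have h2 : (s ^ 2) ≠ 0 := pow_ne_zero 2 h0
    have hd := den_ne hs ((N : ℤ) - 2)
    rw [show -((N : ℤ) - 2) = -(N : ℤ) + 2 by ring] at hd
    rw [Q_succ N hs, smul_mul_assoc, mul_smul_comm]
    congr 1
    have key : kap N s + (s ^ 2 / (s ^ ((N : ℤ) - 2) + s ^ (-(N : ℤ) + 2))) * ((s ^ 2)⁻¹) ^ 2 =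
        s ^ 2 / (s ^ ((N : ℤ) - 2) + s ^ (-(N : ℤ) + 2)) := by
      rw [kap, ← mul_div_right_comm, ← add_div]
      congr 1
      field_simp
      ring
    generalize s ^ 2 / (s ^ ((N : ℤ) - 2) + s ^ (-(N : ℤ) + 2)) = D at key ⊢
    rcases fin_cases2 i with rfl | rfl | ⟨j, rfl⟩
    · rw [add_mul, mul_add, smul_mul_assoc, mul_smul_comm, incl_zero h0, scale_Q, map_smul,
        mul_smul_comm, mul_assoc, last_zero, mul_add, mul_smul_comm, smul_smul, add_assoc,
        ← add_smul, key]
    · rw [add_mul, mul_add, smul_mul_assoc, mul_smul_comm, last_incl h0, scale_Q, map_smul,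
        smul_mul_assoc, ← mul_assoc, last_zero, add_mul, smul_mul_assoc, smul_smul,
        add_assoc (x s 0 * x s (Fin.last (N + 1)) * x s (Fin.last (N + 1))), ← add_smul, key]
    · rw [add_mul, mul_add, smul_mul_assoc, mul_smul_comm, ← incl_x, ← map_mul, ← map_mul,
        Q_comm hs N j, incl_x]
      congr 1
      rw [mul_assoc, last_emb' h0, mul_smul_comm, ← mul_assoc, zero_emb, smul_mul_assoc,
        smul_smul, inv_mul_cancel₀ h2, one_smul, mul_assoc]

theorem Q_central {s : ℂ} (hs : Admissible s) (N : ℕ) (y : Alg N s) :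
    Q N s * y = y * Q N s := by
  have hy : y ∈ Algebra.adjoin ℂ (Set.range (x (N := N) s)) := by rw [adjoin_x]; trivial
  induction hy using Algebra.adjoin_induction with
  | mem a ha => obtain ⟨i, rfl⟩ := ha; exact Q_comm hs N i
  | algebraMap r => exact (Algebra.commutes _ _).symm
  | add a b _ _ ha hb => simp only [add_mul, mul_add, ha, hb]
  | mul a b _ _ ha hb => rw [← mul_assoc, ha, mul_assoc, hb, mul_assoc]


/-- Coefficients of the operator realising the last variable. -/
def coef (N : ℕ) (s : ℂ) (a : ℕ) : ℂ := kap N s * ∑ l ∈ Finset.range a, ((s ^ 2)⁻¹ ^ 2) ^ l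

/-- The operator realising the first variable. -/
def repZero (N : ℕ) (s : ℂ) : Module.End ℂ (ℕ → ℕ → Alg N s) where
  toFun f a b := match a with
    | 0 => 0
    | a + 1 => f a b
  map_add' f g := by funext a b; cases a <;> simp
  map_smul' c f := by funext a b; cases a <;> simp

/-- The operator realising an inner variable. -/
def repMid {N : ℕ} (s : ℂ) (i : Fin N) : Module.End ℂ (ℕ → ℕ → Alg N s) where
  toFun f a b := (s ^ 2)⁻¹ ^ a • (x s i * f a b)
  map_add' f g := by funext a b; simp [mul_add]
  map_smul' c f := by
    funext a b
    simp only [Pi.smul_apply, mul_smul_comm, RingHom.id_apply]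
    rw [smul_comm]

/-- The operator realising the last variable. -/
def repLast (N : ℕ) (s : ℂ) : Module.End ℂ (ℕ → ℕ → Alg N s) where
  toFun f a b := (match b with
    | 0 => 0
    | b + 1 => scale N s (s ^ 2)⁻¹ (f a b)) + coef N s (a + 1) • (Q N s * f (a + 1) b)
  map_add' f g := by
    funext a b
    cases b
    · simp [mul_add]
    · simp only [Pi.add_apply, map_add, mul_add, smul_add]; abel
  map_smul' c f := by
    funext a b
    cases b
    · simp only [Pi.smul_apply, mul_smul_comm, RingHom.id_apply, zero_add]
      rw [smul_comm]
    · simp only [Pi.smul_apply, mul_smul_comm, RingHom.id_apply, map_smul, smul_add]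
      rw [smul_comm c (coef N s (a + 1))]

/-- The operators realising all variables. -/
def repGen {N : ℕ} (s : ℂ) : Fin (N + 2) → Module.End ℂ (ℕ → ℕ → Alg N s) :=
  Fin.cons (repZero N s) (Fin.snoc (fun i => repMid s i) (repLast N s))

theorem repGen_zero (N : ℕ) (s : ℂ) : repGen s (0 : Fin (N + 2)) = repZero N s := rfl

theorem repGen_emb {N : ℕ} (s : ℂ) (i : Fin N) : repGen s (emb i) = repMid s i := by
  rw [repGen, emb, Fin.cons_succ, Fin.snoc_castSucc]

theorem repGen_last (N : ℕ) (s : ℂ) : repGen s (Fin.last (N + 1)) = repLast N s := by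
  rw [repGen, ← Fin.succ_last, Fin.cons_succ, Fin.snoc_last]

theorem repMid_mul {N : ℕ} (s : ℂ) (i j : Fin N) (f : ℕ → ℕ → Alg N s) (a b : ℕ) :
    (repMid s i * repMid s j) f a b = ((s ^ 2)⁻¹ ^ a * (s ^ 2)⁻¹ ^ a) • (x s i * x s j * f a b) := by
  show (s ^ 2)⁻¹ ^ a • (x s i * ((s ^ 2)⁻¹ ^ a • (x s j * f a b))) = _
  rw [mul_smul_comm, smul_smul, mul_assoc]

/-- Operators realising the algebra in `N + 2` variables. -/
def rep {N : ℕ} {s : ℂ} (hs : Admissible s) :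
    Alg (N + 2) s →ₐ[ℂ] Module.End ℂ (ℕ → ℕ → Alg N s) :=
  lift (repGen s)
    (fun i j hij hj => by
      have h2 : s ^ 2 ≠ 0 := pow_ne_zero 2 hs.1
      rcases fin_cases2 i with rfl | rfl | ⟨i, rfl⟩
      · rcases fin_cases2 j with rfl | rfl | ⟨j, rfl⟩
        · exact absurd hij (lt_irrefl _)
        · exact absurd (Fin.rev_zero _).symm hj
        · rw [repGen_zero, repGen_emb]
          ext f a b
          cases a with
          | zero =>
            show (0 : Alg N s) = s ^ 2 • ((s ^ 2)⁻¹ ^ 0 • (x s j * 0))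
            simp
          | succ a =>
            show (s ^ 2)⁻¹ ^ a • (x s j * f a b) = s ^ 2 • ((s ^ 2)⁻¹ ^ (a + 1) • (x s j * f a b))
            rw [smul_smul, pow_succ' (s ^ 2)⁻¹ a, mul_inv_cancel_left₀ h2]
      · exact absurd (Fin.le_last j) (not_le.2 hij)
      · rcases fin_cases2 j with rfl | rfl | ⟨j, rfl⟩
        · exact absurd (Fin.zero_le (emb i)) (not_le.2 hij)
        · rw [repGen_last, repGen_emb]
          ext f a b
          have e : (s ^ 2)⁻¹ ^ a = s ^ 2 * (s ^ 2)⁻¹ ^ (a + 1) := by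
            rw [pow_succ' (s ^ 2)⁻¹ a, mul_inv_cancel_left₀ h2]
          have hq : x s i * (Q N s * f (a + 1) b) = Q N s * (x s i * f (a + 1) b) := by
            rw [← mul_assoc, ← Q_comm hs, mul_assoc]
          cases b with
          | zero =>
            show (s ^ 2)⁻¹ ^ a • (x s i * (0 + coef N s (a + 1) • (Q N s * f (a + 1) 0))) =
              s ^ 2 • (0 + coef N s (a + 1) • (Q N s * ((s ^ 2)⁻¹ ^ (a + 1) •
                (x s i * f (a + 1) 0))))
            rw [zero_add, zero_add, mul_smul_comm, mul_smul_comm, hq, e]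
            simp only [smul_smul]
            congr 1
            ring
          | succ b =>
            show (s ^ 2)⁻¹ ^ a • (x s i * (scale N s (s ^ 2)⁻¹ (f a b) +
                coef N s (a + 1) • (Q N s * f (a + 1) (b + 1)))) =
              s ^ 2 • (scale N s (s ^ 2)⁻¹ ((s ^ 2)⁻¹ ^ a • (x s i * f a b)) +
                coef N s (a + 1) • (Q N s * ((s ^ 2)⁻¹ ^ (a + 1) • (x s i * f (a + 1) (b + 1)))))
            rw [mul_add, mul_smul_comm, mul_smul_comm, hq, map_smul, map_mul, scale_x,
              smul_mul_assoc]
            simp only [smul_add, smul_smul]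
            congr 2
            rw [e]; ring
        · rw [repGen_emb, repGen_emb]
          ext f a b
          rw [rev_emb, Ne, emb_inj] at hj
          rw [repMid_mul, LinearMap.smul_apply, Pi.smul_apply, Pi.smul_apply, repMid_mul,
            x_comm s i j ((emb_lt _ _).1 hij) hj, smul_mul_assoc, smul_comm])
    (fun i hi => by
      have h2 : s ^ 2 ≠ 0 := pow_ne_zero 2 hs.1
      rcases fin_cases2 i with rfl | rfl | ⟨i, rfl⟩
      · rw [Fin.rev_zero, Ioo_zero, Finset.sum_map, twoRho_zero, repGen_zero, repGen_last]
        simp only [embE_apply, rev_emb, twoRho_emb, repGen_emb]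
        rw [← kap]
        have hsum : ∀ (f : ℕ → ℕ → Alg N s) (a b : ℕ),
            (∑ j : Fin N, s ^ twoRho j.rev • (repMid s j * repMid s j.rev)) f a b =
              ((s ^ 2)⁻¹ ^ 2) ^ a • (Q N s * f a b) := by
          intro f a b
          rw [LinearMap.sum_apply, Finset.sum_apply, Finset.sum_apply, Q, Finset.sum_mul,
            Finset.smul_sum]
          refine Finset.sum_congr rfl fun j _ => ?_
          rw [LinearMap.smul_apply, Pi.smul_apply, Pi.smul_apply, repMid_mul, smul_mul_assoc,
            smul_comm]
          congr 2
          ring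
        ext f a b
        rw [LinearMap.add_apply, Pi.add_apply, Pi.add_apply, LinearMap.smul_apply, Pi.smul_apply,
          Pi.smul_apply, hsum, smul_smul]
        cases a with
        | zero =>
          have hc : coef N s (0 + 1) = kap N s * ((s ^ 2)⁻¹ ^ 2) ^ 0 := by simp [coef]
          cases b with
          | zero =>
            show (0 : Alg N s) + coef N s (0 + 1) • (Q N s * f 0 0) = 0 + _
            rw [hc]
          | succ b =>
            show scale N s (s ^ 2)⁻¹ 0 + coef N s (0 + 1) • (Q N s * f 0 (b + 1)) = 0 + _
            rw [hc, map_zero]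
        | succ a =>
          have hc : coef N s (a + 1 + 1) = coef N s (a + 1) + kap N s * ((s ^ 2)⁻¹ ^ 2) ^ (a + 1) := by
            rw [coef, Finset.sum_range_succ, mul_add]; rfl
          cases b with
          | zero =>
            show (0 : Alg N s) + coef N s (a + 1 + 1) • (Q N s * f (a + 1) 0) =
              0 + coef N s (a + 1) • (Q N s * f (a + 1) 0) + _
            rw [hc, add_smul, add_assoc]
          | succ b =>
            show scale N s (s ^ 2)⁻¹ (f a b) + coef N s (a + 1 + 1) • (Q N s * f (a + 1) (b + 1)) =
              scale N s (s ^ 2)⁻¹ (f a b) + coef N s (a + 1) • (Q N s * f (a + 1) (b + 1)) + _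
            rw [hc, add_smul, add_assoc (scale N s (s ^ 2)⁻¹ (f a b))]
      · exact absurd (Fin.le_last _) (not_le.2 hi)
      · rw [rev_emb, Ioo_emb, Finset.sum_map, twoRho_emb]
        rw [rev_emb, emb_lt] at hi
        simp only [embE_apply, rev_emb, twoRho_emb, repGen_emb]
        ext f a b
        rw [LinearMap.add_apply, Pi.add_apply, Pi.add_apply, LinearMap.smul_apply, Pi.smul_apply,
          Pi.smul_apply, LinearMap.sum_apply, Finset.sum_apply, Finset.sum_apply, repMid_mul,
          repMid_mul, x_conj s i hi, add_mul, smul_add]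
        congr 1
        rw [smul_mul_assoc, smul_comm, Finset.sum_mul, Finset.smul_sum]
        congr 1
        refine Finset.sum_congr rfl fun j _ => ?_
        rw [LinearMap.smul_apply, Pi.smul_apply, Pi.smul_apply, repMid_mul, smul_mul_assoc,
          smul_comm])

/-- The function concentrated at `(a, b)` with value `p`. -/
def delta {N : ℕ} {s : ℂ} (a b : ℕ) (p : Alg N s) : ℕ → ℕ → Alg N s :=
  fun a' b' => if a' = a ∧ b' = b then p else 0

theorem rep_zero_pow {N : ℕ} {s : ℂ} (hs : Admissible s) (k a b : ℕ) (p : Alg N s) :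
    rep hs (x s 0 ^ k) (delta a b p) = delta (a + k) b p := by
  induction k with
  | zero => simp
  | succ k ih =>
    rw [pow_succ', map_mul, Module.End.mul_apply, ih, rep, lift_x, repGen_zero]
    funext a' b'
    cases a' with
    | zero =>
      show (0 : Alg N s) = if 0 = a + (k + 1) ∧ b' = b then p else 0
      rw [if_neg (by omega)]
    | succ a' =>
      show (if a' = a + k ∧ b' = b then p else 0) = if a' + 1 = a + (k + 1) ∧ b' = b then p else 0
      congr 1
      simp only [eq_iff_iff]
      omega

theorem rep_last_pow {N : ℕ} {s : ℂ} (hs : Admissible s) (k : ℕ) :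
    rep hs (x s (Fin.last (N + 1)) ^ k) (delta 0 0 1) = delta 0 k 1 := by
  induction k with
  | zero => simp
  | succ k ih =>
    rw [pow_succ', map_mul, Module.End.mul_apply, ih, rep, lift_x, repGen_last]
    funext a' b'
    have e : delta (N := N) (s := s) 0 k 1 (a' + 1) b' = 0 := if_neg (by omega)
    cases b' with
    | zero =>
      show (0 : Alg N s) + coef N s (a' + 1) • (Q N s * delta 0 k 1 (a' + 1) 0) =
        if a' = 0 ∧ 0 = k + 1 then 1 else 0
      rw [e, if_neg (by omega)]; simp
    | succ b' =>
      show scale N s (s ^ 2)⁻¹ (delta 0 k 1 a' b') + coef N s (a' + 1) • (Q N s *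
        delta 0 k 1 (a' + 1) (b' + 1)) = if a' = 0 ∧ b' + 1 = k + 1 then 1 else 0
      have e : delta (N := N) (s := s) 0 k 1 (a' + 1) (b' + 1) = 0 := if_neg (by omega)
      rw [e, delta]
      by_cases h : a' = 0 ∧ b' = k
      · rw [if_pos h, if_pos (by omega)]; simp
      · rw [if_neg h, if_neg (by omega)]; simp

theorem rep_incl {N : ℕ} {s : ℂ} (hs : Admissible s) (y p : Alg N s) (b : ℕ) :
    rep hs (incl N s y) (delta 0 b p) = delta 0 b (y * p) := by
  have hy : y ∈ Algebra.adjoin ℂ (Set.range (x (N := N) s)) := by rw [adjoin_x]; trivial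
  induction hy using Algebra.adjoin_induction generalizing p with
  | mem y hy =>
    obtain ⟨i, rfl⟩ := hy
    rw [incl_x, rep, lift_x, repGen_emb]
    funext a' b'
    show (s ^ 2)⁻¹ ^ a' • (x s i * (if a' = 0 ∧ b' = b then p else 0)) =
      if a' = 0 ∧ b' = b then x s i * p else 0
    split_ifs with h
    · rw [h.1]; simp
    · simp
  | algebraMap r =>
    rw [AlgHom.commutes, AlgHom.commutes, Module.algebraMap_end_apply]
    funext a' b'
    show r • (if a' = 0 ∧ b' = b then p else 0) = if a' = 0 ∧ b' = b then _ else 0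
    rw [smul_ite, smul_zero, Algebra.smul_def]
  | add y z _ _ hy hz =>
    rw [map_add, map_add, LinearMap.add_apply, hy, hz]
    funext a' b'
    show (if a' = 0 ∧ b' = b then y * p else 0) + (if a' = 0 ∧ b' = b then z * p else 0) =
      if a' = 0 ∧ b' = b then _ else 0
    split_ifs <;> simp [add_mul]
  | mul y z _ _ hy hz =>
    rw [map_mul, map_mul, Module.End.mul_apply, hz, hy, mul_assoc]

theorem mon_succ {N : ℕ} (s : ℂ) (ν : Fin (N + 2) → ℕ) :
    mon s ν = x s 0 ^ ν 0 * (incl N s (mon s fun i => ν (emb i)) *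
      x s (Fin.last (N + 1)) ^ ν (Fin.last (N + 1))) := by
  rw [mon, List.ofFn_succ, List.prod_cons, List.ofFn_succ_last, List.prod_append, mon,
    map_list_prod, List.map_ofFn]
  congr 2
  · congr 2
    funext i
    simp only [Function.comp, map_pow, incl_x]
    rfl
  · simp

theorem rep_mon {N : ℕ} {s : ℂ} (hs : Admissible s) (ν : Fin (N + 2) → ℕ) :
    rep hs (mon s ν) (delta 0 0 1) =
      delta (ν 0) (ν (Fin.last (N + 1))) (mon s fun i => ν (emb i)) := by
  rw [mon_succ, map_mul, map_mul, Module.End.mul_apply, Module.End.mul_apply, rep_last_pow,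
    rep_incl, rep_zero_pow, zero_add, mul_one]


theorem eq_top_of_stable {N : ℕ} {s : ℂ} (S : Submodule ℂ (Alg N s)) (h1 : (1 : Alg N s) ∈ S)
    (hx : ∀ i, ∀ y ∈ S, x s i * y ∈ S) : S = ⊤ := by
  have h : ∀ z : Alg N s, ∀ y ∈ S, z * y ∈ S := by
    intro z
    have hz : z ∈ Algebra.adjoin ℂ (Set.range (x (N := N) s)) := by rw [adjoin_x]; trivial
    induction hz using Algebra.adjoin_induction with
    | mem z hz => obtain ⟨i, rfl⟩ := hz; exact hx i
    | algebraMap r => intro y hy; rw [← Algebra.smul_def]; exact S.smul_mem r hy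
    | add z w _ _ hz hw => intro y hy; rw [add_mul]; exact S.add_mem (hz y hy) (hw y hy)
    | mul z w _ _ hz hw => intro y hy; rw [mul_assoc]; exact hz _ (hw y hy)
  rw [eq_top_iff]
  intro z _
  simpa using h z 1 h1

theorem span_step {N : ℕ} {s : ℂ} (hs : Admissible s)
    (hN : Submodule.span ℂ (Set.range (mon (N := N) s)) = ⊤) :
    Submodule.span ℂ (Set.range (mon (N := N + 2) s)) = ⊤ := by
  set S := Submodule.span ℂ (Set.range (mon (N := N + 2) s)) with hS
  have helt : ∀ (a b : ℕ) (y : Alg N s),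
      x s 0 ^ a * (incl N s y * x s (Fin.last (N + 1)) ^ b) ∈ S := by
    intro a b y
    have hy : y ∈ Submodule.span ℂ (Set.range (mon (N := N) s)) := by rw [hN]; trivial
    induction hy using Submodule.span_induction with
    | mem y hy =>
      obtain ⟨ν, rfl⟩ := hy
      refine Submodule.subset_span ⟨Fin.cons a (Fin.snoc ν b), ?_⟩
      rw [mon_succ]
      have e1 : (Fin.cons a (Fin.snoc ν b : Fin (N + 1) → ℕ) : Fin (N + 2) → ℕ)
          (Fin.last (N + 1)) = b := by
        rw [← Fin.succ_last, Fin.cons_succ, Fin.snoc_last]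
      have e2 : (fun i => (Fin.cons a (Fin.snoc ν b : Fin (N + 1) → ℕ) : Fin (N + 2) → ℕ)
          (emb i)) = ν := by
        funext i
        rw [emb, Fin.cons_succ, Fin.snoc_castSucc]
      rw [e1, e2, Fin.cons_zero]
    | zero => simp
    | add y z _ _ hy hz => rw [map_add, add_mul, mul_add]; exact S.add_mem hy hz
    | smul c y _ hy =>
      rw [map_smul, smul_mul_assoc, mul_smul_comm]; exact S.smul_mem c hy
  have hind : ∀ z : Alg (N + 2) s, (∀ (a b : ℕ) (y : Alg N s),
      z * (x s 0 ^ a * (incl N s y * x s (Fin.last (N + 1)) ^ b)) ∈ S) →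
      ∀ w ∈ S, z * w ∈ S := by
    intro z hz w hw
    induction hw using Submodule.span_induction with
    | mem w hw => obtain ⟨ν, rfl⟩ := hw; rw [mon_succ]; exact hz _ _ _
    | zero => simp
    | add v w _ _ hv hw => rw [mul_add]; exact S.add_mem hv hw
    | smul c w _ hw => rw [mul_smul_comm]; exact S.smul_mem c hw
  have h0 : ∀ w ∈ S, x s 0 * w ∈ S := hind _ fun a b y => by
    rw [← mul_assoc, ← pow_succ']; exact helt _ _ _
  have hpow : ∀ (a : ℕ) (z : Alg N s), ∃ z', incl N s z * x s 0 ^ a = x s 0 ^ a * incl N s z' := by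
    intro a
    induction a with
    | zero => intro z; exact ⟨z, by simp⟩
    | succ a ih =>
      intro z
      obtain ⟨z', hz'⟩ := ih (scale N s (s ^ 2)⁻¹ z)
      exact ⟨z', by rw [pow_succ', ← mul_assoc, incl_zero hs.1, mul_assoc, hz', mul_assoc]⟩
  have hincl : ∀ z : Alg N s, ∀ w ∈ S, incl N s z * w ∈ S := fun z => hind _ fun a b y => by
    obtain ⟨z', hz'⟩ := hpow a z
    rw [← mul_assoc, hz', mul_assoc, ← mul_assoc (incl N s z'), ← map_mul]
    exact helt _ _ _
  have hlast : ∀ w ∈ S, x s (Fin.last (N + 1)) * w ∈ S := hind _ fun a b => by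
    induction a with
    | zero =>
      intro y
      rw [pow_zero, one_mul, ← mul_assoc, last_incl hs.1, mul_assoc, ← pow_succ']
      simpa using helt 0 (b + 1) (scale N s (s ^ 2)⁻¹ y)
    | succ a ih =>
      intro y
      rw [pow_succ', mul_assoc, ← mul_assoc, last_zero, add_mul, mul_assoc, smul_mul_assoc]
      exact S.add_mem (h0 _ (ih y)) (S.smul_mem _ (hincl _ _ (helt _ _ _)))
  refine eq_top_of_stable S ?_ ?_
  · simpa using helt 0 0 1
  · intro i
    rcases fin_cases2 i with rfl | rfl | ⟨j, rfl⟩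
    · exact h0
    · exact hlast
    · rw [← incl_x]; exact hincl _

theorem linearIndependent_step {N : ℕ} {s : ℂ} (hs : Admissible s)
    (hl : LinearIndependent ℂ (mon (N := N) s))
    (hN : Submodule.span ℂ (Set.range (mon (N := N) s)) = ⊤) :
    LinearIndependent ℂ (mon (N := N + 2) s) := by
  let B : Module.Basis (Fin N → ℕ) ℂ (Alg N s) := Module.Basis.mk hl hN.ge
  have hB : ∀ μ ν, B.coord μ (mon s ν) = if ν = μ then 1 else 0 := by
    intro μ ν
    rw [← Module.Basis.mk_apply hl hN.ge ν, Module.Basis.coord_apply, Module.Basis.repr_self,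
      Finsupp.single_apply]
  rw [linearIndependent_iff']
  intro t g hg ν hν
  have h1 := congrArg (fun z => rep hs z (delta 0 0 1)) hg
  simp only [map_sum, map_smul, LinearMap.sum_apply, LinearMap.smul_apply, rep_mon, map_zero,
    LinearMap.zero_apply] at h1
  have h2 := congrArg (fun f => B.coord (fun i => ν (emb i)) (f (ν 0) (ν (Fin.last (N + 1))))) h1
  simp only [Finset.sum_apply, Pi.smul_apply, map_sum, map_smul, Pi.zero_apply, map_zero] at h2
  rw [Finset.sum_eq_single ν] at h2
  · simpa [delta, hB] using h2
  · intro ν' _ hne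
    rw [delta]
    split_ifs with h
    · rw [hB, if_neg, smul_zero]
      intro h'
      apply hne
      funext k
      rcases fin_cases2 k with rfl | rfl | ⟨j, rfl⟩
      · exact h.1.symm
      · exact h.2.symm
      · exact congrFun h' j
    · simp
  · intro h; exact absurd hν h

theorem mon_basis_aux {s : ℂ} (hs : Admissible s) : ∀ N : ℕ,
    LinearIndependent ℂ (mon (N := N) s) ∧
      Submodule.span ℂ (Set.range (mon (N := N) s)) = ⊤
  | 0 => by
    constructor
    · let φ : Alg 0 s →ₐ[ℂ] ℂ := lift (fun i => i.elim0) (fun i => i.elim0) (fun i => i.elim0)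
      refine LinearIndependent.of_comp φ.toLinearMap ?_
      rw [linearIndependent_unique_iff]
      simp [mon]
    · refine eq_top_of_stable _ (Submodule.subset_span ⟨fun i => i.elim0, by simp [mon]⟩) ?_
      intro i; exact i.elim0
  | 1 => by
    constructor
    · let φ : Alg 1 s →ₐ[ℂ] Polynomial ℂ := lift (fun _ => Polynomial.X)
        (fun i j hij => by rw [Subsingleton.elim i j] at hij; exact absurd hij (lt_irrefl _))
        (fun i hi => absurd (hi.trans_eq (Subsingleton.elim _ i)) (lt_irrefl _))
      refine LinearIndependent.of_comp φ.toLinearMap ?_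
      have h := (Polynomial.basisMonomials ℂ).linearIndependent.comp (fun ν : Fin 1 → ℕ => ν 0)
        (fun a b h => by funext i; rw [Subsingleton.elim i 0]; exact h)
      have e : (φ.toLinearMap ∘ mon s : (Fin 1 → ℕ) → Polynomial ℂ) =
          (Polynomial.basisMonomials ℂ) ∘ fun ν : Fin 1 → ℕ => ν 0 := by
        funext ν
        simp [mon, φ, Polynomial.X_pow_eq_monomial]
      rw [e]
      exact h
    · refine eq_top_of_stable _ (Submodule.subset_span ⟨fun _ => 0, by simp [mon]⟩) ?_
      intro i y hy
      induction hy using Submodule.span_induction with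
      | mem w hw =>
        obtain ⟨ν, rfl⟩ := hw
        refine Submodule.subset_span ⟨fun i => ν i + 1, ?_⟩
        rw [Subsingleton.elim i 0]
        simp [mon, pow_succ']
      | zero => simp
      | add v w _ _ hv hw => rw [mul_add]; exact Submodule.add_mem _ hv hw
      | smul c w _ hw => rw [mul_smul_comm]; exact Submodule.smul_mem _ c hw
  | N + 2 => ⟨linearIndependent_step hs (mon_basis_aux hs N).1 (mon_basis_aux hs N).2,
      span_step hs (mon_basis_aux hs N).2⟩

/-- The ordered monomials form a basis of the algebra. -/
def monBasis {N : ℕ} {s : ℂ} (hs : Admissible s) : Module.Basis (Fin N → ℕ) ℂ (Alg N s) :=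
  Module.Basis.mk (mon_basis_aux hs N).1 (mon_basis_aux hs N).2.ge

theorem monBasis_apply {N : ℕ} {s : ℂ} (hs : Admissible s) (ν : Fin N → ℕ) :
    monBasis hs ν = mon s ν := by
  rw [monBasis, Module.Basis.mk_apply]

/-! ### `q`-numbers and operators given on monomials -/

/-- The `q`-number `[a]_q = (q ^ a - q ^ (-a)) / (q - q⁻¹)`. -/
def qInt (s : ℂ) (a : ℤ) : ℂ := ((s ^ 2) ^ a - (s ^ 2) ^ (-a)) / (s ^ 2 - (s ^ 2)⁻¹)

/-- The `q`-number `[a] = (1 - q ^ a) / (1 - q)`. -/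
def bInt (s : ℂ) (a : ℤ) : ℂ := (1 - (s ^ 2) ^ a) / (1 - s ^ 2)

/-- The `q`-shifted factorial `(a; b)_k = (1 - a) (1 - a b) ⋯ (1 - a b ^ (k - 1))`. -/
def qPoch (a b : ℂ) (k : ℕ) : ℂ := ∏ j ∈ Finset.range k, (1 - a * b ^ j)

/-- The exponent vector `ν + ε_i - ε_j` (it occurs with coefficient zero if `ν_j = 0`, `j ≠ i`). -/
def move {N : ℕ} (ν : Fin N → ℕ) (i j : Fin N) : Fin N → ℕ := ν + Pi.single i 1 - Pi.single j 1

/-- The exponent vector `ν - ε_j`. -/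
def lower {N : ℕ} (ν : Fin N → ℕ) (j : Fin N) : Fin N → ℕ := ν - Pi.single j 1

/-- The linear operator with given values on the ordered monomials. -/
def onMon {N : ℕ} {s : ℂ} (hs : Admissible s) (f : (Fin N → ℕ) → Alg N s) :
    Module.End ℂ (Alg N s) :=
  (monBasis hs).constr ℂ f

/-! ### The action of the quantum algebra `U_q(so_N)` -/

/-- The coordinate `ν_i - ν_{i'}` of the weight of the monomial `x ^ ν`. -/
def wt {N : ℕ} (ν : Fin N → ℕ) (i : Fin N) : ℤ := (ν i : ℤ) - ν i.rev

/-- The operator of a raising generator, `b ≠ b'`: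
`x ^ ν ↦ [ν_b]_q q ^ (ν_a - ν_b + 1) x ^ (ν + ε_a - ε_b)
  - [ν_{a'}]_q q ^ (ν_a - ν_b - ν_{a'} + ν_{b'} + 1) x ^ (ν + ε_{b'} - ε_{a'})`. -/
def raise {N : ℕ} {s : ℂ} (hs : Admissible s) (a b : Fin N) : Module.End ℂ (Alg N s) :=
  onMon hs fun ν =>
    (qInt s (ν b) * (s ^ 2) ^ ((ν a : ℤ) - ν b + 1)) • mon s (move ν a b) -
      (qInt s (ν a.rev) * (s ^ 2) ^ ((ν a : ℤ) - ν b - ν a.rev + ν b.rev + 1)) •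
        mon s (move ν b.rev a.rev)

/-- The operator of a lowering generator, `b ≠ b'`:
`x ^ ν ↦ [ν_a]_q q ^ (-ν_a + ν_b - ν_{b'} + ν_{a'} + 1) x ^ (ν - ε_a + ε_b)
  - [ν_{b'}]_q q ^ (-ν_{b'} + ν_{a'} + 1) x ^ (ν - ε_{b'} + ε_{a'})`. -/
def descend {N : ℕ} {s : ℂ} (hs : Admissible s) (a b : Fin N) : Module.End ℂ (Alg N s) :=
  onMon hs fun ν =>
    (qInt s (ν a) * (s ^ 2) ^ (-(ν a : ℤ) + ν b - ν b.rev + ν a.rev + 1)) • mon s (move ν b a) -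
      (qInt s (ν b.rev) * (s ^ 2) ^ (-(ν b.rev : ℤ) + ν a.rev + 1)) •
        mon s (move ν a.rev b.rev)

/-- The operator of the raising generator for a short root, `b = b'`:
`x ^ ν ↦ [ν_b] q ^ (ν_a - ν_b + 3/2) x ^ (ν + ε_a - ε_b)
  - [ν_{a'}]_q q ^ (ν_a - ν_{a'} + 1) x ^ (ν + ε_b - ε_{a'})`. -/
def raiseShort {N : ℕ} {s : ℂ} (hs : Admissible s) (a b : Fin N) : Module.End ℂ (Alg N s) :=
  onMon hs fun ν =>
    (bInt s (ν b) * s ^ (2 * ((ν a : ℤ) - ν b) + 3)) • mon s (move ν a b) -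
      (qInt s (ν a.rev) * (s ^ 2) ^ ((ν a : ℤ) - ν a.rev + 1)) • mon s (move ν b a.rev)

/-- The operator of the lowering generator for a short root, `b = b'`:
`x ^ ν ↦ [ν_a]_q q ^ (-ν_a + ν_{a'} + 1/2) x ^ (ν - ε_a + ε_b)
  - [ν_b] q ^ (-ν_b + ν_{a'} + 1) x ^ (ν - ε_b + ε_{a'})`. -/
def descendShort {N : ℕ} {s : ℂ} (hs : Admissible s) (a b : Fin N) : Module.End ℂ (Alg N s) :=
  onMon hs fun ν =>
    (qInt s (ν a) * s ^ (2 * (-(ν a : ℤ) + ν a.rev) + 1)) • mon s (move ν b a) -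
      (bInt s (ν b) * (s ^ 2) ^ (-(ν b : ℤ) + ν a.rev + 1)) • mon s (move ν a.rev b)

/-- The generators of `U_q(so_N)`, `n = ⌊N / 2⌋`, including the elements `K̂_i` with
`K̂_i ▷ x ^ ν = q ^ (ν_i - ν_{i'}) x ^ ν`, and the inverses of `K_i` and `K̂_i`. -/
inductive Gen (N : ℕ) : Type
  | Khat (i : Fin (N / 2))
  | KhatInv (i : Fin (N / 2))
  | K (i : Fin (N / 2))
  | KInv (i : Fin (N / 2))
  | E (i : Fin (N / 2))
  | F (i : Fin (N / 2))

/-- The `i`-th coordinate index, for `i ≤ n`. -/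
def coordIdx {N : ℕ} (i : Fin (N / 2)) : Fin N := ⟨i, by omega⟩

/-- The first index `a` attached to the `i`-th simple root (one-based): `a = i`, except that
`a = n - 1` if `i = n` and `N = 2 n`. -/
def rootFst {N : ℕ} (i : Fin (N / 2)) : Fin N :=
  if (i : ℕ) + 1 = N / 2 ∧ Even N then ⟨i - 1, by omega⟩ else ⟨i, by omega⟩

/-- The second index `b = i + 1` attached to the `i`-th simple root (one-based). Note that
`i + 1 = n'` if `i = n`, `N = 2 n`, and that `i + 1 = (i + 1)'` if `i = n`, `N = 2 n + 1`. The simple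
root is the difference of the weights of `x_a` and `x_b`. -/
def rootSnd {N : ℕ} (i : Fin (N / 2)) : Fin N := ⟨i + 1, by omega⟩

/-- The action of the generators on the algebra `A`. -/
def genAct {N : ℕ} {s : ℂ} (hs : Admissible s) : Gen N → Module.End ℂ (Alg N s)
  | .Khat i => onMon hs fun ν => (s ^ 2) ^ wt ν (coordIdx i) • mon s ν
  | .KhatInv i => onMon hs fun ν => (s ^ 2) ^ (-wt ν (coordIdx i)) • mon s ν
  | .K i => onMon hs fun ν => (s ^ 2) ^ (wt ν (rootFst i) - wt ν (rootSnd i)) • mon s ν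
  | .KInv i => onMon hs fun ν => (s ^ 2) ^ (-(wt ν (rootFst i) - wt ν (rootSnd i))) • mon s ν
  | .E i => if rootSnd i = (rootSnd i).rev then raiseShort hs (rootFst i) (rootSnd i)
      else raise hs (rootFst i) (rootSnd i)
  | .F i => if rootSnd i = (rootSnd i).rev then descendShort hs (rootFst i) (rootSnd i)
      else descend hs (rootFst i) (rootSnd i)

/-- The values of the counit on the generators. -/
def genCounit {N : ℕ} : Gen N → ℂ
  | .Khat _ => 1
  | .KhatInv _ => 1
  | .K _ => 1
  | .KInv _ => 1
  | .E _ => 0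
  | .F _ => 0

/-- The action `X ▷ a`. An element of `U_q(so_N)` is represented by a noncommutative polynomial in
the generators; invariance under a subalgebra spanned by such polynomials does not depend on the
relations of `U_q(so_N)`, because the action and the counit respect them. -/
def action {N : ℕ} {s : ℂ} (hs : Admissible s) :
    FreeAlgebra ℂ (Gen N) →ₐ[ℂ] Module.End ℂ (Alg N s) :=
  FreeAlgebra.lift ℂ (genAct hs)

/-- The counit. -/
def counit (N : ℕ) : FreeAlgebra ℂ (Gen N) →ₐ[ℂ] ℂ := FreeAlgebra.lift ℂ genCounit

/-- The generators of `U_q(so_2)`: the element `K̂_1` and its inverse. -/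
def gensSO2 (N : ℕ) : Set (Gen N) :=
  {g | ∃ i : Fin (N / 2), (i : ℕ) = 0 ∧ (g = .Khat i ∨ g = .KhatInv i)}

/-- The generators of `U_q(so_{N-2})`, `N ≥ 4`: the elements `K_i`, `K_i⁻¹`, `E_i`, `F_i` with
`i = 2, …, n`; for `N = 4`, where `so_{N-2} = so_2`, the element `K̂_2` and its inverse. -/
def gensInner (N : ℕ) : Set (Gen N) :=
  if N = 4 then {g | ∃ i : Fin (N / 2), (i : ℕ) = 1 ∧ (g = .Khat i ∨ g = .KhatInv i)}
  else {g | ∃ i : Fin (N / 2), 0 < (i : ℕ) ∧ (g = .K i ∨ g = .KInv i ∨ g = .E i ∨ g = .F i)}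

/-- The subalgebra `U_q(so_2) × U_q(so_{N-2})`, generated by the two sets of generators. -/
def subalg (N : ℕ) : Subalgebra ℂ (FreeAlgebra ℂ (Gen N)) :=
  Algebra.adjoin ℂ (FreeAlgebra.ι ℂ '' (gensSO2 N ∪ gensInner N))

/-! ### The `q`-Laplace operator and harmonic polynomials -/

/-- The `q`-derivative. For `k < k'` it is
`∂_k x ^ ν = [ν_k]_q q ^ (ν_{k+1} + ⋯ + ν_{1'}) x ^ (ν - ε_k)`, for `k = k'` the same with `[ν_k]` in
place of `[ν_k]_q`, and for `k < k'` moreover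
`∂_{k'} x ^ ν = [ν_{k'}]_q q ^ (ν_k + ν_{(k-1)'} + ⋯ + ν_{1'}) x ^ (ν - ε_{k'})
  + ∑ j, [ν_j]_q [ν_{j'}]_q (q - q⁻¹) q ^ (ρ_k - ρ_j + d_{kj}) x ^ (ν + ε_k - ε_j - ε_{j'})
  + [ν_c - 1] [ν_c] (q - q⁻¹) / (1 + q) q ^ (ρ_k + 2 + e_k) x ^ (ν + ε_k - 2 ε_c)`,
with the sum over `k < j < j'`,
`d_{kj} = (ν_k + ⋯ + ν_{j-1}) + (ν_{(j-1)'} + ⋯ + ν_{1'})`, `e_k = (ν_k + ⋯ + ν_{1'}) - 2 ν_c`, where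
`c` is the index with `c = c'`; the last summand is absent if `N` is even. -/
def partialD {N : ℕ} {s : ℂ} (hs : Admissible s) (k : Fin N) : Module.End ℂ (Alg N s) :=
  onMon hs fun ν =>
    if k < k.rev then
      (qInt s (ν k) * (s ^ 2) ^ (∑ l ∈ Finset.Ioi k, ν l)) • mon s (lower ν k)
    else if k = k.rev then
      (bInt s (ν k) * (s ^ 2) ^ (∑ l ∈ Finset.Ioi k, ν l)) • mon s (lower ν k)
    else
      (qInt s (ν k) * (s ^ 2) ^ (ν k.rev + ∑ l ∈ Finset.Ioi k, ν l)) • mon s (lower ν k) +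
      ∑ j ∈ Finset.Ioi k.rev with j < j.rev,
        (qInt s (ν j) * qInt s (ν j.rev) * (s ^ 2 - (s ^ 2)⁻¹) *
          s ^ (twoRho k.rev - twoRho j) *
          (s ^ 2) ^ (∑ l ∈ Finset.Ico k.rev j, ν l + ∑ l ∈ Finset.Ioi j.rev, ν l)) •
            mon s (lower (move ν k.rev j) j.rev) +
      ∑ j : Fin N with j = j.rev,
        (bInt s ((ν j : ℤ) - 1) * bInt s (ν j) * ((s ^ 2 - (s ^ 2)⁻¹) / (1 + s ^ 2)) *
          s ^ (twoRho k.rev + 4) *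
          (s ^ 2) ^ ((∑ l ∈ Finset.Ici k.rev, (ν l : ℤ)) - 2 * ν j)) •
            mon s (lower (move ν k.rev j) j)

/-- The `q`-Laplace operator `∑ i, q ^ ρ_i ∂_i ∂_{i'}`. -/
def laplace (N : ℕ) {s : ℂ} (hs : Admissible s) : Module.End ℂ (Alg N s) :=
  ∑ i : Fin N, s ^ twoRho i • (partialD hs i * partialD hs i.rev)

/-- The space `A_m` of homogeneous polynomials of degree `m`. -/
def homog (N : ℕ) (s : ℂ) (m : ℕ) : Submodule ℂ (Alg N s) :=
  Submodule.span ℂ {p | ∃ ν : Fin N → ℕ, ∑ i, ν i = m ∧ p = mon s ν}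

/-- The space `H_m` of homogeneous harmonic polynomials of degree `m`. -/
def harmonic (N : ℕ) {s : ℂ} (hs : Admissible s) (m : ℕ) : Submodule ℂ (Alg N s) :=
  homog N s m ⊓ LinearMap.ker (laplace N hs)

/-- The space of polynomials in `H_m` that are zonal with respect to the subalgebra
`U_q(so_2) × U_q(so_{N-2})`: those with `X ▷ p = ε(X) p` for all `X` in the subalgebra. -/
def zonal (N : ℕ) {s : ℂ} (hs : Admissible s) (m : ℕ) : Submodule ℂ (Alg N s) where
  carrier := {p | p ∈ harmonic N hs m ∧ ∀ X ∈ subalg N, action hs X p = counit N X • p}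
  zero_mem' := ⟨Submodule.zero_mem _, fun X _ => by simp⟩
  add_mem' := fun ha hb => ⟨Submodule.add_mem _ ha.1 hb.1, fun X hX => by
    rw [map_add, ha.2 X hX, hb.2 X hX, smul_add]⟩
  smul_mem' := fun c p hp => ⟨Submodule.smul_mem _ c hp.1, fun X hX => by
    rw [map_smul, hp.2 X hX, smul_comm]⟩

/-! ### The projection onto harmonic polynomials and the polynomials `φ` -/

/-- The coefficients `α_k` of the projection `A_m → H_m`. -/
def projCoeff (N : ℕ) (s : ℂ) (m k : ℕ) : ℂ :=
  (s ^ 2) ^ (2 * (k : ℤ) ^ 2 - 2 * m * k - k) * (1 - (s ^ 2) ^ 2) ^ (2 * k) /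
    ((1 + (s ^ 2) ^ ((N : ℤ) - 2)) ^ (2 * k) *
      qPoch ((s ^ 2) ^ (-(N : ℤ) - 2 * m + 4)) ((s ^ 2) ^ 2) k * qPoch ((s ^ 2) ^ 2) ((s ^ 2) ^ 2) k)

/-- The operator `∑ k ≤ ⌊m / 2⌋, α_k Q ^ k Δ_q ^ k`, which is on `A_m` the projection onto `H_m` along
`Q A_{m-2}`. -/
def harmonicProj (N : ℕ) {s : ℂ} (hs : Admissible s) (m : ℕ) : Module.End ℂ (Alg N s) :=
  ∑ k ∈ Finset.range (m / 2 + 1),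
    projCoeff N s m k • (LinearMap.mulLeft ℂ (Q N s ^ k) * laplace N hs ^ k)

/-- The coefficients `C^k_{a b}`, where `m = a + b`; the factor `q ^ ((6 - N) k / 2)` is
`s ^ ((6 - N) k)`. -/
def phiCoeff (N : ℕ) (s : ℂ) (a b k : ℕ) : ℂ :=
  qPoch ((s ^ 2) ^ (-2 * (a : ℤ))) ((s ^ 2) ^ 2) k *
      qPoch ((s ^ 2) ^ (-2 * (b : ℤ))) ((s ^ 2) ^ 2) k /
    (qPoch ((s ^ 2) ^ 2) ((s ^ 2) ^ 2) k *
      qPoch ((s ^ 2) ^ (-(N : ℤ) - 2 * (a + b) + 4)) ((s ^ 2) ^ 2) k) *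
    (s ^ ((6 - (N : ℤ)) * k) / (1 + (s ^ 2) ^ ((N : ℤ) - 2)) ^ k)

/-- The polynomial `φ^m_{a b} = ∑ k ≤ min(a, b), C^k_{a b} Q ^ k x_1 ^ (a - k) x_{1'} ^ (b - k)` with
`m = a + b`. -/
def phi (N : ℕ) [NeZero N] (s : ℂ) (a b : ℕ) : Alg N s :=
  ∑ k ∈ Finset.range (min a b + 1),
    phiCoeff N s a b k • (Q N s ^ k * (x s 0 ^ (a - k) * x s (Fin.rev 0) ^ (b - k)))

end

end QuantumEuclid

/-!
Every polynomial in `N + 2` variables is in a unique way a sum of products `x_1 ^ a y x_{N+2} ^ b`,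
where `y` is a polynomial in the `N` inner variables, which generate a copy of the algebra for `N`
(`sandwich`, `comp`). In terms of this decomposition all structures are given by recursions in steps
of two variables, and all identities between them are proved by induction along these recursions.

* Let `normQ` be `Q` divided by `q ^ (N / 2 - 1) + q ^ (1 - N / 2)`. Multiplication by it sends
  `x_1 ^ a y x_N ^ b` to
  `x_1 ^ (a + 1) (σ y) x_N ^ (b + 1) + q x_1 ^ a (normQ y) x_N ^ b`, with `normQ` on the right taken in
  the inner variables and `σ` the rescaling of the variables by `q⁻¹` (`normQ_mul_sandwich`).
* Up to a nonzero factor that depends on the degree only, the `q`-Laplace operator is an operator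
  `redLap` with `x_1 ^ a y x_N ^ b ↦ [a]_q [b]_q x_1 ^ (a - 1) y x_N ^ (b - 1)
  + q ^ (a + b + 1) x_1 ^ a (redLap y) x_N ^ b` (`redLap_sandwich`, `laplace_of_homog`). The commutator
  of `redLap` and `normQ` is a scalar in each degree (`redLap_normQ_mul`), which gives the
  two-term recurrence for harmonic polynomials in `Q` and `x_1 x_N`, hence that `φ` is harmonic and
  that it is the image of `x_1 ^ h x_N ^ h` under the projection (`phi_mem_harmonic`,
  `harmonicProj_outerPow`).
* The generators `E_i` and `F_i` commute with multiplication by `Q` and annihilate the constants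
  (`commutesRadius_genAct`). Hence those of the inner algebra annihilate `φ`, and `φ` is zonal
  (`phi_mem_zonal`).

For the converse, a zonal polynomial `p` has weight zero, since `q` is not a root of unity
(`zonal_le_zeroWeight`), so only components with `a = b` occur. As `redLap p = 0`, the recursion for
`redLap` computes the component for `a + 1` from the one for `a`; so `p` is determined by its component
for `a = b = 0` (`eq_zero_of_mem_harmonic`). That component is an invariant of the inner algebra, and
such an invariant is a polynomial in the squared radius (`mem_radial_of_invariant`), again by induction:
the equation `E_1 p = 0` determines an invariant from its component for `a = b = 0`, which is an
invariant of the next inner algebra. As it is homogeneous of degree `m`, it is zero if `m` is odd and a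
multiple of `normQ ^ h` if `m = 2 h`, where `φ` has a nonzero multiple of `normQ ^ h` as its component
(`comp_phi`).
-/

namespace QuantumEuclid

noncomputable section

/-! ### Linear maps given on the monomials -/

theorem onMon_mon {N : ℕ} {s : ℂ} (hs : Admissible s) (f : (Fin N → ℕ) → Alg N s)
    (ν : Fin N → ℕ) : onMon hs f (mon s ν) = f ν := by
  rw [onMon, ← monBasis_apply hs, Module.Basis.constr_basis]

/-- Linear maps that agree on the ordered monomials are equal. -/
theorem linearMap_eq_of_mon {N : ℕ} {s : ℂ} (hs : Admissible s) {V : Type*} [AddCommGroup V]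
    [Module ℂ V] {f g : Alg N s →ₗ[ℂ] V} (h : ∀ ν, f (mon s ν) = g (mon s ν)) (p : Alg N s) :
    f p = g p := by
  have : f = g := (monBasis hs).ext fun ν => by rw [monBasis_apply]; exact h ν
  rw [this]

theorem mon_zero {N : ℕ} (s : ℂ) : mon (N := N) s 0 = 1 := by
  simp [mon]

theorem scale_mon {N : ℕ} (s c : ℂ) (ν : Fin N → ℕ) :
    scale N s c (mon s ν) = c ^ (∑ i, ν i) • mon s ν := by
  have h : ∀ l : List (Fin N), scale N s c ((l.map fun i => x s i ^ ν i).prod) =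
      c ^ ((l.map ν).sum) • (l.map fun i => x s i ^ ν i).prod := by
    intro l
    induction l with
    | nil => simp
    | cons i l ih =>
      simp only [List.map_cons, List.prod_cons, List.sum_cons, map_mul, ih, map_pow, scale_x,
        smul_pow, smul_mul_assoc, mul_smul_comm, smul_smul, pow_add]
      congr 1
      ring
  have h1 := h (List.finRange N)
  rw [← List.ofFn_eq_map, ← List.ofFn_eq_map, List.sum_ofFn] at h1
  exact h1

/-! ### Splitting off the first and the last variable -/

/-- The exponent vector `(a, ν_1, …, ν_N, b)`. -/
def wrap {N : ℕ} (a b : ℕ) (ν : Fin N → ℕ) : Fin (N + 2) → ℕ := Fin.cons a (Fin.snoc ν b)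

section wrap

variable {N : ℕ} (a b : ℕ) (ν : Fin N → ℕ)

@[simp] theorem wrap_zero : wrap a b ν 0 = a := rfl

@[simp] theorem wrap_last : wrap a b ν (Fin.last (N + 1)) = b := by
  rw [wrap, ← Fin.succ_last, Fin.cons_succ, Fin.snoc_last]

@[simp] theorem wrap_emb (i : Fin N) : wrap a b ν (emb i) = ν i := by
  rw [wrap, emb, Fin.cons_succ, Fin.snoc_castSucc]

theorem wrap_eta (ν : Fin (N + 2) → ℕ) :
    wrap (ν 0) (ν (Fin.last (N + 1))) (fun i => ν (emb i)) = ν := by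
  funext k
  rcases fin_cases2 k with rfl | rfl | ⟨i, rfl⟩ <;> simp

theorem wrap_injective {a b a' b' : ℕ} {ν ν' : Fin N → ℕ} (h : wrap a b ν = wrap a' b' ν') :
    a = a' ∧ b = b' ∧ ν = ν' := by
  refine ⟨?_, ?_, ?_⟩
  · simpa using congrFun h 0
  · simpa using congrFun h (Fin.last _)
  · funext i; simpa using congrFun h (emb i)

theorem emb_ne_zero (i : Fin N) : emb i ≠ 0 := by
  rw [Ne, Fin.ext_iff, emb_val, Fin.val_zero]; omega

theorem emb_ne_last (i : Fin N) : emb i ≠ Fin.last (N + 1) := by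
  rw [Ne, Fin.ext_iff, emb_val, Fin.val_last]; omega

theorem sum_fin_add_two {V : Type*} [AddCommMonoid V] (f : Fin (N + 2) → V) :
    ∑ i, f i = f 0 + (∑ i, f (emb i) + f (Fin.last (N + 1))) := by
  rw [Fin.sum_univ_succ, Fin.sum_univ_castSucc]
  rfl

theorem sum_wrap : ∑ i, wrap a b ν i = a + (∑ i, ν i + b) := by
  simp [sum_fin_add_two]

theorem lower_wrap_zero : lower (wrap a b ν) 0 = wrap (a - 1) b ν := by
  funext k
  rcases fin_cases2 k with rfl | rfl | ⟨i, rfl⟩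
  · simp [lower]
  · simp [lower]
  · simp [lower, Pi.single_eq_of_ne (emb_ne_zero i)]

theorem lower_wrap_last : lower (wrap a b ν) (Fin.last (N + 1)) = wrap a (b - 1) ν := by
  funext k
  rcases fin_cases2 k with rfl | rfl | ⟨i, rfl⟩
  · simp [lower]
  · simp [lower]
  · simp [lower, Pi.single_eq_of_ne (emb_ne_last i)]

theorem single_emb_emb (i j : Fin N) :
    (Pi.single (emb j) 1 : Fin (N + 2) → ℕ) (emb i) = (Pi.single j 1 : Fin N → ℕ) i := by
  by_cases h : i = j
  · subst h; simp
  · rw [Pi.single_eq_of_ne h, Pi.single_eq_of_ne (fun h' => h (emb_inj.1 h'))]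

theorem lower_wrap_emb (j : Fin N) : lower (wrap a b ν) (emb j) = wrap a b (lower ν j) := by
  funext k
  rcases fin_cases2 k with rfl | rfl | ⟨i, rfl⟩
  · simp [lower, Pi.single_eq_of_ne (emb_ne_zero j).symm]
  · simp [lower, Pi.single_eq_of_ne (emb_ne_last j).symm]
  · simp [lower, single_emb_emb]

/-- The exponent vector `ν + ε_j`. -/
def incr {N : ℕ} (ν : Fin N → ℕ) (j : Fin N) : Fin N → ℕ := ν + Pi.single j 1

theorem move_eq (i j : Fin N) : move ν i j = lower (incr ν i) j := rfl

theorem incr_wrap_zero : incr (wrap a b ν) 0 = wrap (a + 1) b ν := by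
  funext k
  rcases fin_cases2 k with rfl | rfl | ⟨i, rfl⟩
  · simp [incr]
  · simp [incr]
  · simp [incr, Pi.single_eq_of_ne (emb_ne_zero i)]

theorem incr_wrap_last : incr (wrap a b ν) (Fin.last (N + 1)) = wrap a (b + 1) ν := by
  funext k
  rcases fin_cases2 k with rfl | rfl | ⟨i, rfl⟩
  · simp [incr]
  · simp [incr]
  · simp [incr, Pi.single_eq_of_ne (emb_ne_last i)]

theorem incr_wrap_emb (j : Fin N) : incr (wrap a b ν) (emb j) = wrap a b (incr ν j) := by
  funext k
  rcases fin_cases2 k with rfl | rfl | ⟨i, rfl⟩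
  · simp [incr, Pi.single_eq_of_ne (emb_ne_zero j).symm]
  · simp [incr, Pi.single_eq_of_ne (emb_ne_last j).symm]
  · simp [incr, single_emb_emb]

end wrap

/-- The embedding `y ↦ x_1 ^ a y x_N ^ b` of the polynomials in the inner variables. The whole
algebra is the direct sum of its images. -/
def sandwich {N : ℕ} {s : ℂ} (a b : ℕ) : Alg N s →ₗ[ℂ] Alg (N + 2) s where
  toFun y := x s 0 ^ a * (incl N s y * x s (Fin.last (N + 1)) ^ b)
  map_add' y z := by simp [add_mul, mul_add]
  map_smul' c y := by simp

theorem sandwich_apply {N : ℕ} {s : ℂ} (a b : ℕ) (y : Alg N s) :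
    sandwich a b y = x s 0 ^ a * (incl N s y * x s (Fin.last (N + 1)) ^ b) := rfl

theorem sandwich_mon {N : ℕ} {s : ℂ} (a b : ℕ) (ν : Fin N → ℕ) :
    sandwich a b (mon s ν) = mon s (wrap a b ν) := by
  rw [mon_succ, sandwich_apply]; simp

theorem sandwich_one {N : ℕ} {s : ℂ} (a b : ℕ) :
    sandwich a b (1 : Alg N s) = x s 0 ^ a * x s (Fin.last (N + 1)) ^ b := by
  simp [sandwich_apply]

/-- Linear maps that agree on all products `x_1 ^ a x ^ ν x_N ^ b` are equal. -/
theorem linearMap_eq_of_sandwich {N : ℕ} {s : ℂ} (hs : Admissible s) {V : Type*} [AddCommGroup V]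
    [Module ℂ V] {f g : Alg (N + 2) s →ₗ[ℂ] V}
    (h : ∀ a b (ν : Fin N → ℕ), f (sandwich a b (mon s ν)) = g (sandwich a b (mon s ν)))
    (p : Alg (N + 2) s) : f p = g p :=
  linearMap_eq_of_mon hs (fun ν => by rw [← wrap_eta ν, ← sandwich_mon]; exact h _ _ _) p

/-- The component `y` of `x_1 ^ a y x_N ^ b` in a polynomial. -/
def comp {N : ℕ} {s : ℂ} (hs : Admissible s) (a b : ℕ) : Alg (N + 2) s →ₗ[ℂ] Alg N s where
  toFun p := rep hs p (delta 0 0 1) a b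
  map_add' p r := by simp
  map_smul' c p := by simp

/-- The components are the coordinates for the decomposition into the images of the maps
`sandwich a b`. -/
theorem comp_sandwich {N : ℕ} {s : ℂ} (hs : Admissible s) (a b a' b' : ℕ) (y : Alg N s) :
    comp hs a b (sandwich a' b' y) = if a = a' ∧ b = b' then y else 0 := by
  change rep hs (sandwich a' b' y) (delta 0 0 1) a b = _
  rw [sandwich_apply, map_mul, map_mul, Module.End.mul_apply, Module.End.mul_apply, rep_last_pow,
    rep_incl, rep_zero_pow, zero_add, mul_one]
  rfl

theorem repr_mon {N : ℕ} {s : ℂ} (hs : Admissible s) (ν : Fin N → ℕ) :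
    (monBasis hs).repr (mon s ν) = Finsupp.single ν 1 := by
  rw [← monBasis_apply hs, Module.Basis.repr_self]

theorem repr_comp {N : ℕ} {s : ℂ} (hs : Admissible s) (a b : ℕ) (ν : Fin N → ℕ)
    (p : Alg (N + 2) s) :
    (monBasis hs).repr (comp hs a b p) ν = (monBasis hs).repr p (wrap a b ν) := by
  refine linearMap_eq_of_sandwich hs (f := (monBasis hs).coord ν ∘ₗ comp hs a b)
    (g := (monBasis hs).coord (wrap a b ν)) (fun a' b' ν' => ?_) p
  simp only [LinearMap.comp_apply, Module.Basis.coord_apply, comp_sandwich]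
  rw [sandwich_mon, repr_mon]
  by_cases h : wrap a' b' ν' = wrap a b ν
  · obtain ⟨rfl, rfl, rfl⟩ := wrap_injective h
    simp [repr_mon]
  · rw [Finsupp.single_eq_of_ne (Ne.symm h)]
    split_ifs with h1
    · rw [repr_mon, Finsupp.single_eq_of_ne]
      rintro rfl
      exact h (by rw [h1.1, h1.2])
    · simp

theorem eq_zero_of_comp {N : ℕ} {s : ℂ} (hs : Admissible s) {p : Alg (N + 2) s}
    (h : ∀ a b, comp hs a b p = 0) : p = 0 := by
  apply (monBasis hs).repr.injective
  ext ν
  rw [← wrap_eta ν, ← repr_comp, h]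
  simp

/-! ### The squared radius -/

/-- The factor `q ^ (N / 2 - 1) + q ^ (1 - N / 2)`. -/
def radFactor (N : ℕ) (s : ℂ) : ℂ := s ^ ((N : ℤ) - 2) + s ^ (-(N : ℤ) + 2)

theorem radFactor_ne_zero {s : ℂ} (hs : Admissible s) (N : ℕ) : radFactor N s ≠ 0 := by
  have := den_ne hs ((N : ℤ) - 2)
  rwa [show -((N : ℤ) - 2) = -(N : ℤ) + 2 by ring] at this

/-- The squared radius, divided by `q ^ (N / 2 - 1) + q ^ (1 - N / 2)`. -/
def normQ (N : ℕ) (s : ℂ) : Alg N s := (radFactor N s)⁻¹ • Q N s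

theorem Q_eq_normQ {s : ℂ} (hs : Admissible s) (N : ℕ) : Q N s = radFactor N s • normQ N s := by
  rw [normQ, smul_smul, mul_inv_cancel₀ (radFactor_ne_zero hs N), one_smul]

theorem normQ_succ {s : ℂ} (hs : Admissible s) (N : ℕ) :
    normQ (N + 2) s = x s 0 * x s (Fin.last (N + 1)) + s ^ 2 • incl N s (normQ N s) := by
  have e : radFactor (N + 2) s = s ^ (N : ℤ) + s ^ (-(N : ℤ)) := by
    simp only [radFactor]; push_cast; congr 2 <;> ring
  rw [normQ, Q_succ N hs, ← e, smul_smul, inv_mul_cancel₀ (radFactor_ne_zero hs _), one_smul,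
    normQ, map_smul, smul_smul, div_eq_mul_inv]
  rfl

theorem normQ_central {s : ℂ} (hs : Admissible s) (N : ℕ) (y : Alg N s) :
    normQ N s * y = y * normQ N s := by
  rw [normQ, smul_mul_assoc, mul_smul_comm, Q_central hs]

/-- The recursion for the squared radius in the number of variables. The scaling comes from moving
`x_1` and `x_N` past the inner polynomial. -/
theorem normQ_mul_sandwich {N : ℕ} {s : ℂ} (hs : Admissible s) (a b : ℕ) (y : Alg N s) :
    normQ (N + 2) s * sandwich a b y =
      sandwich (a + 1) (b + 1) (scale N s (s ^ 2)⁻¹ y) + s ^ 2 • sandwich a b (normQ N s * y) := by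
  rw [sandwich_apply, ← mul_assoc, normQ_central hs, mul_assoc, normQ_succ hs, add_mul, mul_add]
  congr 1
  · rw [sandwich_apply, pow_succ (x s 0), pow_succ' (x s (Fin.last _)), mul_assoc (x s 0),
      ← mul_assoc (x s (Fin.last _)), last_incl hs.1]
    simp only [mul_assoc]
  · rw [sandwich_apply, map_mul, smul_mul_assoc, mul_smul_comm, mul_assoc]

theorem comp_normQ_mul {N : ℕ} {s : ℂ} (hs : Admissible s) {a b : ℕ} (hab : a = 0 ∨ b = 0)
    (p : Alg (N + 2) s) :
    comp hs a b (normQ (N + 2) s * p) = s ^ 2 • (normQ N s * comp hs a b p) := by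
  refine linearMap_eq_of_sandwich hs (f := comp hs a b ∘ₗ LinearMap.mulLeft ℂ (normQ (N + 2) s))
    (g := s ^ 2 • (LinearMap.mulLeft ℂ (normQ N s) ∘ₗ comp hs a b)) (fun c d ν => ?_) p
  simp only [LinearMap.comp_apply, LinearMap.mulLeft_apply, normQ_mul_sandwich hs, map_add,
    map_smul, comp_sandwich, LinearMap.smul_apply]
  rw [if_neg (by omega), zero_add]
  split_ifs <;> simp

theorem comp_succ_normQ_mul {N : ℕ} {s : ℂ} (hs : Admissible s) (a b : ℕ) (p : Alg (N + 2) s) :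
    comp hs (a + 1) (b + 1) (normQ (N + 2) s * p) =
      scale N s (s ^ 2)⁻¹ (comp hs a b p) + s ^ 2 • (normQ N s * comp hs (a + 1) (b + 1) p) := by
  refine linearMap_eq_of_sandwich hs
    (f := comp hs (a + 1) (b + 1) ∘ₗ LinearMap.mulLeft ℂ (normQ (N + 2) s))
    (g := (scale N s (s ^ 2)⁻¹).toLinearMap ∘ₗ comp hs a b +
      s ^ 2 • (LinearMap.mulLeft ℂ (normQ N s) ∘ₗ comp hs (a + 1) (b + 1))) (fun c d ν => ?_) p
  simp only [LinearMap.comp_apply, LinearMap.mulLeft_apply, normQ_mul_sandwich hs, map_add,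
    map_smul, comp_sandwich, LinearMap.smul_apply, LinearMap.add_apply, AlgHom.toLinearMap_apply,
    add_left_inj]
  split_ifs <;> simp

/-- In the lowest component, the squared radius acts by that of the inner variables. -/
theorem comp_normQ_pow_mul {N : ℕ} {s : ℂ} (hs : Admissible s) (k : ℕ) (p : Alg (N + 2) s) :
    comp hs 0 0 (normQ (N + 2) s ^ k * p) =
      (s ^ 2) ^ k • (normQ N s ^ k * comp hs 0 0 p) := by
  induction k with
  | zero => simp
  | succ k ih =>
    rw [pow_succ', mul_assoc, comp_normQ_mul hs (Or.inl rfl), ih, mul_smul_comm, smul_smul,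
      pow_succ' (normQ N s), pow_succ' (s ^ 2), mul_assoc]

/-- The powers of the squared radius do not vanish: the highest component of the `k`-th power, the
one at `x_1 ^ k x_N ^ k`, is one. -/
theorem normQ_pow_ne_zero {N : ℕ} {s : ℂ} (hs : Admissible s) (k : ℕ) :
    normQ (N + 2) s ^ k ≠ 0 := by
  have h1 : ∀ l : ℕ, comp hs l l (1 : Alg (N + 2) s) = if l = 0 then 1 else 0 := by
    intro l
    have := comp_sandwich hs l l 0 0 (1 : Alg N s)
    rw [sandwich_one] at this
    simpa using this
  have h : comp hs k k (normQ (N + 2) s ^ k) = 1 ∧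
      ∀ l, k < l → comp hs l l (normQ (N + 2) s ^ k) = 0 := by
    induction k with
    | zero =>
      rw [pow_zero]
      exact ⟨by rw [h1, if_pos rfl], fun l hl => by rw [h1, if_neg (by omega)]⟩
    | succ k ih =>
      refine ⟨?_, fun l hl => ?_⟩
      · rw [pow_succ', comp_succ_normQ_mul, ih.1, ih.2 _ (by omega)]; simp
      · obtain ⟨l, rfl⟩ : ∃ l', l = l' + 1 := ⟨l - 1, by omega⟩
        rw [pow_succ', comp_succ_normQ_mul, ih.2 l (by omega), ih.2 _ (by omega)]; simp
  intro h0
  have h2 := h.1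
  rw [h0, map_zero] at h2
  -- the constants are not zero, since the empty monomial belongs to a basis
  have h3 := (monBasis (N := N) hs).ne_zero 0
  rw [monBasis_apply, mon_zero] at h3
  exact h3 h2.symm

/-! ### The `q`-Laplace operator -/

section sums

variable {N : ℕ} {V : Type*} [AddCommMonoid V] (f : Fin (N + 2) → V)

theorem sum_eq_sum_ite {n : ℕ} (S : Finset (Fin n)) (f : Fin n → V) :
    ∑ l ∈ S, f l = ∑ l, if l ∈ S then f l else 0 := by
  simp

theorem emb_pos (i : Fin N) : (0 : Fin (N + 2)) < emb i := by
  rw [Fin.lt_def, emb_val, Fin.val_zero]; omega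

theorem emb_lt_last (i : Fin N) : emb i < Fin.last (N + 1) := by
  rw [Fin.lt_def, emb_val, Fin.val_last]; omega

theorem emb_le (i j : Fin N) : emb i ≤ emb j ↔ i ≤ j := by
  rw [← not_lt, emb_lt, not_lt]

theorem sum_Ioi_zero : ∑ l ∈ Finset.Ioi 0, f l = ∑ i, f (emb i) + f (Fin.last (N + 1)) := by
  rw [sum_eq_sum_ite, sum_fin_add_two]
  simp [emb_ne_zero]

theorem sum_Ioi_emb (j : Fin N) :
    ∑ l ∈ Finset.Ioi (emb j), f l = ∑ i ∈ Finset.Ioi j, f (emb i) + f (Fin.last (N + 1)) := by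
  rw [sum_eq_sum_ite, sum_fin_add_two, sum_eq_sum_ite (Finset.Ioi j)]
  simp [emb_lt, emb_lt_last]

theorem sum_Ici_emb (j : Fin N) :
    ∑ l ∈ Finset.Ici (emb j), f l = ∑ i ∈ Finset.Ici j, f (emb i) + f (Fin.last (N + 1)) := by
  rw [sum_eq_sum_ite, sum_fin_add_two, sum_eq_sum_ite (Finset.Ici j)]
  simp [emb_le, emb_ne_zero, Fin.le_last]

theorem sum_Iio_emb (j : Fin N) :
    ∑ l ∈ Finset.Iio (emb j), f l = f 0 + ∑ i ∈ Finset.Iio j, f (emb i) := by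
  rw [sum_eq_sum_ite, sum_fin_add_two, sum_eq_sum_ite (Finset.Iio j)]
  simp [emb_lt, emb_pos, (emb_lt_last j).not_gt]

theorem sum_Ico_zero_emb (j : Fin N) :
    ∑ l ∈ Finset.Ico 0 (emb j), f l = f 0 + ∑ i ∈ Finset.Iio j, f (emb i) := by
  rw [sum_eq_sum_ite, sum_fin_add_two, sum_eq_sum_ite (Finset.Iio j)]
  simp [emb_lt, emb_pos, (emb_lt_last j).not_gt]

theorem sum_Ico_emb (i j : Fin N) :
    ∑ l ∈ Finset.Ico (emb i) (emb j), f l = ∑ l ∈ Finset.Ico i j, f (emb l) := by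
  rw [sum_eq_sum_ite, sum_fin_add_two, sum_eq_sum_ite (Finset.Ico i j)]
  simp [emb_lt, emb_le, emb_ne_zero, (emb_lt_last j).not_gt]

theorem sum_Ioi_last : ∑ l ∈ Finset.Ioi (Fin.last (N + 1)), f l = 0 := by
  rw [show Finset.Ioi (Fin.last (N + 1)) = ∅ from ?_, Finset.sum_empty]
  ext i
  simp [Fin.le_last]

theorem zero_lt_last : (0 : Fin (N + 2)) < Fin.last (N + 1) := by
  rw [Fin.lt_def, Fin.val_zero, Fin.val_last]; omega

theorem sum_Ioi_zero_lt_rev :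
    ∑ j ∈ Finset.Ioi (0 : Fin (N + 2)) with j < j.rev, f j =
      ∑ j : Fin N with j < j.rev, f (emb j) := by
  rw [Finset.sum_filter, sum_Ioi_zero, Finset.sum_filter]
  simp [rev_emb, emb_lt]

theorem sum_Ioi_emb_lt_rev (i : Fin N) :
    ∑ j ∈ Finset.Ioi (emb i) with j < j.rev, f j =
      ∑ j ∈ Finset.Ioi i with j < j.rev, f (emb j) := by
  rw [Finset.sum_filter, sum_Ioi_emb, Finset.sum_filter]
  simp [rev_emb, emb_lt]

theorem sum_lt_rev : ∑ j : Fin (N + 2) with j < j.rev, f j =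
    f 0 + ∑ j : Fin N with j < j.rev, f (emb j) := by
  rw [Finset.sum_filter, sum_fin_add_two, Finset.sum_filter]
  simp [rev_emb, emb_lt, zero_lt_last]

theorem sum_eq_rev : ∑ j : Fin (N + 2) with j = j.rev, f j =
    ∑ j : Fin N with j = j.rev, f (emb j) := by
  rw [Finset.sum_filter, sum_fin_add_two, Finset.sum_filter]
  simp [rev_emb, emb_inj, zero_lt_last.ne, zero_lt_last.ne']

end sums

/-- The multiple of the `q`-Laplace operator (by a factor depending on the degree only) with the
explicit form
`x ^ ν ↦ ∑ j, [ν_j]_q [ν_{j'}]_q q ^ (j - 1 + (ν_1 + ⋯ + ν_{j-1}) + (ν_{(j-1)'} + ⋯ + ν_{1'}))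
  x ^ (ν - ε_j - ε_{j'}) + [ν_c - 1] [ν_c] q ^ (N / 2 + 1 + |ν| - 2 ν_c) / (1 + q) x ^ (ν - 2 ε_c)`,
where `j < j'` in the sum and where the last summand, with `c = c'`, is absent if `N` is even. -/
def redLap {N : ℕ} {s : ℂ} (hs : Admissible s) : Module.End ℂ (Alg N s) :=
  onMon hs fun ν =>
    ∑ j : Fin N with j < j.rev,
      (qInt s (ν j) * qInt s (ν j.rev) * s ^ ((N : ℤ) - 2 - twoRho j) *
        (s ^ 2) ^ (∑ l ∈ Finset.Iio j, ν l + ∑ l ∈ Finset.Ioi j.rev, ν l)) •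
          mon s (lower (lower ν j) j.rev) +
    ∑ j : Fin N with j = j.rev,
      (bInt s ((ν j : ℤ) - 1) * bInt s (ν j) * (s ^ ((N : ℤ) + 2) / (1 + s ^ 2)) *
        (s ^ 2) ^ ((∑ l, (ν l : ℤ)) - 2 * ν j)) • mon s (lower (lower ν j) j)

/-- The recursion for the reduced `q`-Laplace operator in the number of variables. -/
theorem redLap_sandwich {N : ℕ} {s : ℂ} (hs : Admissible s) (a b : ℕ) (y : Alg N s) :
    redLap hs (sandwich a b y) = (qInt s a * qInt s b) • sandwich (a - 1) (b - 1) y +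
      (s ^ 2) ^ (a + b + 1) • sandwich a b (redLap hs y) := by
  have h0 := hs.1
  have h2 : s ^ 2 ≠ 0 := pow_ne_zero 2 h0
  refine linearMap_eq_of_mon hs (f := redLap hs ∘ₗ sandwich a b)
    (g := (qInt s a * qInt s b) • sandwich (a - 1) (b - 1) +
      (s ^ 2) ^ (a + b + 1) • (sandwich a b ∘ₗ redLap hs)) (fun ν => ?_) y
  simp only [LinearMap.comp_apply, LinearMap.add_apply, LinearMap.smul_apply]
  rw [sandwich_mon, redLap, onMon_mon, redLap, onMon_mon, sum_lt_rev, sum_eq_rev, add_assoc]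
  congr 1
  · rw [Fin.rev_zero, wrap_zero, wrap_last, sum_Ioi_last, twoRho_zero, lower_wrap_zero,
      lower_wrap_last, sandwich_mon, show Finset.Iio (0 : Fin (N + 2)) = ∅ from ?_]
    · push_cast
      simp
    · ext i; simp
  · simp only [map_add, map_sum, map_smul, smul_add, Finset.smul_sum, smul_smul, rev_emb,
      wrap_emb, twoRho_emb, sum_Iio_emb, sum_Ioi_emb, wrap_zero, wrap_last, lower_wrap_emb,
      sandwich_mon, sum_fin_add_two]
    congr 1
    · refine Finset.sum_congr rfl fun j _ => ?_
      congr 1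
      push_cast
      rw [show (N : ℤ) + 2 - 2 - twoRho j = ((N : ℤ) - 2 - twoRho j) + (2 : ℕ) by push_cast; ring,
        zpow_add₀ h0, zpow_natCast]
      ring
    · refine Finset.sum_congr rfl fun j _ => ?_
      congr 1
      push_cast
      rw [show (N : ℤ) + 2 + 2 = ((N : ℤ) + 2) + (2 : ℕ) by push_cast; ring,
        zpow_add₀ h0, zpow_natCast,
        show (a : ℤ) + (∑ i, (ν i : ℤ) + b) - 2 * ν j =
          (∑ i, (ν i : ℤ) - 2 * ν j) + (a + b : ℕ) by push_cast; ring, zpow_add₀ h2, zpow_natCast]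
      ring

theorem partialD_zero_sandwich {N : ℕ} {s : ℂ} (hs : Admissible s) (a b : ℕ) (y : Alg N s) :
    partialD hs 0 (sandwich a b y) =
      (qInt s a * (s ^ 2) ^ b) • sandwich (a - 1) b (scale N s (s ^ 2) y) := by
  refine linearMap_eq_of_mon hs (f := partialD hs 0 ∘ₗ sandwich a b)
    (g := (qInt s a * (s ^ 2) ^ b) • (sandwich (a - 1) b ∘ₗ (scale N s (s ^ 2)).toLinearMap))
    (fun ν => ?_) y
  simp only [LinearMap.comp_apply, LinearMap.smul_apply, AlgHom.toLinearMap_apply]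
  rw [sandwich_mon, partialD, onMon_mon, Fin.rev_zero, if_pos zero_lt_last, wrap_zero,
    sum_Ioi_zero, wrap_last, lower_wrap_zero, scale_mon, map_smul, smul_smul, sandwich_mon]
  congr 1
  simp only [wrap_emb]
  ring

/-- The correction terms in the derivative by the last variable add up to the reduced `q`-Laplace
operator of the inner variables. -/
theorem partialD_last_sandwich {N : ℕ} {s : ℂ} (hs : Admissible s) (a b : ℕ) (y : Alg N s) :
    partialD hs (Fin.last (N + 1)) (sandwich a b y) =
      (qInt s b * (s ^ 2) ^ a) • sandwich a (b - 1) y +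
        ((s ^ 2 - (s ^ 2)⁻¹) * (s ^ 2) ^ (a + b + 1)) • sandwich (a + 1) b (redLap hs y) := by
  have h0 := hs.1
  have h2 : s ^ 2 ≠ 0 := pow_ne_zero 2 h0
  refine linearMap_eq_of_mon hs (f := partialD hs (Fin.last (N + 1)) ∘ₗ sandwich a b)
    (g := (qInt s b * (s ^ 2) ^ a) • sandwich a (b - 1) +
      ((s ^ 2 - (s ^ 2)⁻¹) * (s ^ 2) ^ (a + b + 1)) • (sandwich (a + 1) b ∘ₗ redLap hs))
    (fun ν => ?_) y
  simp only [LinearMap.comp_apply, LinearMap.add_apply, LinearMap.smul_apply]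
  rw [sandwich_mon, partialD, onMon_mon, Fin.rev_last, if_neg (not_lt.2 zero_lt_last.le),
    if_neg zero_lt_last.ne', wrap_zero, sum_Ioi_last, wrap_last, lower_wrap_last, redLap, onMon_mon,
    sum_Ioi_zero_lt_rev, sum_eq_rev, add_assoc (_ • mon s _), sandwich_mon, add_zero a]
  congr 1
  simp only [map_add, map_sum, map_smul, smul_add, Finset.smul_sum, smul_smul, rev_emb, move_eq,
      wrap_emb, twoRho_emb, sum_Ico_zero_emb, sum_Ioi_emb, wrap_zero, wrap_last, lower_wrap_emb,
      sandwich_mon, incr_wrap_zero, twoRho_zero]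
  congr 1
  · refine Finset.sum_congr rfl fun j _ => ?_
    congr 1
    rw [show (N : ℤ) - twoRho j = ((N : ℤ) - 2 - twoRho j) + (2 : ℕ) by push_cast; ring,
      zpow_add₀ h0, zpow_natCast]
    ring
  · refine Finset.sum_congr rfl fun j _ => ?_
    congr 1
    have e : Finset.Ici (0 : Fin (N + 2)) = Finset.univ := by ext; simp
    rw [e, sum_fin_add_two]
    simp only [wrap_zero, wrap_emb, wrap_last]
    rw [show (N : ℤ) + 4 = ((N : ℤ) + 2) + (2 : ℕ) by push_cast; ring,
      zpow_add₀ h0, zpow_natCast,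
      show (a : ℤ) + (∑ i, (ν i : ℤ) + b) - 2 * ν j =
        (∑ i, (ν i : ℤ) - 2 * ν j) + (a + b : ℕ) by push_cast; ring, zpow_add₀ h2, zpow_natCast]
    ring

theorem partialD_emb_sandwich {N : ℕ} {s : ℂ} (hs : Admissible s) (k : Fin N) (a b : ℕ)
    (y : Alg N s) :
    partialD hs (emb k) (sandwich a b y) = (s ^ 2) ^ b • sandwich a b (partialD hs k y) := by
  have h0 := hs.1
  have h2 : s ^ 2 ≠ 0 := pow_ne_zero 2 h0
  refine linearMap_eq_of_mon hs (f := partialD hs (emb k) ∘ₗ sandwich a b)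
    (g := (s ^ 2) ^ b • (sandwich a b ∘ₗ partialD hs k)) (fun ν => ?_) y
  simp only [LinearMap.comp_apply, LinearMap.smul_apply]
  rw [sandwich_mon, partialD, onMon_mon, partialD, onMon_mon, rev_emb]
  simp only [emb_lt, emb_inj]
  split_ifs
  · simp only [wrap_emb, sum_Ioi_emb, wrap_last, lower_wrap_emb, map_smul, smul_smul, sandwich_mon]
    congr 1
    ring
  · simp only [wrap_emb, sum_Ioi_emb, wrap_last, lower_wrap_emb, map_smul, smul_smul, sandwich_mon]
    congr 1
    ring
  · simp only [map_add, map_sum, map_smul, smul_add, Finset.smul_sum, smul_smul, rev_emb, move_eq,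
      wrap_emb, twoRho_emb, sum_Ico_emb, sum_Ioi_emb, wrap_last, lower_wrap_emb,
      sandwich_mon, incr_wrap_emb, sum_Ioi_emb_lt_rev, sum_eq_rev, sum_Ici_emb]
    congr 1
    · congr 1
      · congr 1
        ring
      · refine Finset.sum_congr rfl fun j _ => ?_
        congr 1
        ring
    · refine Finset.sum_congr rfl fun j _ => ?_
      congr 1
      rw [show (∑ i ∈ Finset.Ici k.rev, (ν i : ℤ) + b) - 2 * ν j =
        (∑ i ∈ Finset.Ici k.rev, (ν i : ℤ) - 2 * ν j) + b by ring, zpow_add₀ h2, zpow_natCast]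
      ring

/-! ### `q`-numbers and the scalars of the recursions -/

theorem q_ne_zero {s : ℂ} (hs : Admissible s) : s ^ 2 ≠ 0 := pow_ne_zero 2 hs.1

theorem q_zpow_ne_one {s : ℂ} (hs : Admissible s) {k : ℤ} (hk : k ≠ 0) : (s ^ 2) ^ k ≠ 1 := by
  intro h
  rcases lt_or_gt_of_ne hk with hk | hk
  · refine hs.2 (-k).toNat (by omega) ?_
    rw [← zpow_natCast, Int.toNat_of_nonneg (by omega), zpow_neg, h, inv_one]
  · refine hs.2 k.toNat (by omega) ?_
    rw [← zpow_natCast, Int.toNat_of_nonneg (by omega), h]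

theorem eq_zero_of_q_zpow {s : ℂ} (hs : Admissible s) {k : ℤ} (h : (s ^ 2) ^ k = 1) : k = 0 := by
  by_contra hk
  exact q_zpow_ne_one hs hk h

theorem eq_of_q_pow_eq {s : ℂ} (hs : Admissible s) {k l : ℕ} (h : (s ^ 2) ^ k = (s ^ 2) ^ l) :
    k = l := by
  have h1 : (k : ℤ) - l = 0 := eq_zero_of_q_zpow hs (by
    rw [zpow_sub₀ (q_ne_zero hs), zpow_natCast, zpow_natCast, h,
      div_self (pow_ne_zero _ (q_ne_zero hs))])
  omega

theorem q_sub_inv_ne_zero {s : ℂ} (hs : Admissible s) : s ^ 2 - (s ^ 2)⁻¹ ≠ 0 := by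
  have h2 := q_ne_zero hs
  have h := q_zpow_ne_one hs (k := 2) (by norm_num)
  intro h'
  apply h
  rw [sub_eq_zero] at h'
  rw [zpow_ofNat, pow_two]
  nth_rewrite 1 [h']
  exact inv_mul_cancel₀ h2

theorem sq_sub_one_ne_zero {s : ℂ} (hs : Admissible s) : (s ^ 2) ^ 2 - 1 ≠ 0 := by
  have h := q_zpow_ne_one hs (k := 2) (by norm_num)
  rw [zpow_ofNat] at h
  exact sub_ne_zero.2 h

theorem one_sub_q_ne_zero {s : ℂ} (hs : Admissible s) : 1 - s ^ 2 ≠ 0 := by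
  have h := q_zpow_ne_one hs (k := 1) (by norm_num)
  rw [zpow_one] at h
  exact sub_ne_zero.2 h.symm

theorem one_add_q_ne_zero {s : ℂ} (hs : Admissible s) : 1 + s ^ 2 ≠ 0 := by
  have h2 := q_ne_zero hs
  have h := q_zpow_ne_one hs (k := 2) (by norm_num)
  intro h'
  apply h
  rw [zpow_ofNat, show s ^ 2 = -1 by linear_combination h']
  norm_num

@[simp] theorem qInt_zero (s : ℂ) : qInt s 0 = 0 := by simp [qInt]

theorem qInt_ne_zero {s : ℂ} (hs : Admissible s) {k : ℤ} (hk : k ≠ 0) : qInt s k ≠ 0 := by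
  have h2 := q_ne_zero hs
  rw [qInt]
  refine div_ne_zero ?_ (q_sub_inv_ne_zero hs)
  intro h
  refine q_zpow_ne_one hs (k := k + k) (by omega) ?_
  rw [zpow_add₀ h2]
  nth_rewrite 1 [sub_eq_zero.1 h]
  rw [← zpow_add₀ h2]
  simp

theorem bInt_ne_zero {s : ℂ} (hs : Admissible s) {k : ℤ} (hk : k ≠ 0) : bInt s k ≠ 0 :=
  div_ne_zero (sub_ne_zero.2 (q_zpow_ne_one hs hk).symm) (one_sub_q_ne_zero hs)

theorem qInt_natCast (s : ℂ) (k : ℕ) :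
    qInt s k = ((s ^ 2) ^ k - ((s ^ 2) ^ k)⁻¹) / (s ^ 2 - (s ^ 2)⁻¹) := by
  rw [qInt, zpow_neg, zpow_natCast]

theorem radFactor_eq {s : ℂ} (hs : Admissible s) (N : ℕ) :
    radFactor N s = s ^ N * (s ^ 2)⁻¹ + (s ^ N)⁻¹ * s ^ 2 := by
  have h0 := hs.1
  rw [radFactor, zpow_sub₀ h0, zpow_add₀ h0, zpow_neg, zpow_natCast]
  norm_cast

theorem radFactor_add_two {s : ℂ} (hs : Admissible s) (N : ℕ) :
    radFactor (N + 2) s = s ^ N + (s ^ N)⁻¹ := by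
  have h0 := hs.1
  rw [radFactor_eq hs, pow_add]
  field_simp

/-! ### The `q`-Laplace operator in each degree -/

theorem Q_fin_one (s : ℂ) : Q 1 s = x s 0 ^ 2 := by simp [Q, twoRho, pow_two]

theorem mon_fin_one {s : ℂ} (ν : Fin 1 → ℕ) : mon s ν = x s 0 ^ ν 0 := by simp [mon]

theorem x_pow_eq_mon {s : ℂ} (k : ℕ) : (x s 0 : Alg 1 s) ^ k = mon s fun _ => k := by
  simp [mon]

theorem redLap_fin_zero {s : ℂ} (hs : Admissible s) (y : Alg 0 s) : redLap hs y = 0 := by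
  refine linearMap_eq_of_mon hs (f := redLap hs) (g := 0) (fun ν => ?_) y
  rw [redLap, onMon_mon]
  simp

theorem lower_const (k : ℕ) (j : Fin 1) : lower (fun _ : Fin 1 => k) j = fun _ => k - 1 := by
  funext i
  rw [Subsingleton.elim i j]
  simp [lower]

theorem redLap_fin_one {s : ℂ} (hs : Admissible s) (k : ℕ) :
    redLap hs (x s (0 : Fin 1) ^ k) =
      (bInt s ((k : ℤ) - 1) * bInt s k * (s ^ 3 / (1 + s ^ 2)) * (s ^ 2) ^ (-(k : ℤ))) •
        x s 0 ^ (k - 2) := by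
  have e : ((k : ℤ) - 2 * k) = -k := by ring
  rw [x_pow_eq_mon, redLap, onMon_mon]
  simp only [Finset.sum_filter, Fin.isValue, Finset.univ_unique, Fin.default_eq_zero,
    Finset.sum_singleton, Fin.rev_zero, Fin.last_zero, lt_irrefl, if_false, if_true, zero_add,
    lower_const, x_pow_eq_mon, e]
  norm_num [Nat.sub_sub]

theorem laplace_fin_one {s : ℂ} (hs : Admissible s) (k : ℕ) :
    laplace 1 hs (x s (0 : Fin 1) ^ k) =
      (bInt s ((k : ℤ) - 1) * bInt s k) • x s 0 ^ (k - 2) := by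
  have h : ∀ k : ℕ, partialD hs (0 : Fin 1) (x s (0 : Fin 1) ^ k) = bInt s k • x s 0 ^ (k - 1) := by
    intro k
    rw [x_pow_eq_mon, partialD, onMon_mon, x_pow_eq_mon, lower_const]
    simp
  have e : twoRho (0 : Fin 1) = 0 := by simp [twoRho]
  rw [laplace]
  simp only [Finset.univ_unique, Fin.default_eq_zero, Finset.sum_singleton, Fin.rev_zero,
    Fin.last_zero, LinearMap.smul_apply, Module.End.mul_apply, h, map_smul, smul_smul,
    Nat.sub_sub, e, zpow_zero, one_mul, Fin.isValue]
  rcases k with _ | k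
  · simp [bInt]
  · push_cast
    rw [add_sub_cancel_right, mul_comm]

theorem scale_sandwich {N : ℕ} {s : ℂ} (hs : Admissible s) (c : ℂ) (a b : ℕ) (y : Alg N s) :
    scale (N + 2) s c (sandwich a b y) = c ^ (a + b) • sandwich a b (scale N s c y) := by
  refine linearMap_eq_of_mon hs (f := (scale (N + 2) s c).toLinearMap ∘ₗ sandwich a b)
    (g := c ^ (a + b) • (sandwich a b ∘ₗ (scale N s c).toLinearMap)) (fun ν => ?_) y
  simp only [LinearMap.comp_apply, AlgHom.toLinearMap_apply, LinearMap.smul_apply]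
  rw [sandwich_mon, scale_mon, scale_mon, map_smul, smul_smul, sandwich_mon, sum_wrap]
  congr 1
  ring

/-- The operator `redLap` lowers the degree by two. -/
theorem scale_redLap {s : ℂ} (hs : Admissible s) (c : ℂ) : ∀ (N : ℕ) (y : Alg N s),
    c ^ 2 • scale N s c (redLap hs y) = redLap hs (scale N s c y)
  | 0, y => by simp [redLap_fin_zero]
  | 1, y => by
    refine linearMap_eq_of_mon hs (f := c ^ 2 • ((scale 1 s c).toLinearMap ∘ₗ redLap hs))
      (g := redLap hs ∘ₗ (scale 1 s c).toLinearMap) (fun ν => ?_) y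
    simp only [LinearMap.comp_apply, AlgHom.toLinearMap_apply, LinearMap.smul_apply]
    rw [mon_fin_one, redLap_fin_one, map_smul, map_pow, map_pow, scale_x, smul_pow, smul_pow,
      map_smul, redLap_fin_one]
    simp only [smul_smul]
    rcases hk : ν 0 with _ | _ | k
    · simp [bInt]
    · simp [bInt]
    · congr 1
      rw [show k + 1 + 1 - 2 = k from rfl]
      ring
  | N + 2, y => by
    refine linearMap_eq_of_sandwich hs
      (f := c ^ 2 • ((scale (N + 2) s c).toLinearMap ∘ₗ redLap hs))
      (g := redLap hs ∘ₗ (scale (N + 2) s c).toLinearMap) (fun a b ν => ?_) y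
    simp only [LinearMap.comp_apply, AlgHom.toLinearMap_apply, LinearMap.smul_apply]
    rw [scale_sandwich hs, map_smul, redLap_sandwich, redLap_sandwich, ← scale_redLap hs c N]
    simp only [map_add, map_smul, scale_sandwich hs, smul_add, smul_smul]
    congr 1
    · rcases a with _ | a
      · simp
      rcases b with _ | b
      · simp
      congr 1
      simp only [Nat.add_sub_cancel]
      ring
    · congr 1
      ring

theorem laplace_apply {N : ℕ} {s : ℂ} (hs : Admissible s) (p : Alg N s) :
    laplace N hs p = ∑ i, s ^ twoRho i • partialD hs i (partialD hs i.rev p) := by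
  rw [laplace, LinearMap.sum_apply]
  rfl

/-- The `q`-Laplace operator is a multiple of `redLap` in each degree. The contributions of the outer
variables combine with those of the inner ones, which are known by induction, to the recursion for
`redLap`. -/
theorem laplace_mon {s : ℂ} (hs : Admissible s) : ∀ (N : ℕ) (ν : Fin N → ℕ),
    laplace N hs (mon s ν) =
      (radFactor N s * (s ^ 2) ^ ((∑ i, ν i : ℕ) - 1 : ℤ)) • redLap hs (mon s ν)
  | 0, ν => by simp [redLap_fin_zero, laplace]
  | 1, ν => by
    have h2 := q_ne_zero hs
    have h1 := one_add_q_ne_zero hs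
    have h0 := hs.1
    rw [mon_fin_one, laplace_fin_one, redLap_fin_one, smul_smul]
    congr 1
    rw [radFactor, Fin.sum_univ_one, zpow_sub₀ h2, zpow_neg]
    have h3 : (s ^ 2) ^ (ν 0 : ℤ) ≠ 0 := zpow_ne_zero _ h2
    have h4 : s ^ (((1 : ℕ) : ℤ) - 2) = s⁻¹ := by norm_num
    have h5 : s ^ (-((1 : ℕ) : ℤ) + 2) = s := by norm_num
    rw [h4, h5]
    field_simp
  | N + 2, ν => by
    have h2 := q_ne_zero hs
    have h0 := hs.1
    rw [← wrap_eta ν, sum_wrap, ← sandwich_mon]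
    generalize ν 0 = a
    generalize ν (Fin.last (N + 1)) = b
    generalize (fun i => ν (emb i)) = μ
    have hin : ∀ i : Fin N, s ^ twoRho (emb i) •
        (partialD hs (emb i) (partialD hs (emb i).rev (sandwich a b (mon s μ)))) =
        ((s ^ 2) ^ b * (s ^ 2) ^ b) •
          sandwich a b (s ^ twoRho i • partialD hs i (partialD hs i.rev (mon s μ))) := by
      intro i
      rw [rev_emb, partialD_emb_sandwich, map_smul, partialD_emb_sandwich, twoRho_emb, map_smul]
      simp only [smul_smul]
      congr 1
      ring
    have hsc : scale N s (s ^ 2) (redLap hs (mon s μ)) =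
        ((s ^ 2) ^ (∑ i, μ i) * ((s ^ 2) ^ 2)⁻¹) • redLap hs (mon s μ) := by
      have h := scale_redLap hs (s ^ 2) N (mon s μ)
      rw [scale_mon, map_smul] at h
      rw [mul_comm, ← smul_smul, ← h, smul_smul, inv_mul_cancel₀ (pow_ne_zero 2 h2), one_smul]
    rw [laplace_apply, sum_fin_add_two]
    simp only [hin]
    rw [← Finset.smul_sum, ← map_sum, ← laplace_apply, laplace_mon hs N,
      Fin.rev_zero, Fin.rev_last, twoRho_zero, twoRho_last, redLap_sandwich]
    simp only [partialD_zero_sandwich, partialD_last_sandwich, map_add, map_smul, hsc, scale_mon]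
    generalize redLap hs (mon s μ) = y
    generalize ∑ i, μ i = t
    have hN : s ^ N ≠ 0 := pow_ne_zero _ h0
    have hd := q_sub_inv_ne_zero hs
    have hd' := sq_sub_one_ne_zero hs
    simp only [smul_add, smul_smul]
    have e1 : (s ^ 2) ^ ((t : ℤ) - 1) = (s ^ 2) ^ t * (s ^ 2)⁻¹ := by
      rw [zpow_sub₀ h2, zpow_one, zpow_natCast]; rfl
    have e2 : (s ^ 2) ^ (((a + (t + b) : ℕ) : ℤ) - 1) =
        (s ^ 2) ^ a * (s ^ 2) ^ t * (s ^ 2) ^ b * (s ^ 2)⁻¹ := by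
      rw [zpow_sub₀ h2, zpow_one, zpow_natCast, pow_add, pow_add]; ring
    rw [e1, e2, zpow_neg, zpow_natCast, radFactor_add_two hs, radFactor_eq hs]
    simp only [qInt_natCast]
    generalize s ^ N = z at hN
    generalize s ^ 2 = q at h2 hd hd'
    have ha : q ^ a ≠ 0 := pow_ne_zero _ h2
    have hb : q ^ b ≠ 0 := pow_ne_zero _ h2
    rcases a with _ | a <;> rcases b with _ | b <;>
      simp only [Nat.add_sub_cancel, pow_zero, inv_one, sub_self, zero_div, zero_mul, mul_zero] <;>
      match_scalars <;> field_simp <;> ring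

/-! ### The commutator of the `q`-Laplace operator and the squared radius -/

theorem homog_induction {N : ℕ} {s : ℂ} {m : ℕ} {V : Type*} [AddCommGroup V] [Module ℂ V]
    {f g : Alg N s →ₗ[ℂ] V} (h : ∀ ν : Fin N → ℕ, ∑ i, ν i = m → f (mon s ν) = g (mon s ν))
    {p : Alg N s} (hp : p ∈ homog N s m) : f p = g p := by
  refine LinearMap.eqOn_span (f := f) (g := g) ?_ hp
  rintro _ ⟨ν, hν, rfl⟩
  exact h ν hν

theorem mon_mem_homog {N : ℕ} (s : ℂ) (ν : Fin N → ℕ) : mon s ν ∈ homog N s (∑ i, ν i) :=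
  Submodule.subset_span ⟨ν, rfl, rfl⟩

/-- On polynomials of a given degree, the `q`-Laplace operator is a nonzero multiple of `redLap`. -/
theorem laplace_of_homog {N : ℕ} {s : ℂ} (hs : Admissible s) {m : ℕ} {p : Alg N s}
    (hp : p ∈ homog N s m) :
    laplace N hs p = (radFactor N s * (s ^ 2) ^ ((m : ℤ) - 1)) • redLap hs p := by
  refine homog_induction (f := laplace N hs)
    (g := (radFactor N s * (s ^ 2) ^ ((m : ℤ) - 1)) • redLap hs) (fun ν hν => ?_) hp
  rw [laplace_mon, hν, LinearMap.smul_apply]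

/-- The scalar by which the commutator of `redLap` and `normQ` acts on polynomials of degree `m`. -/
def commScalar (N : ℕ) (s : ℂ) (m : ℕ) : ℂ :=
  ((s ^ 2) ^ ((m : ℤ) + N - 1) - (s ^ 2) ^ (-(m : ℤ) - 1)) / (s ^ 2 - (s ^ 2)⁻¹)

theorem commScalar_eq {s : ℂ} (hs : Admissible s) (N m : ℕ) :
    commScalar N s m = ((s ^ 2) ^ m * (s ^ 2) ^ N * (s ^ 2)⁻¹ - ((s ^ 2) ^ m)⁻¹ * (s ^ 2)⁻¹) /
      (s ^ 2 - (s ^ 2)⁻¹) := by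
  have h2 := q_ne_zero hs
  rw [commScalar, zpow_sub₀ h2, zpow_add₀ h2, zpow_sub₀ h2, zpow_neg, zpow_natCast, zpow_natCast,
    zpow_one]
  rfl

theorem scale_inv_redLap_mon {N : ℕ} {s : ℂ} (hs : Admissible s) (ν : Fin N → ℕ) :
    scale N s (s ^ 2)⁻¹ (redLap hs (mon s ν)) =
      ((s ^ 2) ^ 2 * ((s ^ 2) ^ (∑ i, ν i))⁻¹) • redLap hs (mon s ν) := by
  have h2 := q_ne_zero hs
  have h := scale_redLap hs (s ^ 2)⁻¹ N (mon s ν)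
  rw [scale_mon, map_smul] at h
  rw [← inv_pow (s ^ 2) (∑ i, ν i), ← smul_smul, ← h, smul_smul, ← mul_pow,
    mul_inv_cancel₀ h2, one_pow, one_smul]

/-- The commutation relation of the reduced `q`-Laplace operator and the squared radius, by
induction on the number of variables. -/
theorem redLap_normQ_mon {s : ℂ} (hs : Admissible s) : ∀ (N : ℕ) (ν : Fin N → ℕ),
    redLap hs (normQ N s * mon s ν) = normQ N s * redLap hs (mon s ν) +
      commScalar N s (∑ i, ν i) • mon s ν
  | 0, ν => by simp [redLap_fin_zero, commScalar]
  | 1, ν => by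
    have h0 := hs.1
    have h2 := q_ne_zero hs
    have h1 := one_add_q_ne_zero hs
    have h3 := one_sub_q_ne_zero hs
    have h4 := sq_sub_one_ne_zero hs
    have hd := q_sub_inv_ne_zero hs
    have e : normQ 1 s = (s * (1 + s ^ 2)⁻¹) • x s 0 ^ 2 := by
      rw [normQ, Q_fin_one, radFactor_eq hs]
      congr 1
      field_simp
    rw [mon_fin_one, e, smul_mul_assoc, ← pow_add, map_smul, redLap_fin_one, redLap_fin_one,
      Fin.sum_univ_one, smul_mul_assoc, mul_smul_comm, ← pow_add]
    generalize ν 0 = k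
    rw [show 2 + k - 2 = k by omega]
    have e2 : (bInt s ((k : ℤ) - 1) * bInt s k) • (x s 0 ^ (2 + (k - 2)) : Alg 1 s) =
        (bInt s ((k : ℤ) - 1) * bInt s k) • x s 0 ^ k := by
      rcases k with _ | _ | k
      · simp [bInt]
      · simp [bInt]
      · rw [show 2 + (k + 1 + 1 - 2) = k + 1 + 1 by omega]
    rw [show bInt s ((k : ℤ) - 1) * bInt s k * (s ^ 3 / (1 + s ^ 2)) * (s ^ 2) ^ (-(k : ℤ)) =
      ((s ^ 3 / (1 + s ^ 2)) * (s ^ 2) ^ (-(k : ℤ))) * (bInt s ((k : ℤ) - 1) * bInt s k) by ring,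
      ← smul_smul _ (bInt s ((k : ℤ) - 1) * bInt s k), e2]
    have hk : (s ^ 2) ^ k ≠ 0 := pow_ne_zero _ h2
    have b0 : bInt s k = (1 - (s ^ 2) ^ k) / (1 - s ^ 2) := by rw [bInt, zpow_natCast]
    have b1 : bInt s ((k : ℤ) - 1) = (1 - (s ^ 2) ^ k * (s ^ 2)⁻¹) / (1 - s ^ 2) := by
      rw [bInt, zpow_sub₀ h2, zpow_natCast, zpow_one]; rfl
    have b2 : bInt s (((2 + k : ℕ) : ℤ) - 1) = (1 - s ^ 2 * (s ^ 2) ^ k) / (1 - s ^ 2) := by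
      rw [bInt, show ((2 + k : ℕ) : ℤ) - 1 = ((1 + k : ℕ) : ℤ) by push_cast; ring, zpow_natCast,
        pow_add, pow_one]
    have b3 : bInt s ((2 + k : ℕ) : ℤ) = (1 - (s ^ 2) ^ 2 * (s ^ 2) ^ k) / (1 - s ^ 2) := by
      rw [bInt, zpow_natCast, pow_add]
    rw [b0, b1, b2, b3, zpow_neg, zpow_neg, zpow_natCast, zpow_natCast, commScalar_eq hs, pow_add,
      pow_one, show s ^ 3 = s * s ^ 2 by ring]
    match_scalars
    generalize (s ^ 2) ^ k = u at hk
    rw [show s ^ 2 - (s ^ 2)⁻¹ = -((1 - s ^ 2) * (1 + s ^ 2)) / s ^ 2 by field_simp; ring]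
    field_simp
    ring
  | N + 2, ν => by
    have h2 := q_ne_zero hs
    have h4 := sq_sub_one_ne_zero hs
    have hd := q_sub_inv_ne_zero hs
    rw [← wrap_eta ν, sum_wrap, ← sandwich_mon]
    generalize ν 0 = a
    generalize ν (Fin.last (N + 1)) = b
    generalize (fun i => ν (emb i)) = μ
    have ih := redLap_normQ_mon hs N μ
    have hsc := scale_inv_redLap_mon hs μ
    rw [normQ_mul_sandwich hs, map_add, map_smul, redLap_sandwich, redLap_sandwich,
      redLap_sandwich, ih, mul_add, mul_smul_comm, mul_smul_comm, normQ_mul_sandwich hs,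
      normQ_mul_sandwich hs, hsc, scale_mon]
    simp only [map_add, map_smul, smul_add, smul_smul, inv_pow, commScalar_eq hs, qInt_natCast]
    generalize redLap hs (mon s μ) = y
    generalize ∑ i, μ i = t
    generalize s ^ 2 = q at h2 h4 hd
    have ha : q ^ a ≠ 0 := pow_ne_zero _ h2
    have hb : q ^ b ≠ 0 := pow_ne_zero _ h2
    have ht : q ^ t ≠ 0 := pow_ne_zero _ h2
    rcases a with _ | a <;> rcases b with _ | b <;>
      simp only [Nat.add_sub_cancel, pow_zero, inv_one, sub_self, zero_div, zero_mul, mul_zero] <;>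
      match_scalars <;> field_simp <;> ring

/-! ### Harmonic polynomials in `Q`, `x_1` and `x_N` -/

theorem repr_onMon_diag {N : ℕ} {s : ℂ} (hs : Admissible s) (c : (Fin N → ℕ) → ℂ) (p : Alg N s)
    (ν : Fin N → ℕ) :
    (monBasis hs).repr (onMon hs (fun μ => c μ • mon s μ) p) ν =
      c ν * (monBasis hs).repr p ν := by
  refine linearMap_eq_of_mon hs
    (f := (monBasis hs).coord ν ∘ₗ onMon hs (fun μ => c μ • mon s μ))
    (g := c ν • (monBasis hs).coord ν) (fun μ => ?_) p
  simp only [LinearMap.comp_apply, LinearMap.smul_apply, Module.Basis.coord_apply, onMon_mon,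
    map_smul, repr_mon, smul_eq_mul]
  by_cases h : μ = ν
  · subst h; rfl
  · simp [Finsupp.single_eq_of_ne (Ne.symm h)]

theorem scale_eq_onMon {N : ℕ} {s : ℂ} (hs : Admissible s) (c : ℂ) (p : Alg N s) :
    scale N s c p = onMon hs (fun ν => c ^ (∑ i, ν i) • mon s ν) p := by
  refine linearMap_eq_of_mon hs (f := (scale N s c).toLinearMap) (fun ν => ?_) p
  rw [AlgHom.toLinearMap_apply, scale_mon, onMon_mon]

theorem mem_span_mon {N : ℕ} {s : ℂ} (hs : Admissible s) {P : (Fin N → ℕ) → Prop} {p : Alg N s}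
    (h : ∀ ν, (monBasis hs).repr p ν ≠ 0 → P ν) :
    p ∈ Submodule.span ℂ {r | ∃ ν : Fin N → ℕ, P ν ∧ r = mon s ν} := by
  rw [← (monBasis hs).linearCombination_repr p, Finsupp.linearCombination_apply]
  refine Submodule.sum_mem _ fun ν hν => Submodule.smul_mem _ _ (Submodule.subset_span ?_)
  exact ⟨ν, h ν (Finsupp.mem_support_iff.1 hν), monBasis_apply hs ν⟩

/-- The homogeneous polynomials of degree `m` are the eigenvectors of the scaling by `q` with
eigenvalue `q ^ m`, because `q` is not a root of unity. -/
theorem mem_homog_iff {N : ℕ} {s : ℂ} (hs : Admissible s) {m : ℕ} {p : Alg N s} :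
    p ∈ homog N s m ↔ scale N s (s ^ 2) p = (s ^ 2) ^ m • p := by
  constructor
  · intro hp
    refine homog_induction (f := (scale N s (s ^ 2)).toLinearMap)
      (g := (s ^ 2) ^ m • LinearMap.id) (fun ν hν => ?_) hp
    simp [scale_mon, hν]
  · intro h
    refine mem_span_mon hs fun ν hν => ?_
    have h1 := congrArg (fun r => (monBasis hs).repr r ν) h
    simp only [scale_eq_onMon hs, repr_onMon_diag, map_smul, Finsupp.smul_apply, smul_eq_mul] at h1
    exact eq_of_q_pow_eq hs (mul_right_cancel₀ hν h1)

theorem scale_normQ (N : ℕ) (s c : ℂ) : scale N s c (normQ N s) = c ^ 2 • normQ N s := by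
  rw [normQ, map_smul, scale_Q, smul_comm]

theorem normQ_pow_mul_mem_homog {N : ℕ} {s : ℂ} (hs : Admissible s) (k : ℕ) {m : ℕ} {p : Alg N s}
    (hp : p ∈ homog N s m) : normQ N s ^ k * p ∈ homog N s (m + 2 * k) := by
  rw [mem_homog_iff hs] at hp ⊢
  rw [map_mul, map_pow, scale_normQ, hp, smul_pow, smul_mul_assoc, mul_smul_comm, smul_smul,
    pow_add, pow_mul (s ^ 2) 2, mul_comm]

theorem redLap_normQ_mul {N : ℕ} {s : ℂ} (hs : Admissible s) {m : ℕ} {p : Alg N s}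
    (hp : p ∈ homog N s m) :
    redLap hs (normQ N s * p) = normQ N s * redLap hs p + commScalar N s m • p := by
  refine homog_induction (f := redLap hs ∘ₗ LinearMap.mulLeft ℂ (normQ N s))
    (g := LinearMap.mulLeft ℂ (normQ N s) ∘ₗ redLap hs + commScalar N s m • LinearMap.id)
    (fun ν hν => ?_) hp
  simp only [LinearMap.comp_apply, LinearMap.add_apply, LinearMap.mulLeft_apply,
    LinearMap.smul_apply, LinearMap.id_apply, redLap_normQ_mon, hν]

theorem redLap_one {N : ℕ} {s : ℂ} (hs : Admissible s) : redLap hs (1 : Alg N s) = 0 := by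
  rw [← mon_zero, redLap, onMon_mon]
  simp [bInt]

/-- The polynomial `x_1 ^ a x_N ^ a`. -/
def outerPow (N : ℕ) (s : ℂ) (a : ℕ) : Alg (N + 2) s := sandwich a a 1

theorem outerPow_mem_homog {N : ℕ} {s : ℂ} (hs : Admissible s) (a : ℕ) :
    outerPow N s a ∈ homog (N + 2) s (2 * a) := by
  rw [mem_homog_iff hs, outerPow, scale_sandwich hs, map_one, two_mul]

theorem redLap_outerPow {N : ℕ} {s : ℂ} (hs : Admissible s) (a : ℕ) :
    redLap hs (outerPow N s a) = qInt s a ^ 2 • outerPow N s (a - 1) := by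
  rw [outerPow, redLap_sandwich, redLap_one, map_zero, smul_zero, add_zero, pow_two, outerPow]

/-- The scalar with `redLap (normQ ^ k * x_1 ^ a x_N ^ a) = [a] ^ 2 normQ ^ k x_1 ^ (a-1) x_N ^ (a-1)
  + powScalar N s k a • normQ ^ (k - 1) * x_1 ^ a x_N ^ a`. -/
def powScalar (N : ℕ) (s : ℂ) (k a : ℕ) : ℂ :=
  qInt s k * (((s ^ 2) ^ (2 * a + k + N) * ((s ^ 2) ^ 2)⁻¹ - ((s ^ 2) ^ (2 * a + k))⁻¹) /
    (s ^ 2 - (s ^ 2)⁻¹))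

theorem powScalar_succ {s : ℂ} (hs : Admissible s) (N k a : ℕ) :
    powScalar N s (k + 1) a = powScalar N s k a + commScalar N s (2 * a + 2 * k) := by
  have h2 := q_ne_zero hs
  have hd := q_sub_inv_ne_zero hs
  have hd' := sq_sub_one_ne_zero hs
  rw [powScalar, powScalar, commScalar_eq hs, qInt_natCast, qInt_natCast]
  generalize s ^ 2 = q at h2 hd hd'
  field_simp
  ring

/-- The action of the reduced `q`-Laplace operator on the span of the products of powers of the
squared radius and of `x_1 x_N`; the commutators with the powers of the squared radius add up to a
geometric sum. -/
theorem redLap_normQ_pow {N : ℕ} {s : ℂ} (hs : Admissible s) (a k : ℕ) :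
    redLap hs (normQ (N + 2) s ^ k * outerPow N s a) =
      qInt s a ^ 2 • (normQ (N + 2) s ^ k * outerPow N s (a - 1)) +
        powScalar (N + 2) s k a • (normQ (N + 2) s ^ (k - 1) * outerPow N s a) := by
  induction k with
  | zero => simp [redLap_outerPow, powScalar]
  | succ k ih =>
    rw [pow_succ', mul_assoc, redLap_normQ_mul hs
      (normQ_pow_mul_mem_homog hs k (outerPow_mem_homog hs a)), ih, powScalar_succ hs, mul_add,
      mul_smul_comm, mul_smul_comm, add_smul, add_assoc, mul_assoc, Nat.add_sub_cancel]
    congr 2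
    rcases k with _ | k
    · simp [powScalar]
    · rw [Nat.add_sub_cancel, ← mul_assoc, ← pow_succ']

theorem qPoch_succ (a b : ℂ) (k : ℕ) : qPoch a b (k + 1) = qPoch a b k * (1 - a * b ^ k) :=
  Finset.prod_range_succ _ _

theorem qPoch_denominator_ne_zero {s : ℂ} (hs : Admissible s) {N h k : ℕ} (hk : k < h) :
    1 - (s ^ 2) ^ (-((N + 2 : ℕ) : ℤ) - 2 * ((h : ℤ) + h) + 4) * ((s ^ 2) ^ 2) ^ k ≠ 0 := by
  have h2 := q_ne_zero hs
  rw [← pow_mul, ← zpow_natCast (s ^ 2), ← zpow_add₀ h2]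
  refine sub_ne_zero.2 (q_zpow_ne_one hs ?_).symm
  push_cast
  omega

theorem one_sub_q_sq_pow_ne_zero {s : ℂ} (hs : Admissible s) (k : ℕ) :
    1 - (s ^ 2) ^ 2 * ((s ^ 2) ^ 2) ^ k ≠ 0 := by
  rw [← pow_succ', ← pow_mul, ← zpow_natCast]
  exact sub_ne_zero.2 (q_zpow_ne_one hs (by push_cast; omega)).symm

theorem one_add_q_pow_ne_zero {s : ℂ} (hs : Admissible s) (N : ℕ) :
    1 + (s ^ 2) ^ N ≠ 0 := by
  have h0 := hs.1
  have h := radFactor_ne_zero hs (N + 2)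
  rw [radFactor_add_two hs] at h
  intro h'
  apply h
  have : s ^ N ≠ 0 := pow_ne_zero _ h0
  rw [show s ^ N + (s ^ N)⁻¹ = (1 + (s ^ 2) ^ N) * (s ^ N)⁻¹ by field_simp; ring, h', zero_mul]

theorem phiCoeff_zero (N : ℕ) (s : ℂ) (a b : ℕ) : phiCoeff N s a b 0 = 1 := by
  simp [phiCoeff, qPoch]

theorem phiCoeff_succ {s : ℂ} (hs : Admissible s) (N h k : ℕ) :
    phiCoeff (N + 2) s h h (k + 1) = phiCoeff (N + 2) s h h k *
      ((1 - ((s ^ 2) ^ (2 * h))⁻¹ * ((s ^ 2) ^ 2) ^ k) ^ 2 * (s ^ 4 * (s ^ N)⁻¹) /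
        ((1 - (s ^ 2) ^ 2 * ((s ^ 2) ^ 2) ^ k) *
          (1 - (s ^ 2) ^ (-((N + 2 : ℕ) : ℤ) - 2 * ((h : ℤ) + h) + 4) * ((s ^ 2) ^ 2) ^ k) *
          (1 + (s ^ 2) ^ N))) := by
  have h0 := hs.1
  have h2 := q_ne_zero hs
  rw [phiCoeff, phiCoeff]
  simp only [qPoch_succ]
  have e1 : (s ^ 2) ^ (((N + 2 : ℕ) : ℤ) - 2) = (s ^ 2) ^ N := by
    rw [← zpow_natCast (s ^ 2)]; congr 1; push_cast; ring
  have e2 : s ^ ((6 - ((N + 2 : ℕ) : ℤ)) * ((k + 1 : ℕ) : ℤ)) =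
      s ^ ((6 - ((N + 2 : ℕ) : ℤ)) * (k : ℤ)) * (s ^ 4 * (s ^ N)⁻¹) := by
    rw [show (6 - ((N + 2 : ℕ) : ℤ)) * ((k + 1 : ℕ) : ℤ) =
      (6 - ((N + 2 : ℕ) : ℤ)) * (k : ℤ) + ((4 : ℕ) - (N : ℤ)) by push_cast; ring,
      zpow_add₀ h0, zpow_sub₀ h0, zpow_natCast, zpow_natCast]
    ring
  have e3 : (s ^ 2) ^ (-2 * (h : ℤ)) = ((s ^ 2) ^ (2 * h))⁻¹ := by
    rw [← zpow_natCast (s ^ 2), ← zpow_neg]; congr 1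
  rw [e1, e2, e3, pow_succ (1 + (s ^ 2) ^ N)]
  simp only [div_eq_mul_inv, mul_inv]
  ring

theorem phiCoeff_ne_zero {s : ℂ} (hs : Admissible s) (N h : ℕ) :
    ∀ k, k ≤ h → phiCoeff (N + 2) s h h k ≠ 0
  | 0, _ => by rw [phiCoeff_zero]; exact one_ne_zero
  | k + 1, hk => by
    have h0 := hs.1
    have h2 := q_ne_zero hs
    rw [phiCoeff_succ hs]
    refine mul_ne_zero (phiCoeff_ne_zero hs N h k (by omega)) (div_ne_zero
      (mul_ne_zero (pow_ne_zero _ ?_) (by positivity)) (mul_ne_zero (mul_ne_zero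
        (one_sub_q_sq_pow_ne_zero hs k) (qPoch_denominator_ne_zero hs (by omega)))
        (one_add_q_pow_ne_zero hs N)))
    rw [← pow_mul (s ^ 2) 2 k, ← zpow_natCast (s ^ 2) (2 * h), ← zpow_natCast (s ^ 2) (2 * k),
      ← zpow_neg, ← zpow_add₀ h2]
    exact sub_ne_zero.2 (q_zpow_ne_one hs (by push_cast; omega)).symm

theorem phi_eq {s : ℂ} (hs : Admissible s) (N h : ℕ) :
    phi (N + 2) s h h = ∑ k ∈ Finset.range (h + 1),
      (phiCoeff (N + 2) s h h k * radFactor (N + 2) s ^ k) •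
        (normQ (N + 2) s ^ k * outerPow N s (h - k)) := by
  rw [phi, min_self]
  refine Finset.sum_congr rfl fun k _ => ?_
  rw [Q_eq_normQ hs, smul_pow, smul_mul_assoc, smul_smul, outerPow, sandwich_one, Fin.rev_zero]

/-- The recurrence that the coefficients of a harmonic polynomial `∑ k, c_k Q ^ k x_1 ^ (h-k)
x_N ^ (h-k)` have to satisfy. -/
theorem phiCoeff_recurrence {s : ℂ} (hs : Admissible s) {N h k : ℕ} (hk : k < h) :
    phiCoeff (N + 2) s h h k * radFactor (N + 2) s ^ k * qInt s ((h - k : ℕ) : ℤ) ^ 2 +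
      phiCoeff (N + 2) s h h (k + 1) * radFactor (N + 2) s ^ (k + 1) *
        powScalar (N + 2) s (k + 1) (h - (k + 1)) = 0 := by
  have h0 := hs.1
  have h2 := q_ne_zero hs
  have hd := q_sub_inv_ne_zero hs
  have hd' := sq_sub_one_ne_zero hs
  have h3 := qPoch_denominator_ne_zero hs (N := N) hk
  have h4 := one_sub_q_sq_pow_ne_zero hs k
  have h5 := one_add_q_pow_ne_zero hs N
  have hN : s ^ N ≠ 0 := pow_ne_zero _ h0
  obtain ⟨j, rfl⟩ : ∃ j, h = k + 1 + j := ⟨h - (k + 1), by omega⟩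
  rw [phiCoeff_succ hs, pow_succ (radFactor (N + 2) s), show k + 1 + j - k = j + 1 by omega,
    show k + 1 + j - (k + 1) = j by omega, radFactor_add_two hs, powScalar, qInt_natCast,
    qInt_natCast]
  have e : (s ^ 2) ^ (-((N + 2 : ℕ) : ℤ) - 2 * (((k + 1 + j : ℕ) : ℤ) + ((k + 1 + j : ℕ) : ℤ)) + 4) =
      ((s ^ 2) ^ (N + 4 * k + 4 * j + 2))⁻¹ := by
    rw [← zpow_natCast (s ^ 2), ← zpow_neg]; congr 1; push_cast; ring
  rw [e] at h3 ⊢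
  have e2 : (s ^ 2) ^ N = s ^ N * s ^ N := by rw [← pow_mul, ← pow_add, two_mul]
  have e3 : (s ^ 2) ^ (N + 4 * k + 4 * j + 2) =
      s ^ N * s ^ N * ((s ^ 2) ^ k) ^ 4 * ((s ^ 2) ^ j) ^ 4 * (s ^ 2) ^ 2 := by
    rw [← e2]; ring
  have e4 : ((s ^ 2) ^ 2) ^ k = ((s ^ 2) ^ k) ^ 2 := by ring
  have e5 : (s ^ 2) ^ (2 * (k + 1 + j)) = ((s ^ 2) ^ k) ^ 2 * (s ^ 2) ^ 2 * ((s ^ 2) ^ j) ^ 2 := by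
    ring
  have e6 : (s ^ 2) ^ (2 * j + (k + 1) + (N + 2)) =
      ((s ^ 2) ^ j) ^ 2 * (s ^ 2) ^ k * (s ^ N * s ^ N) * (s ^ 2) ^ 3 := by
    rw [← e2]; ring
  have e7 : (s ^ 2) ^ (2 * j + (k + 1)) = ((s ^ 2) ^ j) ^ 2 * (s ^ 2) ^ k * s ^ 2 := by ring
  have e8 : s ^ 4 = (s ^ 2) ^ 2 := by ring
  rw [e3, e4] at h3
  rw [e4] at h4
  rw [e2] at h5
  rw [e2, e3, e4, e5, e6, e7, e8, pow_succ (s ^ 2) j, pow_succ (s ^ 2) k]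
  have hk' : (s ^ 2) ^ k ≠ 0 := pow_ne_zero _ h2
  have hj' : (s ^ 2) ^ j ≠ 0 := pow_ne_zero _ h2
  generalize phiCoeff (N + 2) s (k + 1 + j) (k + 1 + j) k = C
  generalize (s ^ 2) ^ k = K at *
  generalize (s ^ 2) ^ j = J at *
  generalize s ^ N = z at *
  generalize s ^ 2 = q at *
  have h6 : 1 - (z * z * K ^ 4 * J ^ 4 * q ^ 2)⁻¹ * K ^ 2 =
      (z ^ 2 * K ^ 2 * J ^ 4 * q ^ 2 - 1) / (z ^ 2 * K ^ 2 * J ^ 4 * q ^ 2) := by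
    field_simp
  rw [h6] at h3 ⊢
  have h7 := (div_ne_zero_iff.1 h3).1
  obtain ⟨D, hD⟩ : ∃ D, D = z ^ 2 * K ^ 2 * J ^ 4 * q ^ 2 - 1 := ⟨_, rfl⟩
  rw [← hD] at h7 ⊢
  have h8 : 1 + z ^ 2 ≠ 0 := by rwa [pow_two]
  rw [show z + z⁻¹ = (1 + z ^ 2) / z by field_simp; ring, show z * z = z ^ 2 by ring]
  generalize ((1 + z ^ 2) / z) ^ k = g
  rw [show q - q⁻¹ = (q ^ 2 - 1) / q by field_simp]
  field_simp
  rw [hD]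
  ring

theorem laplace_outerPow_succ {N : ℕ} {s : ℂ} (hs : Admissible s) (a : ℕ) :
    laplace (N + 2) hs (outerPow N s (a + 1)) =
      (radFactor (N + 2) s * ((s ^ 2) ^ (2 * a + 1) * qInt s ((a + 1 : ℕ) : ℤ) ^ 2)) •
        outerPow N s a := by
  rw [laplace_of_homog hs (outerPow_mem_homog hs _), redLap_outerPow, smul_smul, mul_assoc,
    Nat.add_sub_cancel, ← zpow_natCast (s ^ 2) (2 * a + 1),
    show ((2 * (a + 1) : ℕ) : ℤ) - 1 = ((2 * a + 1 : ℕ) : ℤ) by push_cast; ring]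

theorem phi_mem_homog {s : ℂ} (hs : Admissible s) (N h : ℕ) :
    phi (N + 2) s h h ∈ homog (N + 2) s (h + h) := by
  rw [phi_eq hs]
  refine Submodule.sum_mem _ fun k hk => Submodule.smul_mem _ _ ?_
  have := normQ_pow_mul_mem_homog hs k (outerPow_mem_homog (N := N) hs (h - k))
  rwa [show 2 * (h - k) + 2 * k = h + h by have := Finset.mem_range.1 hk; omega] at this

/-- The coefficients of `φ` satisfy the recurrence, so the contributions to `redLap φ` cancel in
pairs; the last one vanishes because it has the factor `[0]_q`. -/
theorem phi_mem_harmonic {s : ℂ} (hs : Admissible s) (N h : ℕ) :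
    phi (N + 2) s h h ∈ harmonic (N + 2) hs (h + h) := by
  refine ⟨phi_mem_homog hs N h, ?_⟩
  rw [SetLike.mem_coe, LinearMap.mem_ker, laplace_of_homog hs (phi_mem_homog hs N h), phi_eq hs,
    map_sum]
  simp only [map_smul, redLap_normQ_pow, smul_add, Finset.sum_add_distrib, smul_smul]
  rw [Finset.sum_range_succ, Finset.sum_range_succ' (fun k => (_ * powScalar _ _ k _) • _)]
  have e : powScalar (N + 2) s 0 (h - 0) = 0 := by simp [powScalar]
  rw [e, Nat.sub_self, Nat.cast_zero, qInt_zero, zero_pow two_ne_zero, mul_zero, zero_smul,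
    mul_zero, zero_smul, add_zero, add_zero, ← smul_add, ← Finset.sum_add_distrib,
    Finset.sum_eq_zero, smul_zero]
  intro k hk
  rw [Nat.sub_sub, Nat.add_sub_cancel, ← add_smul, phiCoeff_recurrence hs (Finset.mem_range.1 hk),
    zero_smul]

theorem projCoeff_succ {s : ℂ} (hs : Admissible s) (N h k : ℕ) :
    projCoeff (N + 2) s (h + h) (k + 1) = projCoeff (N + 2) s (h + h) k *
      ((s ^ 2) ^ (4 * k + 1) * ((s ^ 2) ^ (4 * h))⁻¹ * (1 - (s ^ 2) ^ 2) ^ 2 /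
        ((1 + (s ^ 2) ^ N) ^ 2 * ((1 - (s ^ 2) ^ 2 * ((s ^ 2) ^ 2) ^ k) *
          (1 - (s ^ 2) ^ (-((N + 2 : ℕ) : ℤ) - 2 * ((h : ℤ) + h) + 4) * ((s ^ 2) ^ 2) ^ k)))) := by
  have h2 := q_ne_zero hs
  rw [projCoeff, projCoeff]
  simp only [qPoch_succ]
  have e1 : (s ^ 2) ^ (((N + 2 : ℕ) : ℤ) - 2) = (s ^ 2) ^ N := by
    rw [← zpow_natCast (s ^ 2)]; congr 1; push_cast; ring
  have e2 : (s ^ 2) ^ (2 * ((k + 1 : ℕ) : ℤ) ^ 2 - 2 * ((h + h : ℕ) : ℤ) * ((k + 1 : ℕ) : ℤ) -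
      ((k + 1 : ℕ) : ℤ)) = (s ^ 2) ^ (2 * (k : ℤ) ^ 2 - 2 * ((h + h : ℕ) : ℤ) * (k : ℤ) - (k : ℤ)) *
        ((s ^ 2) ^ (4 * k + 1) * ((s ^ 2) ^ (4 * h))⁻¹) := by
    rw [← zpow_natCast (s ^ 2) (4 * k + 1), ← zpow_natCast (s ^ 2) (4 * h), ← zpow_neg,
      ← zpow_add₀ h2, ← zpow_add₀ h2]
    congr 1
    push_cast
    ring
  rw [e1, e2, show 2 * (k + 1) = 2 * k + 2 by ring, pow_add, pow_add, Nat.cast_add h h]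
  generalize 1 + (s ^ 2) ^ N = w
  simp only [div_eq_mul_inv, mul_inv]
  ring

/-- The summands of `φ` are the images of `x_1 ^ h x_N ^ h` under the summands of the projection. -/
theorem projCoeff_smul_laplace_pow {s : ℂ} (hs : Admissible s) (N h : ℕ) : ∀ k, k ≤ h →
    projCoeff (N + 2) s (h + h) k • (laplace (N + 2) hs ^ k) (outerPow N s h) =
      phiCoeff (N + 2) s h h k • outerPow N s (h - k)
  | 0, _ => by simp [projCoeff, phiCoeff_zero, qPoch]
  | k + 1, hk => by
    have h0 := hs.1
    have h2 := q_ne_zero hs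
    have hd := q_sub_inv_ne_zero hs
    have hd' := sq_sub_one_ne_zero hs
    have h3 := qPoch_denominator_ne_zero hs (N := N) hk
    have h4 := one_sub_q_sq_pow_ne_zero hs k
    have h5 := one_add_q_pow_ne_zero hs N
    have hN : s ^ N ≠ 0 := pow_ne_zero _ h0
    have ih := projCoeff_smul_laplace_pow hs N h k (by omega)
    rw [projCoeff_succ hs, phiCoeff_succ hs, pow_succ' (laplace (N + 2) hs), Module.End.mul_apply,
      mul_comm (projCoeff _ _ _ _), mul_smul, ← map_smul, ih]
    obtain ⟨j, rfl⟩ : ∃ j, h = k + 1 + j := ⟨h - (k + 1), by omega⟩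
    rw [show k + 1 + j - k = j + 1 by omega, show k + 1 + j - (k + 1) = j by omega, map_smul,
      laplace_outerPow_succ, smul_smul, smul_smul, radFactor_add_two hs, qInt_natCast]
    congr 1
    have e2 : (s ^ 2) ^ N = s ^ N * s ^ N := by rw [← pow_mul, ← pow_add, two_mul]
    have e4 : ((s ^ 2) ^ 2) ^ k = ((s ^ 2) ^ k) ^ 2 := by ring
    have e5 : (s ^ 2) ^ (2 * (k + 1 + j)) = ((s ^ 2) ^ k) ^ 2 * (s ^ 2) ^ 2 * ((s ^ 2) ^ j) ^ 2 := by
      ring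
    have e6 : (s ^ 2) ^ (4 * (k + 1 + j)) = ((s ^ 2) ^ k) ^ 4 * (s ^ 2) ^ 4 * ((s ^ 2) ^ j) ^ 4 := by
      ring
    have e7 : (s ^ 2) ^ (4 * k + 1) = ((s ^ 2) ^ k) ^ 4 * s ^ 2 := by ring
    have e8 : s ^ 4 = (s ^ 2) ^ 2 := by ring
    have e9 : (s ^ 2) ^ (2 * j + 1) = ((s ^ 2) ^ j) ^ 2 * s ^ 2 := by ring
    rw [e4] at h3 h4
    rw [e2] at h5
    rw [e2, e4, e5, e6, e7, e8, e9, pow_succ (s ^ 2) j]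
    have hk' : (s ^ 2) ^ k ≠ 0 := pow_ne_zero _ h2
    have hj' : (s ^ 2) ^ j ≠ 0 := pow_ne_zero _ h2
    generalize phiCoeff (N + 2) s (k + 1 + j) (k + 1 + j) k = C
    generalize (s ^ 2) ^ k = K at *
    generalize 1 - (s ^ 2) ^ (-((N + 2 : ℕ) : ℤ) - 2 * (((k + 1 + j : ℕ) : ℤ) +
      ((k + 1 + j : ℕ) : ℤ)) + 4) * K ^ 2 = D at *
    generalize (s ^ 2) ^ j = J at *
    generalize s ^ N = z at *
    generalize s ^ 2 = q at *
    generalize 1 - q ^ 2 * K ^ 2 = D' at *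
    have h8 : 1 + z ^ 2 ≠ 0 := by rwa [pow_two]
    rw [show z + z⁻¹ = (1 + z ^ 2) / z by field_simp; ring, show z * z = z ^ 2 by ring]
    rw [show q - q⁻¹ = (q ^ 2 - 1) / q by field_simp]
    field_simp
    ring

theorem harmonicProj_outerPow {s : ℂ} (hs : Admissible s) (N h : ℕ) :
    harmonicProj (N + 2) hs (h + h) (outerPow N s h) = phi (N + 2) s h h := by
  rw [harmonicProj, LinearMap.sum_apply, phi, min_self, show (h + h) / 2 = h by omega]
  refine Finset.sum_congr rfl fun k hk => ?_
  rw [LinearMap.smul_apply, Module.End.mul_apply, ← map_smul,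
    projCoeff_smul_laplace_pow hs N h k (by have := Finset.mem_range.1 hk; omega), map_smul,
    LinearMap.mulLeft_apply, outerPow, sandwich_one, Fin.rev_zero]

/-! ### The generators of `U_q(so_N)` commute with the squared radius -/

section generators

variable {N : ℕ} {s : ℂ} (hs : Admissible s)

theorem raise_emb_sandwich (i j : Fin N) (a b : ℕ) (y : Alg N s) :
    raise hs (emb i) (emb j) (sandwich a b y) = sandwich a b (raise hs i j y) := by
  refine linearMap_eq_of_mon hs (f := raise hs (emb i) (emb j) ∘ₗ sandwich a b)
    (g := sandwich a b ∘ₗ raise hs i j) (fun ν => ?_) y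
  simp only [LinearMap.comp_apply]
  rw [sandwich_mon, raise, onMon_mon, raise, onMon_mon]
  simp only [rev_emb, wrap_emb, move_eq, incr_wrap_emb, lower_wrap_emb, map_sub, map_smul,
    sandwich_mon]

theorem descend_emb_sandwich (i j : Fin N) (a b : ℕ) (y : Alg N s) :
    descend hs (emb i) (emb j) (sandwich a b y) = sandwich a b (descend hs i j y) := by
  refine linearMap_eq_of_mon hs (f := descend hs (emb i) (emb j) ∘ₗ sandwich a b)
    (g := sandwich a b ∘ₗ descend hs i j) (fun ν => ?_) y
  simp only [LinearMap.comp_apply]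
  rw [sandwich_mon, descend, onMon_mon, descend, onMon_mon]
  simp only [rev_emb, wrap_emb, move_eq, incr_wrap_emb, lower_wrap_emb, map_sub, map_smul,
    sandwich_mon]

theorem raiseShort_emb_sandwich (i j : Fin N) (a b : ℕ) (y : Alg N s) :
    raiseShort hs (emb i) (emb j) (sandwich a b y) = sandwich a b (raiseShort hs i j y) := by
  refine linearMap_eq_of_mon hs (f := raiseShort hs (emb i) (emb j) ∘ₗ sandwich a b)
    (g := sandwich a b ∘ₗ raiseShort hs i j) (fun ν => ?_) y
  simp only [LinearMap.comp_apply]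
  rw [sandwich_mon, raiseShort, onMon_mon, raiseShort, onMon_mon]
  simp only [rev_emb, wrap_emb, move_eq, incr_wrap_emb, lower_wrap_emb, map_sub, map_smul,
    sandwich_mon]

theorem descendShort_emb_sandwich (i j : Fin N) (a b : ℕ) (y : Alg N s) :
    descendShort hs (emb i) (emb j) (sandwich a b y) = sandwich a b (descendShort hs i j y) := by
  refine linearMap_eq_of_mon hs (f := descendShort hs (emb i) (emb j) ∘ₗ sandwich a b)
    (g := sandwich a b ∘ₗ descendShort hs i j) (fun ν => ?_) y
  simp only [LinearMap.comp_apply]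
  rw [sandwich_mon, descendShort, onMon_mon, descendShort, onMon_mon]
  simp only [rev_emb, wrap_emb, move_eq, incr_wrap_emb, lower_wrap_emb, map_sub, map_smul,
    sandwich_mon]

/-- The operator `x ^ ν ↦ [ν_e]_q q ^ (-ν_e) x ^ (ν - ε_e)`. -/
def lowerOp (e : Fin N) : Module.End ℂ (Alg N s) :=
  onMon hs fun ν => (qInt s (ν e) * (s ^ 2) ^ (-(ν e : ℤ))) • mon s (lower ν e)

/-- The operator `x ^ ν ↦ q ^ (ν_{e'} - ν_e) x ^ (ν + ε_{e'})`. -/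
def incrOp (e : Fin N) : Module.End ℂ (Alg N s) :=
  onMon hs fun ν => (s ^ 2) ^ ((ν e.rev : ℤ) - ν e) • mon s (incr ν e.rev)

/-- The operator `x ^ k ↦ [k] q ^ (1 / 2 - k) x ^ (k - 1)` in one variable. -/
def lowerShort : Module.End ℂ (Alg 1 s) :=
  onMon hs fun ν => (bInt s (ν 0) * (s * (s ^ 2) ^ (-(ν 0 : ℤ)))) • mon s (lower ν 0)

/-- The multiplication by the variable, in one variable. -/
def incrShort : Module.End ℂ (Alg 1 s) := onMon hs fun ν => mon s (incr ν 0)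

/-- The action of a generator that mixes the outer variables `x_1`, `x_N` with inner ones, in terms
of two operators `δ` and `η` on the polynomials in the inner variables. This is the shape of the
raising generators. -/
def RaisesOuter (δ η : Module.End ℂ (Alg N s)) (E : Module.End ℂ (Alg (N + 2) s)) : Prop :=
  ∀ a b y, E (sandwich a b y) = (s ^ 2) ^ (a + 1) • sandwich (a + 1) b (δ y) -
    (qInt s b * ((s ^ 2) ^ (a + 1) * ((s ^ 2) ^ b)⁻¹)) • sandwich a (b - 1) (η y)

/-- The mirror image of `RaisesOuter`: up to a factor, the shape of the lowering generators. -/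
def LowersOuter (δ η : Module.End ℂ (Alg N s)) (F : Module.End ℂ (Alg (N + 2) s)) : Prop :=
  ∀ a b y, F (sandwich a b y) = (s ^ 2) ^ (b + 1) • sandwich a (b + 1) (δ y) -
    (qInt s a * ((s ^ 2) ^ (b + 1) * ((s ^ 2) ^ a)⁻¹)) • sandwich (a - 1) b (η y)

theorem raisesOuter_raise (e : Fin N) :
    RaisesOuter (lowerOp hs e) (incrOp hs e) (raise hs 0 (emb e)) := by
  have h2 := q_ne_zero hs
  intro a b y
  refine linearMap_eq_of_mon hs (f := raise hs 0 (emb e) ∘ₗ sandwich a b)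
    (g := (s ^ 2) ^ (a + 1) • (sandwich (a + 1) b ∘ₗ lowerOp hs e) -
      (qInt s b * ((s ^ 2) ^ (a + 1) * ((s ^ 2) ^ b)⁻¹)) • (sandwich a (b - 1) ∘ₗ incrOp hs e))
    (fun ν => ?_) y
  simp only [LinearMap.comp_apply, LinearMap.sub_apply, LinearMap.smul_apply]
  rw [sandwich_mon, raise, onMon_mon, lowerOp, onMon_mon, incrOp, onMon_mon]
  simp only [rev_emb, wrap_emb, move_eq, incr_wrap_emb, lower_wrap_emb, map_smul, Fin.rev_zero,
    sandwich_mon, wrap_zero, wrap_last, incr_wrap_zero, lower_wrap_last, smul_smul]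
  congr 2
  · rw [zpow_add₀ h2, zpow_sub₀ h2, zpow_neg, pow_succ, zpow_natCast, zpow_natCast, zpow_one]
    ring
  · rw [zpow_add₀ h2, zpow_add₀ h2, zpow_sub₀ h2, zpow_sub₀ h2, zpow_sub₀ h2, pow_succ,
      zpow_natCast, zpow_natCast, zpow_natCast, zpow_natCast, zpow_one]
    ring

theorem lowersOuter_descend (e : Fin N) :
    LowersOuter (lowerOp hs e.rev) (incrOp hs e.rev) (-descend hs 0 (emb e)) := by
  have h2 := q_ne_zero hs
  intro a b y
  refine linearMap_eq_of_mon hs (f := -descend hs 0 (emb e) ∘ₗ sandwich a b)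
    (g := (s ^ 2) ^ (b + 1) • (sandwich a (b + 1) ∘ₗ lowerOp hs e.rev) -
      (qInt s a * ((s ^ 2) ^ (b + 1) * ((s ^ 2) ^ a)⁻¹)) •
        (sandwich (a - 1) b ∘ₗ incrOp hs e.rev))
    (fun ν => ?_) y
  simp only [LinearMap.comp_apply, LinearMap.sub_apply, LinearMap.smul_apply, LinearMap.neg_apply]
  rw [sandwich_mon, descend, onMon_mon, lowerOp, onMon_mon, incrOp, onMon_mon, neg_sub]
  simp only [rev_emb, wrap_emb, move_eq, incr_wrap_emb, lower_wrap_emb, map_smul, Fin.rev_zero,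
    Fin.rev_rev, sandwich_mon, wrap_zero, wrap_last, incr_wrap_last, lower_wrap_zero, smul_smul]
  congr 2
  · rw [zpow_add₀ h2, zpow_add₀ h2, zpow_neg, pow_succ, zpow_natCast, zpow_natCast, zpow_one]
    ring
  · rw [zpow_add₀ h2, zpow_add₀ h2, zpow_sub₀ h2, zpow_sub₀ h2, zpow_add₀ h2, zpow_neg, pow_succ,
      zpow_natCast, zpow_natCast, zpow_natCast, zpow_natCast, zpow_one]
    ring

theorem raisesOuter_raiseShort :
    RaisesOuter (lowerShort hs) (incrShort hs) (raiseShort hs 0 (emb 0)) := by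
  have h2 := q_ne_zero hs
  have h0 := hs.1
  intro a b y
  refine linearMap_eq_of_mon hs (f := raiseShort hs 0 (emb 0) ∘ₗ sandwich a b)
    (g := (s ^ 2) ^ (a + 1) • (sandwich (a + 1) b ∘ₗ lowerShort hs) -
      (qInt s b * ((s ^ 2) ^ (a + 1) * ((s ^ 2) ^ b)⁻¹)) • (sandwich a (b - 1) ∘ₗ incrShort hs))
    (fun ν => ?_) y
  simp only [LinearMap.comp_apply, LinearMap.sub_apply, LinearMap.smul_apply]
  rw [sandwich_mon, raiseShort, onMon_mon, lowerShort, onMon_mon, incrShort, onMon_mon]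
  simp only [wrap_emb, move_eq, incr_wrap_emb, lower_wrap_emb, map_smul, Fin.rev_zero,
    sandwich_mon, wrap_zero, wrap_last, incr_wrap_zero, lower_wrap_last, smul_smul]
  congr 2
  · rw [zpow_add₀ h0, zpow_mul, zpow_sub₀ (zpow_ne_zero _ h0), zpow_neg, pow_succ]
    simp only [zpow_natCast, zpow_ofNat]
    ring
  · rw [zpow_add₀ h2, zpow_sub₀ h2, pow_succ, zpow_natCast, zpow_natCast, zpow_one]
    ring

theorem lowersOuter_descendShort :
    LowersOuter (lowerShort hs) (incrShort hs) (-(s • descendShort hs 0 (emb 0))) := by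
  have h2 := q_ne_zero hs
  have h0 := hs.1
  intro a b y
  refine linearMap_eq_of_mon hs (f := -(s • descendShort hs 0 (emb 0)) ∘ₗ sandwich a b)
    (g := (s ^ 2) ^ (b + 1) • (sandwich a (b + 1) ∘ₗ lowerShort hs) -
      (qInt s a * ((s ^ 2) ^ (b + 1) * ((s ^ 2) ^ a)⁻¹)) • (sandwich (a - 1) b ∘ₗ incrShort hs))
    (fun ν => ?_) y
  simp only [LinearMap.comp_apply, LinearMap.sub_apply, LinearMap.smul_apply, LinearMap.neg_apply]
  rw [sandwich_mon, descendShort, onMon_mon, lowerShort, onMon_mon, incrShort, onMon_mon,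
    ← smul_neg, neg_sub, smul_sub]
  simp only [wrap_emb, move_eq, incr_wrap_emb, lower_wrap_emb, map_smul, Fin.rev_zero,
    sandwich_mon, wrap_zero, wrap_last, incr_wrap_last, lower_wrap_zero, smul_smul]
  congr 2
  · rw [zpow_add₀ h2, zpow_add₀ h2, zpow_neg, pow_succ, zpow_natCast, zpow_natCast, zpow_one]
    ring
  · rw [zpow_add₀ h0, zpow_mul, zpow_add₀ (zpow_ne_zero _ h0), zpow_neg, pow_succ]
    simp only [zpow_natCast, zpow_ofNat]
    ring

/-- The relations of `δ` and `η` with the scaling and with the squared radius which make a generator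
of the form `RaisesOuter` or `LowersOuter` commute with the squared radius. -/
structure IsLadder (δ η : Module.End ℂ (Alg N s)) : Prop where
  scale_lower : ∀ y, scale N s (s ^ 2)⁻¹ (δ y) = s ^ 2 • δ (scale N s (s ^ 2)⁻¹ y)
  scale_incr : ∀ y, scale N s (s ^ 2)⁻¹ (η y) = (s ^ 2)⁻¹ • η (scale N s (s ^ 2)⁻¹ y)
  incr_normQ : ∀ y, η (normQ N s * y) = normQ N s * η y
  lower_normQ : ∀ y, δ (normQ N s * y) =
    normQ N s * δ y + (s ^ 2)⁻¹ • η (scale N s (s ^ 2)⁻¹ y)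
  lower_one : δ 1 = 0

theorem lowerOp_zero_sandwich (a b : ℕ) (y : Alg N s) :
    lowerOp hs 0 (sandwich a b y) = (qInt s a * ((s ^ 2) ^ a)⁻¹) • sandwich (a - 1) b y := by
  refine linearMap_eq_of_mon hs (f := lowerOp hs 0 ∘ₗ sandwich a b)
    (g := (qInt s a * ((s ^ 2) ^ a)⁻¹) • sandwich (a - 1) b) (fun ν => ?_) y
  simp only [LinearMap.comp_apply, LinearMap.smul_apply]
  rw [sandwich_mon, lowerOp, onMon_mon, wrap_zero, lower_wrap_zero, sandwich_mon, zpow_neg,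
    zpow_natCast]

theorem lowerOp_last_sandwich (a b : ℕ) (y : Alg N s) :
    lowerOp hs (Fin.last (N + 1)) (sandwich a b y) =
      (qInt s b * ((s ^ 2) ^ b)⁻¹) • sandwich a (b - 1) y := by
  refine linearMap_eq_of_mon hs (f := lowerOp hs (Fin.last (N + 1)) ∘ₗ sandwich a b)
    (g := (qInt s b * ((s ^ 2) ^ b)⁻¹) • sandwich a (b - 1)) (fun ν => ?_) y
  simp only [LinearMap.comp_apply, LinearMap.smul_apply]
  rw [sandwich_mon, lowerOp, onMon_mon, wrap_last, lower_wrap_last, sandwich_mon, zpow_neg,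
    zpow_natCast]

theorem incrOp_zero_sandwich (a b : ℕ) (y : Alg N s) :
    incrOp hs 0 (sandwich a b y) = ((s ^ 2) ^ b * ((s ^ 2) ^ a)⁻¹) • sandwich a (b + 1) y := by
  refine linearMap_eq_of_mon hs (f := incrOp hs 0 ∘ₗ sandwich a b)
    (g := ((s ^ 2) ^ b * ((s ^ 2) ^ a)⁻¹) • sandwich a (b + 1)) (fun ν => ?_) y
  simp only [LinearMap.comp_apply, LinearMap.smul_apply]
  rw [sandwich_mon, incrOp, onMon_mon, Fin.rev_zero, wrap_last, wrap_zero, incr_wrap_last,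
    sandwich_mon, zpow_sub₀ (q_ne_zero hs), zpow_natCast, zpow_natCast, div_eq_mul_inv]

theorem incrOp_last_sandwich (a b : ℕ) (y : Alg N s) :
    incrOp hs (Fin.last (N + 1)) (sandwich a b y) =
      ((s ^ 2) ^ a * ((s ^ 2) ^ b)⁻¹) • sandwich (a + 1) b y := by
  refine linearMap_eq_of_mon hs (f := incrOp hs (Fin.last (N + 1)) ∘ₗ sandwich a b)
    (g := ((s ^ 2) ^ a * ((s ^ 2) ^ b)⁻¹) • sandwich (a + 1) b) (fun ν => ?_) y
  simp only [LinearMap.comp_apply, LinearMap.smul_apply]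
  rw [sandwich_mon, incrOp, onMon_mon, Fin.rev_last, wrap_last, wrap_zero, incr_wrap_zero,
    sandwich_mon, zpow_sub₀ (q_ne_zero hs), zpow_natCast, zpow_natCast, div_eq_mul_inv]

/-- Operator identities on `Alg (N + 2) s` can be checked on the elements `x_1 ^ a y x_N ^ b`. -/
theorem forall_of_sandwich {N : ℕ} {s : ℂ} (hs : Admissible s) {V : Type*} [AddCommGroup V]
    [Module ℂ V] (f g : Alg (N + 2) s →ₗ[ℂ] V)
    (h : ∀ a b (y : Alg N s), f (sandwich a b y) = g (sandwich a b y)) : ∀ p, f p = g p :=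
  linearMap_eq_of_sandwich hs fun a b _ => h a b _

theorem sandwich_zero_zero_one : sandwich 0 0 (1 : Alg N s) = 1 := by simp [sandwich_one]

end generators

section generators

variable {N : ℕ} {s : ℂ} (hs : Admissible s)

-- only the formulas for these operators on monomials are needed from here on
attribute [local irreducible] lowerOp incrOp lowerShort incrShort

theorem isLadder_zero : IsLadder (lowerOp hs (0 : Fin (N + 2))) (incrOp hs 0) where
  scale_lower := by
    have h2 := q_ne_zero hs
    refine forall_of_sandwich hs ((scale _ s (s ^ 2)⁻¹).toLinearMap ∘ₗ lowerOp hs 0)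
      (s ^ 2 • (lowerOp hs 0 ∘ₗ (scale _ s (s ^ 2)⁻¹).toLinearMap)) fun a b y => ?_
    simp only [LinearMap.comp_apply, LinearMap.smul_apply, AlgHom.toLinearMap_apply,
      lowerOp_zero_sandwich, map_smul, scale_sandwich hs, smul_smul]
    rcases a with _ | a
    · simp
    · simp only [Nat.add_sub_cancel, inv_pow]
      match_scalars
      field_simp
      ring
  scale_incr := by
    have h2 := q_ne_zero hs
    refine forall_of_sandwich hs ((scale _ s (s ^ 2)⁻¹).toLinearMap ∘ₗ incrOp hs 0)
      ((s ^ 2)⁻¹ • (incrOp hs 0 ∘ₗ (scale _ s (s ^ 2)⁻¹).toLinearMap)) fun a b y => ?_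
    simp only [LinearMap.comp_apply, LinearMap.smul_apply, AlgHom.toLinearMap_apply,
      incrOp_zero_sandwich, map_smul, scale_sandwich hs, smul_smul]
    match_scalars
    ring
  incr_normQ := by
    have h2 := q_ne_zero hs
    refine forall_of_sandwich hs (incrOp hs 0 ∘ₗ LinearMap.mulLeft ℂ (normQ _ s))
      (LinearMap.mulLeft ℂ (normQ _ s) ∘ₗ incrOp hs 0) fun a b y => ?_
    simp only [LinearMap.comp_apply, LinearMap.mulLeft_apply, normQ_mul_sandwich hs,
      incrOp_zero_sandwich, map_smul, map_add, smul_smul, smul_add]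
    match_scalars
    · field_simp
      ring
    · ring
  lower_normQ := by
    have h2 := q_ne_zero hs
    have hd := sq_sub_one_ne_zero hs
    refine forall_of_sandwich hs (lowerOp hs 0 ∘ₗ LinearMap.mulLeft ℂ (normQ _ s))
      (LinearMap.mulLeft ℂ (normQ _ s) ∘ₗ lowerOp hs 0 +
        (s ^ 2)⁻¹ • (incrOp hs 0 ∘ₗ (scale _ s (s ^ 2)⁻¹).toLinearMap)) fun a b y => ?_
    simp only [LinearMap.comp_apply, LinearMap.mulLeft_apply, normQ_mul_sandwich hs,
      LinearMap.add_apply, LinearMap.smul_apply, AlgHom.toLinearMap_apply, scale_sandwich hs,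
      incrOp_zero_sandwich, lowerOp_zero_sandwich, map_smul, map_add, smul_smul, smul_add,
      Nat.add_sub_cancel, qInt_natCast, inv_pow]
    generalize s ^ 2 = q at h2 hd ⊢
    rw [show q - q⁻¹ = (q ^ 2 - 1) / q by field_simp]
    rcases a with _ | a
    · simp only [pow_zero, inv_one, sub_self, zero_div, zero_mul, zero_smul, mul_zero]
      match_scalars
      field_simp
      ring
    · simp only [Nat.add_sub_cancel]
      match_scalars <;> field_simp
      ring
  lower_one := by rw [← sandwich_zero_zero_one, lowerOp_zero_sandwich]; simp

theorem isLadder_last : IsLadder (lowerOp hs (Fin.last (N + 1))) (incrOp hs (Fin.last (N + 1))) where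
  scale_lower := by
    have h2 := q_ne_zero hs
    refine forall_of_sandwich hs ((scale _ s (s ^ 2)⁻¹).toLinearMap ∘ₗ lowerOp hs (Fin.last (N + 1)))
      (s ^ 2 • (lowerOp hs (Fin.last (N + 1)) ∘ₗ (scale _ s (s ^ 2)⁻¹).toLinearMap)) fun a b y => ?_
    simp only [LinearMap.comp_apply, LinearMap.smul_apply, AlgHom.toLinearMap_apply,
      lowerOp_last_sandwich, map_smul, scale_sandwich hs, smul_smul]
    rcases b with _ | b
    · simp
    · simp only [Nat.add_sub_cancel, inv_pow]
      match_scalars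
      field_simp
      ring
  scale_incr := by
    have h2 := q_ne_zero hs
    refine forall_of_sandwich hs ((scale _ s (s ^ 2)⁻¹).toLinearMap ∘ₗ incrOp hs (Fin.last (N + 1)))
      ((s ^ 2)⁻¹ • (incrOp hs (Fin.last (N + 1)) ∘ₗ (scale _ s (s ^ 2)⁻¹).toLinearMap)) fun a b y => ?_
    simp only [LinearMap.comp_apply, LinearMap.smul_apply, AlgHom.toLinearMap_apply,
      incrOp_last_sandwich, map_smul, scale_sandwich hs, smul_smul]
    match_scalars
    ring
  incr_normQ := by
    have h2 := q_ne_zero hs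
    refine forall_of_sandwich hs (incrOp hs (Fin.last (N + 1)) ∘ₗ LinearMap.mulLeft ℂ (normQ _ s))
      (LinearMap.mulLeft ℂ (normQ _ s) ∘ₗ incrOp hs (Fin.last (N + 1))) fun a b y => ?_
    simp only [LinearMap.comp_apply, LinearMap.mulLeft_apply, normQ_mul_sandwich hs,
      incrOp_last_sandwich, map_smul, map_add, smul_smul, smul_add]
    match_scalars
    · field_simp
      ring
    · ring
  lower_normQ := by
    have h2 := q_ne_zero hs
    have hd := sq_sub_one_ne_zero hs
    refine forall_of_sandwich hs (lowerOp hs (Fin.last (N + 1)) ∘ₗ LinearMap.mulLeft ℂ (normQ _ s))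
      (LinearMap.mulLeft ℂ (normQ _ s) ∘ₗ lowerOp hs (Fin.last (N + 1)) +
        (s ^ 2)⁻¹ • (incrOp hs (Fin.last (N + 1)) ∘ₗ (scale _ s (s ^ 2)⁻¹).toLinearMap)) fun a b y => ?_
    simp only [LinearMap.comp_apply, LinearMap.mulLeft_apply, normQ_mul_sandwich hs,
      LinearMap.add_apply, LinearMap.smul_apply, AlgHom.toLinearMap_apply, scale_sandwich hs,
      incrOp_last_sandwich, lowerOp_last_sandwich, map_smul, map_add, smul_smul, smul_add,
      Nat.add_sub_cancel, qInt_natCast, inv_pow]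
    generalize s ^ 2 = q at h2 hd ⊢
    rw [show q - q⁻¹ = (q ^ 2 - 1) / q by field_simp]
    rcases b with _ | b
    · simp only [pow_zero, inv_one, sub_self, zero_div, zero_mul, zero_smul, mul_zero]
      match_scalars
      field_simp
      ring
    · simp only [Nat.add_sub_cancel]
      match_scalars <;> field_simp
      ring
  lower_one := by rw [← sandwich_zero_zero_one, lowerOp_last_sandwich]; simp

theorem isLadder_short : IsLadder (lowerShort hs) (incrShort hs) := by
  have h0 := hs.1
  have h2 := q_ne_zero hs
  have h1 := one_add_q_ne_zero hs
  have h3 := one_sub_q_ne_zero hs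
  have hl : ∀ k : ℕ, lowerShort hs (x s 0 ^ k) =
      ((1 - (s ^ 2) ^ k) / (1 - s ^ 2) * (s * ((s ^ 2) ^ k)⁻¹)) • x s 0 ^ (k - 1) := by
    intro k
    rw [x_pow_eq_mon, lowerShort, onMon_mon, lower_const, x_pow_eq_mon, bInt, zpow_neg,
      zpow_natCast]
  have hi : ∀ k : ℕ, incrShort hs (x s 0 ^ k) = x s 0 ^ (k + 1) := by
    intro k
    rw [x_pow_eq_mon, incrShort, onMon_mon, x_pow_eq_mon]
    congr 1
    funext i
    rw [Subsingleton.elim i 0]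
    simp [incr]
  have hq : ∀ k : ℕ, normQ 1 s * x s 0 ^ k = (s * (1 + s ^ 2)⁻¹) • x s 0 ^ (k + 2) := by
    intro k
    rw [normQ, Q_fin_one, radFactor_eq hs, smul_mul_assoc, ← pow_add, add_comm 2 k]
    congr 1
    field_simp
  have hsc : ∀ k : ℕ, scale 1 s (s ^ 2)⁻¹ (x s 0 ^ k) = ((s ^ 2) ^ k)⁻¹ • x s 0 ^ k := by
    intro k
    rw [map_pow, scale_x, smul_pow, inv_pow]
  have key : ∀ f g : Module.End ℂ (Alg 1 s), (∀ k : ℕ, f (x s 0 ^ k) = g (x s 0 ^ k)) →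
      ∀ y, f y = g y := fun f g h =>
    linearMap_eq_of_mon hs fun ν => by rw [mon_fin_one]; exact h _
  refine ⟨?_, ?_, ?_, ?_, ?_⟩
  · refine key ((scale _ s (s ^ 2)⁻¹).toLinearMap ∘ₗ lowerShort hs)
      (s ^ 2 • (lowerShort hs ∘ₗ (scale _ s (s ^ 2)⁻¹).toLinearMap)) fun k => ?_
    simp only [LinearMap.comp_apply, LinearMap.smul_apply, AlgHom.toLinearMap_apply, hl, hsc,
      map_smul, smul_smul]
    rcases k with _ | k
    · simp
    · simp only [Nat.add_sub_cancel]
      match_scalars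
      field_simp
      ring
  · refine key ((scale _ s (s ^ 2)⁻¹).toLinearMap ∘ₗ incrShort hs)
      ((s ^ 2)⁻¹ • (incrShort hs ∘ₗ (scale _ s (s ^ 2)⁻¹).toLinearMap)) fun k => ?_
    simp only [LinearMap.comp_apply, LinearMap.smul_apply, AlgHom.toLinearMap_apply, hi, hsc,
      map_smul, smul_smul]
    match_scalars
    field_simp
    ring
  · refine key (incrShort hs ∘ₗ LinearMap.mulLeft ℂ (normQ _ s))
      (LinearMap.mulLeft ℂ (normQ _ s) ∘ₗ incrShort hs) fun k => ?_
    simp only [LinearMap.comp_apply, LinearMap.mulLeft_apply, hi, hq, map_smul]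
  · refine key (lowerShort hs ∘ₗ LinearMap.mulLeft ℂ (normQ _ s))
      (LinearMap.mulLeft ℂ (normQ _ s) ∘ₗ lowerShort hs +
        (s ^ 2)⁻¹ • (incrShort hs ∘ₗ (scale _ s (s ^ 2)⁻¹).toLinearMap)) fun k => ?_
    simp only [LinearMap.comp_apply, LinearMap.mulLeft_apply,
      LinearMap.add_apply, LinearMap.smul_apply, AlgHom.toLinearMap_apply, hl, hi, hq, hsc,
      map_smul, smul_smul]
    generalize hq' : s ^ 2 = q at h1 h2 h3
    rcases k with _ | k
    · simp only [pow_zero, sub_self, zero_div, zero_mul, zero_smul, zero_add]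
      match_scalars
      field_simp
      rw [hq']
      ring
    · simp only [Nat.add_sub_cancel, show k + 1 + 2 - 1 = k + 2 by omega,
        show k + 1 + 1 = k + 2 by omega]
      match_scalars
      field_simp
      rw [hq']
      ring
  · have := hl 0
    simpa using this

/-- An operator of the quantum algebra that commutes with the squared radius and preserves the
degree, and annihilates the constants. -/
structure CommutesRadius (E : Module.End ℂ (Alg N s)) : Prop where
  normQ_mul : ∀ p, E (normQ N s * p) = normQ N s * E p
  scale : ∀ p, E (scale N s (s ^ 2)⁻¹ p) = scale N s (s ^ 2)⁻¹ (E p)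
  one : E 1 = 0

theorem CommutesRadius.normQ_pow_mul {E : Module.End ℂ (Alg N s)} (h : CommutesRadius E) (k : ℕ)
    (p : Alg N s) : E (normQ N s ^ k * p) = normQ N s ^ k * E p := by
  induction k with
  | zero => simp
  | succ k ih => rw [pow_succ', mul_assoc, h.normQ_mul, ih, mul_assoc]

theorem CommutesRadius.normQ_pow {E : Module.End ℂ (Alg N s)} (h : CommutesRadius E) (k : ℕ) :
    E (normQ N s ^ k) = 0 := by
  have := h.normQ_pow_mul k 1
  rwa [mul_one, h.one, mul_zero] at this

theorem CommutesRadius.of_smul {E : Module.End ℂ (Alg N s)} {c : ℂ} (hc : c ≠ 0)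
    (h : CommutesRadius (c • E)) : CommutesRadius E where
  normQ_mul p := by
    have := h.normQ_mul p
    rw [LinearMap.smul_apply, LinearMap.smul_apply, mul_smul_comm] at this
    exact smul_right_injective _ hc this
  scale p := by
    have := h.scale p
    rw [LinearMap.smul_apply, LinearMap.smul_apply, map_smul] at this
    exact smul_right_injective _ hc this
  one := by
    have := h.one
    rw [LinearMap.smul_apply] at this
    exact (smul_eq_zero.1 this).resolve_left hc

include hs

/-- Operators that act on the inner variables only. -/
theorem CommutesRadius.of_inner {E : Module.End ℂ (Alg N s)} (h : CommutesRadius E)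
    {E' : Module.End ℂ (Alg (N + 2) s)} (h' : ∀ a b y, E' (sandwich a b y) = sandwich a b (E y)) :
    CommutesRadius E' where
  normQ_mul := by
    refine forall_of_sandwich hs (E' ∘ₗ LinearMap.mulLeft ℂ (normQ _ s))
      (LinearMap.mulLeft ℂ (normQ _ s) ∘ₗ E') fun a b y => ?_
    simp only [LinearMap.comp_apply, LinearMap.mulLeft_apply, normQ_mul_sandwich hs, map_add,
      map_smul, h', h.normQ_mul, h.scale]
  scale := by
    refine forall_of_sandwich hs (E' ∘ₗ (QuantumEuclid.scale _ s (s ^ 2)⁻¹).toLinearMap)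
      ((QuantumEuclid.scale _ s (s ^ 2)⁻¹).toLinearMap ∘ₗ E') fun a b y => ?_
    simp only [LinearMap.comp_apply, AlgHom.toLinearMap_apply, scale_sandwich hs, map_smul, h',
      h.scale]
  one := by rw [← sandwich_zero_zero_one, h', h.one, map_zero]

/-- The generators that mix outer and inner variables commute with the squared radius: the terms
with `δ (normQ y)` and with `x_1 x_N` compensate each other by the relations of a ladder. -/
theorem RaisesOuter.commutesRadius {δ η : Module.End ℂ (Alg N s)}
    {E : Module.End ℂ (Alg (N + 2) s)} (hE : RaisesOuter δ η E) (h : IsLadder δ η) :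
    CommutesRadius E where
  normQ_mul := by
    have h2 := q_ne_zero hs
    have hd := sq_sub_one_ne_zero hs
    refine forall_of_sandwich hs (E ∘ₗ LinearMap.mulLeft ℂ (normQ _ s))
      (LinearMap.mulLeft ℂ (normQ _ s) ∘ₗ E) fun a b y => ?_
    simp only [LinearMap.comp_apply, LinearMap.mulLeft_apply, normQ_mul_sandwich hs, map_add,
      map_smul, hE _ _ _, mul_sub, mul_smul_comm, h.scale_lower, h.scale_incr, h.incr_normQ,
      h.lower_normQ, Nat.add_sub_cancel, qInt_natCast]
    generalize s ^ 2 = q at h2 hd ⊢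
    rw [show q - q⁻¹ = (q ^ 2 - 1) / q by field_simp]
    rcases b with _ | b
    · simp only [pow_zero, inv_one, sub_self, zero_div, zero_mul, zero_smul]
      match_scalars <;> field_simp <;> ring
    · simp only [Nat.add_sub_cancel]
      match_scalars <;> field_simp <;> ring
  scale := by
    have h2 := q_ne_zero hs
    refine forall_of_sandwich hs (E ∘ₗ (QuantumEuclid.scale _ s (s ^ 2)⁻¹).toLinearMap)
      ((QuantumEuclid.scale _ s (s ^ 2)⁻¹).toLinearMap ∘ₗ E) fun a b y => ?_
    simp only [LinearMap.comp_apply, AlgHom.toLinearMap_apply, scale_sandwich hs, map_smul,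
      hE _ _ _, map_sub, h.scale_lower, h.scale_incr]
    rcases b with _ | b
    · simp only [Nat.cast_zero, qInt_zero, zero_mul, zero_smul]
      simp only [inv_pow, pow_add]
      match_scalars
      field_simp
    · simp only [Nat.add_sub_cancel, inv_pow, pow_add]
      match_scalars <;> field_simp
  one := by rw [← sandwich_zero_zero_one, hE, h.lower_one]; simp

theorem LowersOuter.commutesRadius {δ η : Module.End ℂ (Alg N s)}
    {F : Module.End ℂ (Alg (N + 2) s)} (hF : LowersOuter δ η F) (h : IsLadder δ η) :
    CommutesRadius F where
  normQ_mul := by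
    have h2 := q_ne_zero hs
    have hd := sq_sub_one_ne_zero hs
    refine forall_of_sandwich hs (F ∘ₗ LinearMap.mulLeft ℂ (normQ _ s))
      (LinearMap.mulLeft ℂ (normQ _ s) ∘ₗ F) fun a b y => ?_
    simp only [LinearMap.comp_apply, LinearMap.mulLeft_apply, normQ_mul_sandwich hs, map_add,
      map_smul, hF _ _ _, mul_sub, mul_smul_comm, h.scale_lower, h.scale_incr, h.incr_normQ,
      h.lower_normQ, Nat.add_sub_cancel, qInt_natCast]
    generalize s ^ 2 = q at h2 hd ⊢
    rw [show q - q⁻¹ = (q ^ 2 - 1) / q by field_simp]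
    rcases a with _ | a
    · simp only [pow_zero, inv_one, sub_self, zero_div, zero_mul, zero_smul]
      match_scalars <;> field_simp <;> ring
    · simp only [Nat.add_sub_cancel]
      match_scalars <;> field_simp <;> ring
  scale := by
    have h2 := q_ne_zero hs
    refine forall_of_sandwich hs (F ∘ₗ (QuantumEuclid.scale _ s (s ^ 2)⁻¹).toLinearMap)
      ((QuantumEuclid.scale _ s (s ^ 2)⁻¹).toLinearMap ∘ₗ F) fun a b y => ?_
    simp only [LinearMap.comp_apply, AlgHom.toLinearMap_apply, scale_sandwich hs, map_smul,
      hF _ _ _, map_sub, h.scale_lower, h.scale_incr]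
    rcases a with _ | a
    · simp only [Nat.cast_zero, qInt_zero, zero_mul, zero_smul]
      simp only [inv_pow, pow_add]
      match_scalars
      field_simp
    · simp only [Nat.add_sub_cancel, inv_pow, pow_add]
      match_scalars <;> field_simp
  one := by rw [← sandwich_zero_zero_one, hF, h.lower_one]; simp

end generators

/-! ### The generators and the inner algebra -/

section generators

variable {N : ℕ} {s : ℂ} (hs : Admissible s)

theorem rootFst_succ (hN : 3 ≤ N) {i : Fin ((N + 2) / 2)} {j : Fin (N / 2)}
    (hij : (i : ℕ) = j + 1) : rootFst i = emb (rootFst j) := by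
  ext
  rw [emb_val, rootFst, rootFst]
  simp only [Nat.even_iff]
  split_ifs <;> simp only [] <;> omega

theorem rootSnd_succ {i : Fin ((N + 2) / 2)} {j : Fin (N / 2)}
    (hij : (i : ℕ) = j + 1) : rootSnd i = emb (rootSnd j) := by
  ext
  rw [emb_val, rootSnd, rootSnd]
  simp only []
  omega

/-- The generators of the inner algebra act on the inner variables only, by the generators for `N`. -/
theorem genAct_E_succ (hN : 3 ≤ N) {i : Fin ((N + 2) / 2)} {j : Fin (N / 2)}
    (hij : (i : ℕ) = j + 1) (a b : ℕ) (y : Alg N s) :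
    genAct hs (.E i) (sandwich a b y) = sandwich a b (genAct hs (.E j) y) := by
  simp only [genAct, rootFst_succ hN hij, rootSnd_succ hij, rev_emb, emb_inj]
  split_ifs
  · exact raiseShort_emb_sandwich hs _ _ a b y
  · exact raise_emb_sandwich hs _ _ a b y

theorem genAct_F_succ (hN : 3 ≤ N) {i : Fin ((N + 2) / 2)} {j : Fin (N / 2)}
    (hij : (i : ℕ) = j + 1) (a b : ℕ) (y : Alg N s) :
    genAct hs (.F i) (sandwich a b y) = sandwich a b (genAct hs (.F j) y) := by
  simp only [genAct, rootFst_succ hN hij, rootSnd_succ hij, rev_emb, emb_inj]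
  split_ifs
  · exact descendShort_emb_sandwich hs _ _ a b y
  · exact descend_emb_sandwich hs _ _ a b y

theorem rootFst_zero {i : Fin ((N + 2) / 2)} (hi : (i : ℕ) = 0) : rootFst i = 0 := by
  ext
  rw [rootFst]
  split_ifs <;> simp [hi]

theorem rootSnd_zero {i : Fin ((N + 2 + 2) / 2)} (hi : (i : ℕ) = 0) : rootSnd i = emb 0 := by
  ext
  rw [emb_val, rootSnd]
  simp [hi]

theorem emb_zero_ne_rev : emb (0 : Fin (N + 2)) ≠ (emb (0 : Fin (N + 2))).rev := by
  rw [rev_emb, Ne, emb_inj, Fin.rev_zero]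
  exact zero_lt_last.ne

theorem genAct_E_zero {i : Fin ((N + 2 + 2) / 2)} (hi : (i : ℕ) = 0) :
    genAct hs (.E i) = raise hs 0 (emb 0) := by
  simp only [genAct, rootFst_zero hi, rootSnd_zero hi, if_neg emb_zero_ne_rev]

theorem genAct_F_zero {i : Fin ((N + 2 + 2) / 2)} (hi : (i : ℕ) = 0) :
    genAct hs (.F i) = descend hs 0 (emb 0) := by
  simp only [genAct, rootFst_zero hi, rootSnd_zero hi, if_neg emb_zero_ne_rev]

theorem rootFst_three (i : Fin ((1 + 2) / 2)) : rootFst i = 0 := rootFst_zero (by omega)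

theorem rootSnd_three (i : Fin ((1 + 2) / 2)) : rootSnd i = emb (0 : Fin 1) := by
  ext
  simp [rootSnd, emb_val]

theorem genAct_E_three (i : Fin ((1 + 2) / 2)) :
    genAct (N := 1 + 2) hs (.E i) = raiseShort hs 0 (emb 0) := by
  simp only [genAct, rootFst_three i, rootSnd_three i]
  rw [if_pos]
  rw [rev_emb]
  rfl

theorem genAct_F_three (i : Fin ((1 + 2) / 2)) :
    genAct (N := 1 + 2) hs (.F i) = descendShort hs 0 (emb 0) := by
  simp only [genAct, rootFst_three i, rootSnd_three i]
  rw [if_pos]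
  rw [rev_emb]
  rfl

theorem rootFst_four {i : Fin ((2 + 2) / 2)} (hi : (i : ℕ) = 1) : rootFst i = 0 := by
  ext
  simp [rootFst, hi, Nat.even_iff]

theorem rootSnd_four {i : Fin ((2 + 2) / 2)} (hi : (i : ℕ) = 1) :
    rootSnd i = emb (Fin.last 1) := by
  ext
  simp [rootSnd, hi, emb_val]

theorem emb_last_ne_rev : emb (Fin.last 1) ≠ (emb (Fin.last 1)).rev := by decide

theorem genAct_E_four {i : Fin ((2 + 2) / 2)} (hi : (i : ℕ) = 1) :
    genAct (N := 2 + 2) hs (.E i) = raise hs 0 (emb (Fin.last 1)) := by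
  simp only [genAct, rootFst_four hi, rootSnd_four hi]
  exact if_neg emb_last_ne_rev

theorem genAct_F_four {i : Fin ((2 + 2) / 2)} (hi : (i : ℕ) = 1) :
    genAct (N := 2 + 2) hs (.F i) = descend hs 0 (emb (Fin.last 1)) := by
  simp only [genAct, rootFst_four hi, rootSnd_four hi]
  exact if_neg emb_last_ne_rev

theorem commutesRadius_raise_zero :
    CommutesRadius (raise hs 0 (emb (0 : Fin (N + 2)))) :=
  (raisesOuter_raise hs 0).commutesRadius hs (isLadder_zero hs)

theorem commutesRadius_of_neg {E : Module.End ℂ (Alg N s)} (h : CommutesRadius (-E)) :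
    CommutesRadius E := CommutesRadius.of_smul (c := -1) (by norm_num) (by rwa [neg_one_smul ℂ E])

theorem commutesRadius_descend_zero :
    CommutesRadius (descend hs 0 (emb (0 : Fin (N + 2)))) :=
  commutesRadius_of_neg ((lowersOuter_descend hs 0).commutesRadius hs (by
    rw [Fin.rev_zero]; exact isLadder_last hs))

/-- The generators `E_i` and `F_i` of `U_q(so_N)`, `N ≥ 3`, commute with the squared radius. -/
theorem commutesRadius_genAct : ∀ (N : ℕ), 3 ≤ N → ∀ i : Fin (N / 2),
    CommutesRadius (genAct hs (.E i)) ∧ CommutesRadius (genAct hs (.F i))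
  | 0, h, _ => by omega
  | 1, h, _ => by omega
  | 2, h, _ => by omega
  | 3, _, i => by
    constructor
    · rw [genAct_E_three hs i]
      exact (raisesOuter_raiseShort hs).commutesRadius hs (isLadder_short hs)
    · rw [genAct_F_three hs i]
      exact CommutesRadius.of_smul hs.1 (commutesRadius_of_neg
        ((lowersOuter_descendShort hs).commutesRadius hs (isLadder_short hs)))
  | 4, _, i => by
    obtain hi | hi : (i : ℕ) = 0 ∨ (i : ℕ) = 1 := by omega
    · rw [genAct_E_zero (N := 0) hs hi, genAct_F_zero (N := 0) hs hi]
      exact ⟨commutesRadius_raise_zero hs, commutesRadius_descend_zero hs⟩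
    · rw [genAct_E_four hs hi, genAct_F_four hs hi]
      exact ⟨(raisesOuter_raise hs _).commutesRadius hs (isLadder_last hs), commutesRadius_of_neg
        ((lowersOuter_descend hs _).commutesRadius hs (by
          rw [Fin.rev_last]; exact isLadder_zero hs))⟩
  | N + 5, _, i => by
    rcases Nat.eq_zero_or_pos (i : ℕ) with hi | hi
    · rw [genAct_E_zero (N := N + 1) hs hi, genAct_F_zero (N := N + 1) hs hi]
      exact ⟨commutesRadius_raise_zero hs, commutesRadius_descend_zero hs⟩
    · have hj : (i : ℕ) = (⟨i - 1, by omega⟩ : Fin ((N + 3) / 2)) + 1 := by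
        simp only []; omega
      have ih := commutesRadius_genAct (N + 3) (by omega) ⟨i - 1, by omega⟩
      exact ⟨ih.1.of_inner hs (genAct_E_succ hs (by omega) hj),
        ih.2.of_inner hs (genAct_F_succ hs (by omega) hj)⟩

end generators

/-! ### Polynomials of weight zero -/

/-- The polynomials of weight zero: the span of the monomials `x ^ ν` with `ν_i = ν_{i'}` for
all `i`. -/
def zeroWeight {N : ℕ} {s : ℂ} (hs : Admissible s) : Submodule ℂ (Alg N s) where
  carrier := {p | ∀ ν, (monBasis hs).repr p ν ≠ 0 → ∀ i, ν i = ν i.rev}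
  zero_mem' := fun ν h => absurd (by simp) h
  add_mem' := fun {p r} hp hr ν h => by
    by_cases h1 : (monBasis hs).repr p ν = 0
    · refine hr ν fun h2 => h ?_
      rw [map_add, Finsupp.add_apply, h1, h2, add_zero]
    · exact hp ν h1
  smul_mem' := fun c p hp ν h => hp ν fun h1 => h (by
    rw [map_smul, Finsupp.smul_apply, h1, smul_zero])

section weight

variable {N : ℕ} {s : ℂ} (hs : Admissible s)

/-- A polynomial has weight zero if and only if only the diagonal components occur and these have
weight zero. -/
theorem mem_zeroWeight_iff_comp {p : Alg (N + 2) s} : p ∈ zeroWeight hs ↔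
    (∀ a b, a ≠ b → comp hs a b p = 0) ∧ ∀ a, comp hs a a p ∈ zeroWeight hs := by
  constructor
  · refine fun hp => ⟨fun a b hab => ?_, fun a ν hν i => ?_⟩
    · apply (monBasis hs).repr.injective
      ext ν
      rw [repr_comp, map_zero, Finsupp.zero_apply]
      by_contra h
      have := hp _ h 0
      rw [Fin.rev_zero, wrap_zero, wrap_last] at this
      exact hab this
    · rw [repr_comp] at hν
      have := hp _ hν (emb i)
      rwa [rev_emb, wrap_emb, wrap_emb] at this
  · rintro ⟨h1, h2⟩ ν hν
    rw [← wrap_eta ν] at hν ⊢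
    generalize ν 0 = a at *
    generalize ν (Fin.last (N + 1)) = b at *
    generalize (fun i => ν (emb i)) = μ at *
    rw [← repr_comp] at hν
    have hab : a = b := by
      by_contra hne
      rw [h1 a b hne] at hν
      simp at hν
    subst hab
    intro k
    rcases fin_cases2 k with rfl | rfl | ⟨i, rfl⟩
    · simp
    · simp
    · rw [rev_emb, wrap_emb, wrap_emb]
      exact h2 a μ hν i

theorem onMon_diag_mem_zeroWeight (c : (Fin N → ℕ) → ℂ) {p : Alg N s} (hp : p ∈ zeroWeight hs) :
    onMon hs (fun μ => c μ • mon s μ) p ∈ zeroWeight hs := fun ν hν => hp ν fun h => hν (by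
  rw [repr_onMon_diag, h, mul_zero])

theorem onMon_diag_eq_self_iff (c : (Fin N → ℕ) → ℂ) {p : Alg N s} :
    onMon hs (fun μ => c μ • mon s μ) p = p ↔
      ∀ ν, (monBasis hs).repr p ν ≠ 0 → c ν = 1 := by
  constructor
  · intro h ν hν
    have h1 := congrArg (fun r => (monBasis hs).repr r ν) h
    simp only [repr_onMon_diag] at h1
    exact mul_right_cancel₀ hν (by rw [h1, one_mul])
  · intro h
    apply (monBasis hs).repr.injective
    ext ν
    rw [repr_onMon_diag]
    by_cases h1 : (monBasis hs).repr p ν = 0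
    · rw [h1, mul_zero]
    · rw [h ν h1, one_mul]

theorem scale_mem_zeroWeight (c : ℂ) {p : Alg N s} (hp : p ∈ zeroWeight hs) :
    scale N s c p ∈ zeroWeight hs := by
  rw [scale_eq_onMon hs]
  exact onMon_diag_mem_zeroWeight hs _ hp

theorem normQ_mul_mem_zeroWeight : ∀ (N : ℕ) (p : Alg N s), p ∈ zeroWeight hs →
    normQ N s * p ∈ zeroWeight hs
  | 0, _, _ => fun _ _ i => i.elim0
  | 1, _, _ => fun ν _ i => congrArg ν (Subsingleton.elim _ _)
  | N + 2, p, hp => by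
    rw [mem_zeroWeight_iff_comp] at hp ⊢
    refine ⟨fun a b hab => ?_, fun a => ?_⟩
    · by_cases h : a = 0 ∨ b = 0
      · rw [comp_normQ_mul hs h, hp.1 a b hab, mul_zero, smul_zero]
      · obtain ⟨a, rfl⟩ : ∃ a', a = a' + 1 := ⟨a - 1, by omega⟩
        obtain ⟨b, rfl⟩ : ∃ b', b = b' + 1 := ⟨b - 1, by omega⟩
        rw [comp_succ_normQ_mul, hp.1 _ _ hab, hp.1 _ _ (by omega)]
        simp
    · rcases a with _ | a
      · rw [comp_normQ_mul hs (Or.inl rfl)]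
        exact Submodule.smul_mem _ _ (normQ_mul_mem_zeroWeight N _ (hp.2 0))
      · rw [comp_succ_normQ_mul]
        exact Submodule.add_mem _ (scale_mem_zeroWeight hs _ (hp.2 a))
          (Submodule.smul_mem _ _ (normQ_mul_mem_zeroWeight N _ (hp.2 (a + 1))))

theorem normQ_pow_mul_mem_zeroWeight (k : ℕ) {p : Alg N s} (hp : p ∈ zeroWeight hs) :
    normQ N s ^ k * p ∈ zeroWeight hs := by
  induction k with
  | zero => simpa using hp
  | succ k ih =>
    rw [pow_succ', mul_assoc]
    exact normQ_mul_mem_zeroWeight hs N _ ih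

theorem one_mem_zeroWeight : (1 : Alg N s) ∈ zeroWeight hs := by
  intro ν hν
  rw [← mon_zero, repr_mon] at hν
  have : ν = 0 := by
    by_contra h
    exact hν (Finsupp.single_eq_of_ne h)
  subst this
  intro i
  rfl

theorem outerPow_mem_zeroWeight (a : ℕ) : outerPow N s a ∈ zeroWeight hs := by
  rw [mem_zeroWeight_iff_comp]
  refine ⟨fun b c hbc => ?_, fun b => ?_⟩
  · rw [outerPow, comp_sandwich, if_neg (by omega)]
  · rw [outerPow, comp_sandwich]
    split_ifs
    · exact one_mem_zeroWeight hs
    · exact Submodule.zero_mem _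

theorem phi_mem_zeroWeight (h : ℕ) : phi (N + 2) s h h ∈ zeroWeight hs := by
  rw [phi_eq hs]
  exact Submodule.sum_mem _ fun k _ => Submodule.smul_mem _ _
    (normQ_pow_mul_mem_zeroWeight hs k (outerPow_mem_zeroWeight hs _))

end weight

/-! ### Invariants are polynomials in the squared radius -/

section invariants

variable {N : ℕ} {s : ℂ} (hs : Admissible s)

theorem RaisesOuter.comp_apply {δ η : Module.End ℂ (Alg N s)} {E : Module.End ℂ (Alg (N + 2) s)}
    (hE : RaisesOuter δ η E) (a b : ℕ) (p : Alg (N + 2) s) :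
    comp hs (a + 1) b (E p) = (s ^ 2) ^ (a + 1) • δ (comp hs a b p) -
      (qInt s ((b + 1 : ℕ) : ℤ) * ((s ^ 2) ^ (a + 2) * ((s ^ 2) ^ (b + 1))⁻¹)) •
        η (comp hs (a + 1) (b + 1) p) := by
  refine forall_of_sandwich hs (comp hs (a + 1) b ∘ₗ E)
    ((s ^ 2) ^ (a + 1) • (δ ∘ₗ comp hs a b) -
      (qInt s ((b + 1 : ℕ) : ℤ) * ((s ^ 2) ^ (a + 2) * ((s ^ 2) ^ (b + 1))⁻¹)) •
        (η ∘ₗ comp hs (a + 1) (b + 1))) (fun c d y => ?_) p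
  simp only [LinearMap.comp_apply, LinearMap.sub_apply, LinearMap.smul_apply, hE _ _ _, map_sub,
    map_smul, comp_sandwich, add_left_inj]
  congr 1
  · by_cases h : a = c ∧ b = d
    · rw [if_pos h, if_pos h, h.1]
    · rw [if_neg h, if_neg h, map_zero, smul_zero, smul_zero]
  · rcases d with _ | d
    · simp
    · simp only [Nat.add_sub_cancel, add_left_inj]
      by_cases h : a + 1 = c ∧ b = d
      · rw [if_pos h, if_pos h, ← h.1, h.2]
      · rw [if_neg h, if_neg h, map_zero, smul_zero, smul_zero]

/-- A polynomial annihilated by a raising generator is determined by its component of degree zero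
in the outer variables. -/
theorem RaisesOuter.eq_zero {δ η : Module.End ℂ (Alg N s)} {E : Module.End ℂ (Alg (N + 2) s)}
    (hE : RaisesOuter δ η E) (hη : Function.Injective η) {p : Alg (N + 2) s}
    (hp : p ∈ zeroWeight hs) (hEp : E p = 0) (h0 : comp hs 0 0 p = 0) : p = 0 := by
  rw [mem_zeroWeight_iff_comp] at hp
  have h : ∀ a, comp hs a a p = 0 := by
    intro a
    induction a with
    | zero => exact h0
    | succ a ih =>
      have h1 := hE.comp_apply hs a a p
      rw [hEp, ih, map_zero, map_zero, smul_zero, zero_sub, eq_comm, neg_eq_zero,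
        smul_eq_zero] at h1
      rcases h1 with h1 | h1
      · refine absurd h1 (mul_ne_zero (qInt_ne_zero hs (by omega)) (mul_ne_zero ?_ (inv_ne_zero ?_)))
        · exact pow_ne_zero _ (q_ne_zero hs)
        · exact pow_ne_zero _ (q_ne_zero hs)
      · exact hη (by rw [h1, map_zero])
  refine eq_zero_of_comp hs fun a b => ?_
  by_cases hab : a = b
  · subst hab; exact h a
  · exact hp.1 a b hab

/-- The polynomials in the squared radius. -/
def radial (N : ℕ) (s : ℂ) : Submodule ℂ (Alg N s) :=
  Submodule.span ℂ (Set.range fun k : ℕ => normQ N s ^ k)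

theorem radial_le_zeroWeight : radial N s ≤ zeroWeight hs := by
  rw [radial, Submodule.span_le]
  rintro _ ⟨k, rfl⟩
  simpa using normQ_pow_mul_mem_zeroWeight hs k (one_mem_zeroWeight hs)

theorem CommutesRadius.apply_radial {E : Module.End ℂ (Alg N s)} (h : CommutesRadius E) {p : Alg N s}
    (hp : p ∈ radial N s) : E p = 0 := by
  have : radial N s ≤ LinearMap.ker E := by
    rw [radial, Submodule.span_le]
    rintro _ ⟨k, rfl⟩
    exact h.normQ_pow k
  exact this hp

theorem comp_one : comp hs 0 0 (1 : Alg (N + 2) s) = 1 := by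
  rw [← sandwich_zero_zero_one, comp_sandwich, if_pos ⟨rfl, rfl⟩]

/-- The powers of the squared radius in the inner variables are, up to nonzero factors, the lowest
components of those in all variables. -/
theorem exists_radial_comp {y : Alg N s} (hy : y ∈ radial N s) :
    ∃ r ∈ radial (N + 2) s, comp hs 0 0 r = y := by
  have : radial N s ≤ (radial (N + 2) s).map (comp hs 0 0) := by
    rw [radial, Submodule.span_le]
    rintro _ ⟨k, rfl⟩
    refine ⟨((s ^ 2) ^ k)⁻¹ • normQ (N + 2) s ^ k,
      Submodule.smul_mem _ _ (Submodule.subset_span ⟨k, rfl⟩), ?_⟩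
    have := comp_normQ_pow_mul hs k (1 : Alg (N + 2) s)
    rw [mul_one, comp_one, mul_one] at this
    rw [map_smul, this, smul_smul, inv_mul_cancel₀ (pow_ne_zero _ (q_ne_zero hs)), one_smul]
  exact this hy

/-- The induction step for invariants: subtracting a polynomial in the squared radius with the same
lowest component leaves an invariant with lowest component zero. -/
theorem RaisesOuter.mem_radial {δ η : Module.End ℂ (Alg N s)} {E : Module.End ℂ (Alg (N + 2) s)}
    (hE : RaisesOuter δ η E) (h : IsLadder δ η) (hη : Function.Injective η) {p : Alg (N + 2) s}
    (hp : p ∈ zeroWeight hs) (hEp : E p = 0) (h0 : comp hs 0 0 p ∈ radial N s) :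
    p ∈ radial (N + 2) s := by
  obtain ⟨r, hr, hr0⟩ := exists_radial_comp hs h0
  have h1 : p - r = 0 := hE.eq_zero hs hη
    (Submodule.sub_mem _ hp (radial_le_zeroWeight hs hr))
    (by rw [map_sub, hEp, (hE.commutesRadius hs h).apply_radial hr, sub_zero])
    (by rw [map_sub, hr0, sub_self])
  rwa [sub_eq_zero.1 h1]

theorem incrOp_zero_injective : Function.Injective (incrOp hs (0 : Fin (N + 2))) := by
  have h : ∀ a b (p : Alg (N + 2) s), comp hs a (b + 1) (incrOp hs 0 p) =
      ((s ^ 2) ^ b * ((s ^ 2) ^ a)⁻¹) • comp hs a b p := by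
    intro a b p
    refine linearMap_eq_of_sandwich hs (f := comp hs a (b + 1) ∘ₗ incrOp hs 0)
      (g := ((s ^ 2) ^ b * ((s ^ 2) ^ a)⁻¹) • comp hs a b) (fun c d ν => ?_) p
    rw [LinearMap.comp_apply, LinearMap.smul_apply, incrOp_zero_sandwich, map_smul, comp_sandwich,
      comp_sandwich]
    simp only [add_left_inj]
    by_cases h : a = c ∧ b = d
    · rw [h.1, h.2]
    · rw [if_neg h, smul_zero, smul_zero]
  rw [injective_iff_map_eq_zero]
  intro p hp
  refine eq_zero_of_comp hs fun a b => ?_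
  have := h a b p
  rw [hp, map_zero, eq_comm, smul_eq_zero] at this
  exact this.resolve_left (mul_ne_zero (pow_ne_zero _ (q_ne_zero hs))
    (inv_ne_zero (pow_ne_zero _ (q_ne_zero hs))))

theorem repr_incrShort_succ (k : ℕ) (p : Alg 1 s) :
    (monBasis hs).repr (incrShort hs p) (fun _ => k + 1) = (monBasis hs).repr p fun _ => k := by
  refine linearMap_eq_of_mon hs (f := (monBasis hs).coord (fun _ => k + 1) ∘ₗ incrShort hs)
    (g := (monBasis hs).coord fun _ => k) (fun ν => ?_) p
  rw [LinearMap.comp_apply, incrShort, onMon_mon, Module.Basis.coord_apply,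
    Module.Basis.coord_apply, repr_mon, repr_mon, Finsupp.single_apply, Finsupp.single_apply]
  congr 1
  simp [funext_iff, incr]

theorem repr_incrShort_zero (p : Alg 1 s) :
    (monBasis hs).repr (incrShort hs p) (fun _ => 0) = 0 := by
  refine linearMap_eq_of_mon hs (f := (monBasis hs).coord (fun _ => 0) ∘ₗ incrShort hs)
    (g := 0) (fun ν => ?_) p
  rw [LinearMap.comp_apply, incrShort, onMon_mon, Module.Basis.coord_apply, repr_mon,
    Finsupp.single_eq_of_ne]
  · rfl
  · simp [funext_iff, incr]

theorem repr_lowerShort (k : ℕ) (p : Alg 1 s) :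
    (monBasis hs).repr (lowerShort hs p) (fun _ => k) =
      (bInt s ((k + 1 : ℕ) : ℤ) * (s * (s ^ 2) ^ (-((k + 1 : ℕ) : ℤ)))) *
        (monBasis hs).repr p fun _ => k + 1 := by
  refine linearMap_eq_of_mon hs (f := (monBasis hs).coord (fun _ => k) ∘ₗ lowerShort hs)
    (g := (bInt s ((k + 1 : ℕ) : ℤ) * (s * (s ^ 2) ^ (-((k + 1 : ℕ) : ℤ)))) •
      (monBasis hs).coord fun _ => k + 1) (fun ν => ?_) p
  rw [LinearMap.comp_apply, lowerShort, onMon_mon, map_smul, LinearMap.smul_apply,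
    Module.Basis.coord_apply, Module.Basis.coord_apply, repr_mon, repr_mon]
  obtain ⟨l, rfl⟩ : ∃ l, ν = fun _ => l := ⟨ν 0, by funext i; rw [Subsingleton.elim i 0]⟩
  rw [lower_const, Finsupp.single_apply, Finsupp.single_apply]
  simp only [funext_iff, forall_const]
  rcases l with _ | l
  · simp [bInt]
  · simp only [Nat.add_sub_cancel, add_left_inj]
    by_cases h : l = k
    · rw [h]
    · rw [if_neg h, smul_zero, smul_zero]

theorem incrShort_injective : Function.Injective (incrShort hs) := by
  rw [injective_iff_map_eq_zero]
  intro p hp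
  apply (monBasis hs).repr.injective
  ext ν
  obtain ⟨l, rfl⟩ : ∃ l, ν = fun _ => l := ⟨ν 0, by funext i; rw [Subsingleton.elim i 0]⟩
  rw [← repr_incrShort_succ, hp]
  simp

/-- In three variables, the odd powers of the middle variable cannot occur in an invariant. -/
theorem comp_mem_radial_one {E : Module.End ℂ (Alg (1 + 2) s)}
    (hE : RaisesOuter (lowerShort hs) (incrShort hs) E) {p : Alg (1 + 2) s} (hEp : E p = 0) :
    comp hs 0 0 p ∈ radial 1 s := by
  have h2 := q_ne_zero hs
  have key : ∀ k a, (monBasis hs).repr (comp hs a a p) (fun _ => 2 * k + 1) = 0 := by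
    intro k
    have step : ∀ a j, (monBasis hs).repr (incrShort hs (comp hs (a + 1) (a + 1) p))
        (fun _ => j) = 0 → (monBasis hs).repr (comp hs a a p) (fun _ => j + 1) = 0 := by
      intro a j hj
      have h1 := congrArg (fun r => (monBasis hs).repr r fun _ => j) (hE.comp_apply hs a a p)
      simp only [hEp, map_zero, map_sub, map_smul, Finsupp.zero_apply, Finsupp.sub_apply,
        Finsupp.smul_apply, hj, repr_lowerShort, smul_eq_mul] at h1
      rw [mul_zero, sub_zero, eq_comm, mul_eq_zero, mul_eq_zero] at h1
      exact (h1.resolve_left (pow_ne_zero _ h2)).resolve_left (mul_ne_zero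
        (bInt_ne_zero hs (by omega)) (mul_ne_zero hs.1 (zpow_ne_zero _ h2)))
    induction k with
    | zero => exact fun a => step a 0 (repr_incrShort_zero hs _)
    | succ k ih =>
      intro a
      refine step a (2 * k + 2) ?_
      rw [show 2 * k + 2 = (2 * k + 1) + 1 from rfl, repr_incrShort_succ]
      exact ih (a + 1)
  have h3 := mem_span_mon hs (P := fun ν : Fin 1 → ℕ => Even (ν 0)) (p := comp hs 0 0 p) (by
    intro ν hν
    obtain ⟨l, rfl⟩ : ∃ l, ν = fun _ => l := ⟨ν 0, by funext i; rw [Subsingleton.elim i 0]⟩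
    by_contra hl
    obtain ⟨k, rfl⟩ := Nat.not_even_iff_odd.1 hl
    exact hν (key k 0))
  refine Submodule.span_le.2 ?_ h3
  rintro _ ⟨ν, ⟨k, hk⟩, rfl⟩
  have e2 : mon s ν = radFactor 1 s ^ k • normQ 1 s ^ k := by
    rw [← smul_pow, ← Q_eq_normQ hs, Q_fin_one, mon_fin_one, hk, ← pow_mul, two_mul]
  rw [e2]
  exact Submodule.smul_mem _ _ (Submodule.subset_span ⟨k, rfl⟩)

/-- In two variables, `normQ` is `x_1 x_2`, and weight zero alone suffices. -/
theorem zeroWeight_two_le_radial : zeroWeight (N := 2) hs ≤ radial 2 s := by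
  intro p hp
  refine Submodule.span_le.2 ?_ (mem_span_mon hs (P := fun ν => ∀ i, ν i = ν i.rev) hp)
  rintro _ ⟨ν, hν, rfl⟩
  have h0 : ν (Fin.last 1) = ν 0 := (hν 0).symm
  have hQ : normQ 0 s = 0 := by simp [normQ, Q]
  have h : ∀ a : ℕ, sandwich a a (1 : Alg 0 s) = normQ 2 s ^ a := by
    intro a
    induction a with
    | zero => rw [sandwich_zero_zero_one, pow_zero]
    | succ a ih =>
      rw [pow_succ', ← ih, normQ_mul_sandwich (N := 0) hs, hQ, zero_mul, map_zero, smul_zero,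
        add_zero, map_one (scale 0 s (s ^ 2)⁻¹)]
  refine Submodule.subset_span ⟨ν 0, ?_⟩
  rw [← wrap_eta (N := 0) ν, ← sandwich_mon, h0]
  have e : (fun i : Fin 0 => ν (emb i)) = 0 := Subsingleton.elim _ _
  rw [e, mon_zero]
  exact (h (ν 0)).symm

/-- Operators that act on the inner variables only commute with taking components. -/
theorem comp_of_inner {E : Module.End ℂ (Alg N s)} {E' : Module.End ℂ (Alg (N + 2) s)}
    (h : ∀ a b y, E' (sandwich a b y) = sandwich a b (E y)) (a b : ℕ) (p : Alg (N + 2) s) :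
    comp hs a b (E' p) = E (comp hs a b p) := by
  refine forall_of_sandwich hs (comp hs a b ∘ₗ E') (E ∘ₗ comp hs a b) (fun c d y => ?_) p
  rw [LinearMap.comp_apply, LinearMap.comp_apply, h, comp_sandwich, comp_sandwich]
  split_ifs
  · rfl
  · rw [map_zero]

/-- Polynomials of weight zero annihilated by all raising generators are polynomials in the squared
radius. -/
theorem mem_radial_of_invariant : ∀ (N : ℕ), 2 ≤ N → ∀ p : Alg N s, p ∈ zeroWeight hs →
    (3 ≤ N → ∀ i : Fin (N / 2), genAct hs (.E i) p = 0) → p ∈ radial N s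
  | 0, h, _, _, _ => by omega
  | 1, h, _, _, _ => by omega
  | 2, _, p, hp, _ => zeroWeight_two_le_radial hs hp
  | 3, _, p, hp, hE => by
    have h := raisesOuter_raiseShort hs
    have hE0 := hE le_rfl ⟨0, by omega⟩
    rw [genAct_E_three hs ⟨0, by omega⟩] at hE0
    exact h.mem_radial hs (isLadder_short hs) (incrShort_injective hs) hp hE0
      (comp_mem_radial_one hs h hE0)
  | N + 4, _, p, hp, hE => by
    have h := raisesOuter_raise hs (0 : Fin (N + 2))
    have hE0 := hE (by omega) ⟨0, by omega⟩
    rw [genAct_E_zero hs rfl] at hE0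
    refine h.mem_radial hs (isLadder_zero hs) (incrOp_zero_injective hs) hp hE0
      (mem_radial_of_invariant (N + 2) (by omega) _ ((mem_zeroWeight_iff_comp hs).1 hp |>.2 0) ?_)
    intro hN j
    rw [← comp_of_inner hs (genAct_E_succ hs hN (i := ⟨j + 1, by omega⟩) (j := j) rfl),
      hE (by omega), map_zero]

end invariants

/-! ### Zonal harmonic polynomials -/

section degree

variable {N : ℕ} {s : ℂ} (hs : Admissible s)

theorem comp_mem_homog {m : ℕ} {p : Alg (N + 2) s} (hp : p ∈ homog (N + 2) s m) :
    comp hs 0 0 p ∈ homog N s m := by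
  refine mem_span_mon hs (P := fun ν => ∑ i, ν i = m) fun ν hν => ?_
  rw [repr_comp] at hν
  rw [mem_homog_iff hs, scale_eq_onMon hs] at hp
  have h1 := congrArg (fun r => (monBasis hs).repr r (wrap 0 0 ν)) hp
  simp only [repr_onMon_diag, map_smul, Finsupp.smul_apply, smul_eq_mul] at h1
  have h2 := eq_of_q_pow_eq hs (mul_right_cancel₀ hν h1)
  rwa [sum_wrap, zero_add, add_zero] at h2

/-- The projection onto the homogeneous polynomials of degree `m`. -/
def homogPart (m : ℕ) : Module.End ℂ (Alg N s) :=
  onMon hs fun ν => (if ∑ i, ν i = m then 1 else 0 : ℂ) • mon s ν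

theorem homogPart_of_mem {m k : ℕ} {p : Alg N s} (hp : p ∈ homog N s k) :
    homogPart hs m p = if k = m then p else 0 := by
  refine (homog_induction (f := homogPart hs m) (g := if k = m then LinearMap.id else 0)
    (fun ν hν => ?_) hp).trans (by split_ifs <;> rfl)
  rw [homogPart, onMon_mon, hν]
  split_ifs
  · rw [one_smul]; rfl
  · rw [zero_smul]; rfl

theorem normQ_pow_mem_homog (hs : Admissible s) (k : ℕ) : normQ N s ^ k ∈ homog N s (2 * k) := by
  have h : (1 : Alg N s) ∈ homog N s 0 := by
    rw [← mon_zero]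
    simpa using mon_mem_homog s (0 : Fin N → ℕ)
  simpa using normQ_pow_mul_mem_homog hs k h

/-- The projection onto a degree selects at most one power of the squared radius. -/
theorem mem_span_normQ_pow (hs : Admissible s) {m : ℕ} {p : Alg N s} (hp : p ∈ radial N s)
    (hm : p ∈ homog N s m) :
    p ∈ Submodule.span ℂ {r | ∃ k : ℕ, 2 * k = m ∧ r = normQ N s ^ k} := by
  have h : radial N s ≤ (Submodule.span ℂ {r | ∃ k : ℕ, 2 * k = m ∧ r = normQ N s ^ k}).comap
      (homogPart hs m) := by
    rw [radial, Submodule.span_le]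
    rintro _ ⟨k, rfl⟩
    rw [SetLike.mem_coe, Submodule.mem_comap, homogPart_of_mem hs (normQ_pow_mem_homog hs k)]
    split_ifs with hk
    · exact Submodule.subset_span ⟨k, hk, rfl⟩
    · exact Submodule.zero_mem _
  have := h hp
  rwa [Submodule.mem_comap, homogPart_of_mem hs hm, if_pos rfl] at this

theorem comp_redLap (a : ℕ) (p : Alg (N + 2) s) :
    comp hs a a (redLap hs p) = qInt s ((a + 1 : ℕ) : ℤ) ^ 2 • comp hs (a + 1) (a + 1) p +
      (s ^ 2) ^ (a + a + 1) • redLap hs (comp hs a a p) := by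
  refine forall_of_sandwich hs (comp hs a a ∘ₗ redLap hs)
    (qInt s ((a + 1 : ℕ) : ℤ) ^ 2 • comp hs (a + 1) (a + 1) +
      (s ^ 2) ^ (a + a + 1) • (redLap hs ∘ₗ comp hs a a)) (fun c d y => ?_) p
  simp only [LinearMap.comp_apply, LinearMap.add_apply, LinearMap.smul_apply, redLap_sandwich,
    map_add, map_smul, comp_sandwich]
  congr 1
  · rcases c with _ | c
    · simp
    · rcases d with _ | d
      · simp
      · simp only [Nat.add_sub_cancel, add_left_inj]
        by_cases h : a = c ∧ a = d
        · rw [← h.1, ← h.2, if_pos ⟨rfl, rfl⟩, pow_two]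
        · rw [if_neg h, smul_zero, smul_zero]
  · by_cases h : a = c ∧ a = d
    · rw [if_pos h, if_pos h, ← h.1, ← h.2]
    · rw [if_neg h, if_neg h, map_zero, smul_zero, smul_zero]

/-- A harmonic polynomial of weight zero is determined by its component of degree zero in the outer
variables: the recursion for the `q`-Laplace operator determines the component at
`x_1 ^ (a + 1) x_N ^ (a + 1)` from the one at `x_1 ^ a x_N ^ a`. -/
theorem eq_zero_of_mem_harmonic {m : ℕ} {p : Alg (N + 2) s} (hp : p ∈ harmonic (N + 2) hs m)
    (hw : p ∈ zeroWeight hs) (h0 : comp hs 0 0 p = 0) : p = 0 := by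
  have hL : redLap hs p = 0 := by
    have h1 := hp.2
    rw [SetLike.mem_coe, LinearMap.mem_ker, laplace_of_homog hs hp.1, smul_eq_zero] at h1
    exact h1.resolve_left (mul_ne_zero (radFactor_ne_zero hs _) (zpow_ne_zero _ (q_ne_zero hs)))
  rw [mem_zeroWeight_iff_comp] at hw
  have h : ∀ a, comp hs a a p = 0 := by
    intro a
    induction a with
    | zero => exact h0
    | succ a ih =>
      have h1 := comp_redLap hs a p
      rw [hL, ih, map_zero, map_zero, smul_zero, add_zero, eq_comm, smul_eq_zero] at h1
      exact h1.resolve_left (pow_ne_zero _ (qInt_ne_zero hs (by omega)))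
  refine eq_zero_of_comp hs fun a b => ?_
  by_cases hab : a = b
  · subst hab; exact h a
  · exact hw.1 a b hab

/-- Only the last summand of `φ`, a multiple of `Q ^ h`, has a nonzero lowest component. -/
theorem comp_phi (h : ℕ) : comp hs 0 0 (phi (N + 2) s h h) =
    (phiCoeff (N + 2) s h h h * radFactor (N + 2) s ^ h * (s ^ 2) ^ h) • normQ N s ^ h := by
  rw [phi_eq hs, map_sum, Finset.sum_eq_single h]
  · rw [map_smul, comp_normQ_pow_mul, smul_smul, Nat.sub_self, outerPow, comp_sandwich,
      if_pos ⟨rfl, rfl⟩, mul_one]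
  · intro k hk hne
    have := Finset.mem_range.1 hk
    rw [map_smul, comp_normQ_pow_mul, outerPow, comp_sandwich, if_neg (by omega), mul_zero,
      smul_zero, smul_zero]
  · intro h1
    exact absurd (Finset.mem_range.2 (Nat.lt_succ_self h)) h1

theorem comp_phi_coeff_ne_zero (hs : Admissible s) (N h : ℕ) :
    phiCoeff (N + 2) s h h h * radFactor (N + 2) s ^ h * (s ^ 2) ^ h ≠ 0 :=
  mul_ne_zero (mul_ne_zero (phiCoeff_ne_zero hs N h h le_rfl)
    (pow_ne_zero _ (radFactor_ne_zero hs _))) (pow_ne_zero _ (q_ne_zero hs))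

theorem phi_ne_zero (hs : Admissible s) (hN : 2 ≤ N) (h : ℕ) : phi (N + 2) s h h ≠ 0 := by
  obtain ⟨M, rfl⟩ : ∃ M, N = M + 2 := ⟨N - 2, by omega⟩
  intro h0
  have h1 := comp_phi (N := M + 2) hs h
  rw [h0, map_zero, eq_comm, smul_eq_zero] at h1
  exact h1.elim (comp_phi_coeff_ne_zero hs _ h) (normQ_pow_ne_zero hs h)

end degree

section zonal

variable {N : ℕ} {s : ℂ} (hs : Admissible s)

theorem genAct_of_mem_zonal {m : ℕ} {p : Alg N s} (hp : p ∈ zonal N hs m) {g : Gen N}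
    (hg : g ∈ gensSO2 N ∪ gensInner N) : genAct hs g p = genCounit g • p := by
  have := hp.2 _ (Algebra.subset_adjoin (Set.mem_image_of_mem _ hg))
  rwa [action, counit, FreeAlgebra.lift_ι_apply, FreeAlgebra.lift_ι_apply] at this

/-- It suffices to check invariance on the generators. -/
theorem mem_zonal_of_gens {m : ℕ} {p : Alg N s} (hp : p ∈ harmonic N hs m)
    (h : ∀ g ∈ gensSO2 N ∪ gensInner N, genAct hs g p = genCounit g • p) :
    p ∈ zonal N hs m := by
  refine ⟨hp, fun X hX => ?_⟩
  induction hX using Algebra.adjoin_induction with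
  | mem X hX =>
    obtain ⟨g, hg, rfl⟩ := hX
    rw [action, counit, FreeAlgebra.lift_ι_apply, FreeAlgebra.lift_ι_apply, h g hg]
  | algebraMap c => rw [AlgHom.commutes, AlgHom.commutes]; rfl
  | add X Y _ _ hX hY => rw [map_add, map_add, LinearMap.add_apply, hX, hY, add_smul]
  | mul X Y _ _ hX hY =>
    rw [map_mul, map_mul, Module.End.mul_apply, hY, map_smul, hX, smul_smul, mul_comm]

/-- A weight vanishes if it vanishes on the first coordinate and on the simple roots of the inner
algebra. -/
theorem wt_eq_zero_of_roots (hN : 5 ≤ N) {ν : Fin N → ℕ} (h0 : ∀ i : Fin N, (i : ℕ) = 0 → wt ν i = 0)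
    (h : ∀ i : Fin (N / 2), 0 < (i : ℕ) → wt ν (rootFst i) = wt ν (rootSnd i)) (i : Fin N) :
    wt ν i = 0 := by
  have hrev : ∀ k l : Fin N, (k : ℕ) + l + 1 = N → wt ν k = -wt ν l := by
    intro k l hkl
    have : l = k.rev := by ext; rw [Fin.val_rev]; omega
    rw [this, wt, wt, Fin.rev_rev]
    ring
  -- For odd `N` the last simple root is the weight of `x_n` alone. For even `N` the last two roots are
  -- the difference and the sum of the last two coordinates.
  have hlast : ∀ k : Fin N, (k : ℕ) + 1 = N / 2 → wt ν k = 0 := by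
    intro k hk
    have h1 := h ⟨N / 2 - 1, by omega⟩ (by simp only []; omega)
    rcases Nat.even_or_odd N with he | ho
    · have h2 := h ⟨N / 2 - 2, by omega⟩ (by simp only []; rw [Nat.even_iff] at he; omega)
      have he' := Nat.even_iff.1 he
      rw [rootFst, if_pos ⟨by simp only []; omega, he⟩] at h1
      rw [rootFst, if_neg (by simp only []; omega)] at h2
      have e1 : rootSnd (⟨N / 2 - 2, by omega⟩ : Fin (N / 2)) = k := by
        ext; simp only [rootSnd]; omega
      have e2 := hrev (rootSnd (⟨N / 2 - 1, by omega⟩ : Fin (N / 2))) k (by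
        simp only [rootSnd]; omega)
      have e3 : (⟨N / 2 - 1 - 1, by omega⟩ : Fin N) = ⟨N / 2 - 2, by omega⟩ := by
        ext; simp only []; omega
      rw [e2] at h1
      rw [e1] at h2
      simp only [] at h1 h2
      rw [e3] at h1
      omega
    · rw [rootFst, if_neg (by rw [Nat.not_even_iff_odd.symm] at ho; tauto)] at h1
      have ho' := Nat.odd_iff.1 ho
      have e1 : (⟨N / 2 - 1, by omega⟩ : Fin N) = k := by ext; simp only []; omega
      have e2 := hrev (rootSnd (⟨N / 2 - 1, by omega⟩ : Fin (N / 2)))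
        (rootSnd (⟨N / 2 - 1, by omega⟩ : Fin (N / 2))) (by simp only [rootSnd]; omega)
      simp only [] at h1
      rw [e1] at h1
      omega
  -- from there the other simple roots lead down to the second coordinate
  have hhalf : ∀ j : ℕ, ∀ k : Fin N, 0 < (k : ℕ) → (k : ℕ) + 1 + j = N / 2 → wt ν k = 0 := by
    intro j
    induction j with
    | zero => exact fun k _ hk => hlast k hk
    | succ j ih =>
      intro k hk hkj
      have h1 := h ⟨k, by omega⟩ hk
      rw [rootFst, if_neg (by simp only []; omega)] at h1
      exact h1.trans (ih _ (by simp only [rootSnd]; omega) (by simp only [rootSnd]; omega))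
  have hlow : ∀ k : Fin N, (k : ℕ) < N / 2 → wt ν k = 0 := by
    intro k hk
    rcases Nat.eq_zero_or_pos (k : ℕ) with h1 | h1
    · exact h0 k h1
    · exact hhalf (N / 2 - (k + 1)) k h1 (by omega)
  rcases lt_or_ge (i : ℕ) (N / 2) with hi | hi
  · exact hlow i hi
  · have e := hrev i i.rev (by rw [Fin.val_rev]; omega)
    rcases lt_or_ge (i.rev : ℕ) (N / 2) with hi' | hi'
    · rw [e, hlow _ hi', neg_zero]
    · have : i.rev = i := by ext; rw [Fin.val_rev] at hi' ⊢; omega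
      rw [this] at e
      omega

/-- The generators `K̂_i` and `K_i` force the weight of a zonal polynomial to be zero. -/
theorem zonal_le_zeroWeight (hN : 4 ≤ N) (m : ℕ) : zonal N hs m ≤ zeroWeight hs := by
  intro p hp ν hν
  have hK : ∀ i : Fin (N / 2), Gen.Khat i ∈ gensSO2 N ∪ gensInner N → wt ν (coordIdx i) = 0 := by
    intro i hi
    have h1 := genAct_of_mem_zonal hs hp hi
    rw [genAct, genCounit, one_smul, onMon_diag_eq_self_iff] at h1
    exact eq_zero_of_q_zpow hs (h1 ν hν)
  suffices h : ∀ i, wt ν i = 0 by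
    intro i
    have := h i
    rw [wt] at this
    omega
  have h0 : ∀ i : Fin N, (i : ℕ) = 0 → wt ν i = 0 := fun i hi => by
    have := hK ⟨0, by omega⟩ (Or.inl ⟨_, rfl, Or.inl rfl⟩)
    rwa [show i = coordIdx (⟨0, by omega⟩ : Fin (N / 2)) from Fin.ext hi]
  rcases Nat.eq_or_lt_of_le hN with rfl | hN
  · have h1 := hK ⟨1, by omega⟩ (Or.inr (by
      rw [gensInner, if_pos rfl]; exact ⟨_, rfl, Or.inl rfl⟩))
    have h0 := h0 0 rfl
    simp only [coordIdx, wt] at h0 h1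
    intro i
    fin_cases i
    · exact h0
    · exact h1
    · simp only [wt]
      exact (sub_eq_zero.2 (sub_eq_zero.1 h1).symm)
    · simp only [wt]
      exact (sub_eq_zero.2 (sub_eq_zero.1 h0).symm)
  · refine wt_eq_zero_of_roots hN h0 fun i hi => ?_
    have h1 := genAct_of_mem_zonal hs hp (g := .K i) (Or.inr (by
      rw [gensInner, if_neg (by omega)]; exact ⟨_, hi, Or.inl rfl⟩))
    rw [genAct, genCounit, one_smul, onMon_diag_eq_self_iff] at h1
    exact sub_eq_zero.1 (eq_zero_of_q_zpow hs (h1 ν hν))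

theorem comp_mem_radial_of_mem_zonal (hN : 2 ≤ N) {m : ℕ} {p : Alg (N + 2) s}
    (hp : p ∈ zonal (N + 2) hs m) : comp hs 0 0 p ∈ radial N s := by
  have hw := (mem_zeroWeight_iff_comp hs).1 (zonal_le_zeroWeight hs (by omega) m hp) |>.2 0
  refine mem_radial_of_invariant hs N hN _ hw fun hN3 j => ?_
  have h1 := genAct_of_mem_zonal hs hp (g := .E ⟨j + 1, by omega⟩) (Or.inr (by
    rw [gensInner, if_neg (by omega)]
    exact ⟨_, Nat.succ_pos _, Or.inr (Or.inr (Or.inl rfl))⟩))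
  rw [← comp_of_inner hs (genAct_E_succ hs hN3 (i := ⟨j + 1, by omega⟩) (j := j) rfl), h1,
    genCounit, zero_smul, map_zero]

/-- A zonal polynomial is determined by its component of degree zero in the outer variables, which
is a multiple of a power of the squared radius in the inner variables. -/
theorem comp_mem_span_of_mem_zonal (hN : 2 ≤ N) {m : ℕ} {p : Alg (N + 2) s}
    (hp : p ∈ zonal (N + 2) hs m) : comp hs 0 0 p ∈
      Submodule.span ℂ {r | ∃ k : ℕ, 2 * k = m ∧ r = normQ N s ^ k} :=
  have hm : p ∈ homog (N + 2) s m := hp.1.1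
  mem_span_normQ_pow hs (comp_mem_radial_of_mem_zonal hs hN hp) (comp_mem_homog hs hm)

/-- An operator on the inner variables that commutes with the squared radius and annihilates the
constants also annihilates `φ`, a polynomial in `Q`, `x_1` and `x_N`. -/
theorem apply_phi_eq_zero (hs : Admissible s) {E : Module.End ℂ (Alg N s)}
    {E' : Module.End ℂ (Alg (N + 2) s)}
    (h : CommutesRadius E) (h' : ∀ a b y, E' (sandwich a b y) = sandwich a b (E y)) (k : ℕ) :
    E' (phi (N + 2) s k k) = 0 := by
  rw [phi_eq hs, map_sum]
  refine Finset.sum_eq_zero fun l _ => ?_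
  rw [map_smul, (h.of_inner hs h').normQ_pow_mul, outerPow, h', h.one, map_zero, mul_zero,
    smul_zero]

theorem onMon_weight_of_mem_zeroWeight {p : Alg N s} (hp : p ∈ zeroWeight hs)
    {f : (Fin N → ℕ) → ℤ} (hf : ∀ ν, (∀ i, wt ν i = 0) → f ν = 0) :
    onMon hs (fun ν => (s ^ 2) ^ f ν • mon s ν) p = p := by
  rw [onMon_diag_eq_self_iff]
  intro ν hν
  rw [hf ν fun i => by rw [wt, hp ν hν i, sub_self], zpow_zero]

theorem phi_mem_zonal (hN : 2 ≤ N) (h : ℕ) :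
    phi (N + 2) s h h ∈ zonal (N + 2) hs (h + h) := by
  refine mem_zonal_of_gens hs (phi_mem_harmonic hs N h) fun g hg => ?_
  have hw := phi_mem_zeroWeight (N := N) hs h
  have hinner : ∀ i : Fin ((N + 2) / 2), 0 < (i : ℕ) → 3 ≤ N →
      genAct hs (.E i) (phi (N + 2) s h h) = 0 ∧ genAct hs (.F i) (phi (N + 2) s h h) = 0 := by
    intro i hi hN3
    have hij : (i : ℕ) = (⟨i - 1, by omega⟩ : Fin (N / 2)) + 1 := by simp only []; omega
    have hc := commutesRadius_genAct hs N hN3 ⟨i - 1, by omega⟩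
    exact ⟨apply_phi_eq_zero hs hc.1 (genAct_E_succ hs hN3 hij) h,
      apply_phi_eq_zero hs hc.2 (genAct_F_succ hs hN3 hij) h⟩
  have hgen : (∃ i : Fin ((N + 2) / 2), g = .E i ∨ g = .F i) → 3 ≤ N ∧
      ∃ i : Fin ((N + 2) / 2), 0 < (i : ℕ) ∧ (g = .E i ∨ g = .F i) := by
    rintro ⟨i, hi⟩
    rcases hg with ⟨j, _, hj⟩ | hg
    · rcases hi with rfl | rfl <;> simp at hj
    · rw [gensInner] at hg
      split_ifs at hg with hN4
      · obtain ⟨j, _, hj⟩ := hg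
        rcases hi with rfl | rfl <;> simp at hj
      · obtain ⟨j, hj0, hj⟩ := hg
        refine ⟨by omega, j, hj0, ?_⟩
        rcases hi with rfl | rfl <;> simpa using hj
  rcases g with i | i | i | i | i | i
  · rw [genCounit, one_smul]
    exact onMon_weight_of_mem_zeroWeight hs hw fun ν hν => hν _
  · rw [genCounit, one_smul]
    exact onMon_weight_of_mem_zeroWeight hs hw fun ν hν => by rw [hν, neg_zero]
  · rw [genCounit, one_smul]
    exact onMon_weight_of_mem_zeroWeight hs hw fun ν hν => by rw [hν, hν, sub_zero]
  · rw [genCounit, one_smul]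
    exact onMon_weight_of_mem_zeroWeight hs hw fun ν hν => by rw [hν, hν, sub_zero, neg_zero]
  · obtain ⟨hN3, j, hj, h1⟩ := hgen ⟨i, Or.inl rfl⟩
    have : i = j := by simpa using h1
    rw [genCounit, zero_smul]
    exact (hinner i (this ▸ hj) hN3).1
  · obtain ⟨hN3, j, hj, h1⟩ := hgen ⟨i, Or.inr rfl⟩
    have : i = j := by simpa using h1
    rw [genCounit, zero_smul]
    exact (hinner i (this ▸ hj) hN3).2

theorem zonal_even (hN : 2 ≤ N) (h : ℕ) :
    zonal (N + 2) hs (h + h) = Submodule.span ℂ {phi (N + 2) s h h} := by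
  refine le_antisymm (fun p hp => ?_) ?_
  · have h1 := comp_mem_span_of_mem_zonal hs hN hp
    have e : {r | ∃ k : ℕ, 2 * k = h + h ∧ r = normQ N s ^ k} = {normQ N s ^ h} := by
      ext r
      constructor
      · rintro ⟨k, hk, rfl⟩
        rw [show k = h by omega]
        rfl
      · rintro rfl
        exact ⟨h, two_mul h, rfl⟩
    rw [e, Submodule.mem_span_singleton] at h1
    obtain ⟨c, hc⟩ := h1
    have hne := comp_phi_coeff_ne_zero hs N h
    refine Submodule.mem_span_singleton.2
      ⟨c * (phiCoeff (N + 2) s h h h * radFactor (N + 2) s ^ h * (s ^ 2) ^ h)⁻¹, ?_⟩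
    rw [eq_comm, ← sub_eq_zero]
    refine eq_zero_of_mem_harmonic hs (m := h + h)
      (Submodule.sub_mem _ hp.1 (Submodule.smul_mem _ _ (phi_mem_harmonic hs N h)))
      (Submodule.sub_mem _ (zonal_le_zeroWeight hs (by omega) _ hp)
        (Submodule.smul_mem _ _ (phi_mem_zeroWeight hs h))) ?_
    rw [map_sub, map_smul, comp_phi, smul_smul, inv_mul_cancel_right₀ hne, hc, sub_self]
  · rw [Submodule.span_singleton_le_iff_mem]
    exact phi_mem_zonal hs hN h

theorem zonal_odd (hN : 2 ≤ N) {m : ℕ} (hm : ¬Even m) : zonal (N + 2) hs m = ⊥ := by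
  rw [eq_bot_iff]
  intro p hp
  have h1 := comp_mem_span_of_mem_zonal hs hN hp
  have e : {r | ∃ k : ℕ, 2 * k = m ∧ r = normQ N s ^ k} = ∅ := by
    ext r
    simp only [Set.mem_ofPred_eq, Set.mem_empty_iff_false, iff_false]
    rintro ⟨k, hk, _⟩
    exact hm ⟨k, by omega⟩
  rw [e, Submodule.span_empty, Submodule.mem_bot] at h1
  exact eq_zero_of_mem_harmonic hs hp.1 (zonal_le_zeroWeight hs (by omega) _ hp) h1

end zonal

end

end QuantumEuclid

theorem theorem2 (N : ℕ) [NeZero N] (hN : 4 ≤ N) (s : ℂ) (hs : QuantumEuclid.Admissible s)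
    (m : ℕ) :
    Module.rank ℂ (QuantumEuclid.zonal N hs m) ≤ 1 ∧
      (QuantumEuclid.zonal N hs m ≠ ⊥ ↔ Even m) ∧
      (Even m →
        QuantumEuclid.zonal N hs m =
            Submodule.span ℂ {QuantumEuclid.phi N s (m / 2) (m / 2)} ∧
          QuantumEuclid.phi N s (m / 2) (m / 2) =
            QuantumEuclid.harmonicProj N hs m
              (QuantumEuclid.x s 0 ^ (m / 2) * QuantumEuclid.x s (Fin.rev 0) ^ (m / 2))) := by
  obtain ⟨M, rfl⟩ : ∃ M, N = M + 2 := ⟨N - 2, by omega⟩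
  have hM : 2 ≤ M := by omega
  by_cases hm : Even m
  · obtain ⟨h, rfl⟩ := hm
    rw [show (h + h) / 2 = h by omega, QuantumEuclid.zonal_even hs hM h]
    refine ⟨(rank_span_le _).trans (by simp), ⟨fun _ => ⟨h, rfl⟩, fun _ => ?_⟩, fun _ => ⟨rfl, ?_⟩⟩
    · rw [Ne, Submodule.span_singleton_eq_bot]
      exact QuantumEuclid.phi_ne_zero hs hM h
    · have := QuantumEuclid.harmonicProj_outerPow hs M h
      rw [QuantumEuclid.outerPow, QuantumEuclid.sandwich_one, ← Fin.rev_zero] at this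
      exact this.symm
  · rw [QuantumEuclid.zonal_odd hs hM hm]
    exact ⟨by simp, by simpa using hm, fun h => absurd h hm⟩
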